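/- Let $G$ and $H$ be finitely generated groups, and let $G\wr H = G^{(H)}\rtimes H$ be their (restricted) wreath product: its elements are the pairs $(f,h)$ with $h\in H$ and $f\colon H\to G$ of finite support, with $(f_1,h_1)(f_2,h_2)=(f,h_1h_2)$, $f(x)=f_1(x)f_2(h_1^{-1}x)$. Fix arbitrary finite symmetric generating sets of $G$, $H$ and $G\wr H$. An *exponent expression* over a group $K$ with finite generating set $\Sigma$ is a formal expression $E=v_0u_1^{x_1}v_1\cdots u_k^{x_k}v_k$ with $k\ge 0$, words $u_i,v_i\in\Sigma^*$ and variables $x_1,\dots,x_k$ ranging over $\mathbb N$; it is a *knapsack expression* if the $x_i$ are pairwise distinct. A valuation $\nu$ of the variables is a solution of $E=1$ if the word $v_0u_1^{\nu(x_1)}v_1\cdots u_k^{\nu(x_k)}v_k$ represents $1$ in $K$. Let $\mathsf{Sol}(E)\subseteq\mathbb N^k$ denote the set of solutions of a knapsack expression $E$. - $\mathrm{KP}(K)$: given a knapsack expression $E$ over $K$, does $E=1$ have a solution? - $\mathrm{KP}(G^*)$: given $m\ge 0$ and a knapsack expression $E$ over the direct power $G^m$ (generated by the elements with a generator of $G$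 in one coordinate and $1$ in all others), does $E=1$ have a solution? - $\mathrm{ExpEq}(G)$: given a finite list $E_1,\dots,E_n$ of exponent expressions over $G$, is there a valuation that is a solution of all equations $E_1=1,\dots,E_n=1$? $H$ is *knapsack-semilinear* if for every knapsack expression $E$ over $H$ the set $\mathsf{Sol}(E)$ is semilinear, i.e. a finite union of sets $\{w_0+\lambda_1w_1+\cdots+\lambda_nw_n\mid\lambda_i\in\mathbb N\}$, and such a representation can be computed from $E$. **Theorem.** Let $H$ be knapsack-semilinear. 1. If $H$ is infinite, then $\mathrm{KP}(G\wr H)$ is decidable if and only if $\mathrm{KP}(G^*)$ is decidable. 2. Whether or not $H$ is infinite, if $\mathrm{KP}(G^*)$ is decidable, then $\mathrm{KP}(G\wr H)$ is decidable. 3. $\mathrm{KP}(G^*)$ is decidable if and only if $\mathrm{ExpEq}(G)$ is decidable. Hence in 1 and 2 one may replace $\mathrm{KP}(G^*)$ by $\mathrm{ExpEq}(G)$. -/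

import Mathlib

/-! ### Words, generating families, exponent expressions -/

/-- The element of the group `G` represented by the word `w` over the alphabet `A`, where the
letter `x` stands for `a x`. -/
def evalWord {A G : Type*} [Group G] (a : A → G) (w : List A) : G :=
  (w.map a).prod

/-- `a 0, …, a (n - 1)` enumerates a finite symmetric generating set of `G`: the set of
generators is closed under inverses, and every element of `G` is represented by a word. -/
def IsSymmGen {G : Type*} [Group G] {n : ℕ} (a : Fin n → G) : Prop :=
  (∀ i, ∃ j, a j = (a i)⁻¹) ∧ ∀ g : G, ∃ w : List (Fin n), evalWord a w = g

/-- An exponent expression `v₀ u₁^x₁ v₁ ⋯ u_k^x_k v_k` over the alphabet `A`, given as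
`(v₀, [(u₁, x₁, v₁), …, (u_k, x_k, v_k)])`. The `uᵢ` and `vᵢ` are words, the variables are named
by natural numbers and may repeat. -/
abbrev ExpExpr (A : Type*) : Type _ := List A × List (List A × ℕ × List A)

namespace ExpExpr

variable {A : Type*}

/-- The variables `x₁, …, x_k`, in the order in which they occur. -/
def vars (E : ExpExpr A) : List ℕ := E.2.map fun t => t.2.1

/-- The depth `k`. -/
def depth (E : ExpExpr A) : ℕ := E.vars.length

/-- A knapsack expression: every variable occurs at most once. -/
def IsKnapsack (E : ExpExpr A) : Prop := E.vars.Nodup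

/-- The word `ν(E) = v₀ u₁^ν(x₁) v₁ ⋯ u_k^ν(x_k) v_k`. -/
def subst (ν : ℕ → ℕ) (E : ExpExpr A) : List A :=
  E.1 ++ (E.2.map fun t => (List.replicate (ν t.2.1) t.1).flatten ++ t.2.2).flatten

/-- All letters of the words in `E` satisfy `P`. -/
def LettersIn (P : A → Prop) (E : ExpExpr A) : Prop :=
  (∀ x ∈ E.1, P x) ∧ ∀ t ∈ E.2, (∀ x ∈ t.1, P x) ∧ ∀ x ∈ t.2.2, P x

/-- The valuation `ν` is a solution of `E = 1` in the group `G`. -/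
def IsSolution {G : Type*} [Group G] (a : A → G) (E : ExpExpr A) (ν : ℕ → ℕ) : Prop :=
  evalWord a (E.subst ν) = 1

/-- The solution set of `E = 1` as a subset of `ℕ^k`: the tuples `(ν(x₁), …, ν(x_k))` for the
solutions `ν`. -/
def solSet {G : Type*} [Group G] (a : A → G) (E : ExpExpr A) : Set (Fin E.depth → ℕ) :=
  {s | ∃ ν : ℕ → ℕ, IsSolution a E ν ∧ ∀ i, s i = ν (E.vars.get i)}

end ExpExpr

/-! ### The decision problems -/

/-- The knapsack problem for `G` is decidable. -/
def KPDecidable {G : Type*} [Group G] {n : ℕ} (a : Fin n → G) : Prop :=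
  ComputablePred fun E : ExpExpr (Fin n) => E.IsKnapsack ∧ ∃ ν, E.IsSolution a ν

/-- Solvability of systems of exponent equations over `G` is decidable. -/
def ExpEqDecidable {G : Type*} [Group G] {n : ℕ} (a : Fin n → G) : Prop :=
  ComputablePred fun S : List (ExpExpr (Fin n)) => ∃ ν, ∀ E ∈ S, E.IsSolution a ν

/-- The letter `(i, s)` stands for the element of `G^m` with `a s` at coordinate `i` and `1` at
all other coordinates. The letters `(i, s)` with `i < m` generate `G^m`. -/
def powLetter {G : Type*} [Group G] {n : ℕ} (a : Fin n → G) (m : ℕ) (l : ℕ × Fin n) :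
    Fin m → G :=
  fun j => if (j : ℕ) = l.1 then a l.2 else 1

/-- The uniform knapsack problem for the powers of `G` is decidable: the input is a number `m`
together with a knapsack expression over the group `G^m`. -/
def KPPowersDecidable {G : Type*} [Group G] {n : ℕ} (a : Fin n → G) : Prop :=
  ComputablePred fun I : ℕ × ExpExpr (ℕ × Fin n) =>
    (I.2.LettersIn (fun l => l.1 < I.1) ∧ I.2.IsKnapsack) ∧
      ∃ ν, I.2.IsSolution (powLetter a I.1) ν

/-! ### Knapsack-semilinear groups -/

/-- The vector of `ℕ^k` whose entries are listed in `v` (filled up with zeros or cut off if the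
list does not have length `k`). -/
def listVec (k : ℕ) (v : List ℕ) : Fin k → ℕ := fun i => v.getD i 0

/-- The linear set `{v₀ + λ₁ v₁ + ⋯ + λ_n v_n | λ₁, …, λ_n ∈ ℕ}` in `ℕ^k` with linear
representation `(v₀, [v₁, …, v_n])`. -/
def linearSetOf (k : ℕ) (L : List ℕ × List (List ℕ)) : Set (Fin k → ℕ) :=
  {s | ∃ c : Fin L.2.length → ℕ, s = listVec k L.1 + ∑ i, c i • listVec k (L.2.get i)}

/-- The semilinear subset of `ℕ^k` with the given semilinear representation. -/
def semilinearSetOf (k : ℕ) (R : List (List ℕ × List (List ℕ))) : Set (Fin k → ℕ) :=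
  {s | ∃ L ∈ R, s ∈ linearSetOf k L}

/-- `H` is knapsack-semilinear: there is an algorithm that computes, from each knapsack
expression over `H`, a semilinear representation of its solution set. -/
def IsKnapsackSemilinear {H : Type*} [Group H] {n : ℕ} (b : Fin n → H) : Prop :=
  ∃ f : ExpExpr (Fin n) → List (List ℕ × List (List ℕ)), Computable f ∧
    ∀ E : ExpExpr (Fin n), E.IsKnapsack → E.solSet b = semilinearSetOf E.depth (f E)

/-! ### Wreath products -/

/-- The wreath product `G ≀ H = G^(H) ⋊ H`, as the subgroup of those elements `(f, h)` of the
unrestricted wreath product for which `f : H → G` has finite support. -/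
def wreath (G H : Type*) [Group G] [Group H] : Subgroup (G ≀ᵣ H) where
  carrier := {x | (Function.mulSupport x.left).Finite}
  one_mem' := by simp
  mul_mem' := by
    intro x y hx hy
    refine (hx.union (hy.image fun k => x.right * k)).subset fun k hk => ?_
    by_cases h : x.left k = 1
    · refine Or.inr ⟨x.right⁻¹ * k, ?_, by simp⟩
      simpa [Function.mem_mulSupport, h] using hk
    · exact Or.inl h
  inv_mem' := by
    intro x hx
    refine (hx.image fun k => x.right⁻¹ * k).subset fun k hk => ⟨x.right * k, ?_, by simp⟩
    simpa [Function.mem_mulSupport] using hk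

/-!
The claims follow from these implications.

* `KPPowersDecidable.expEq` and `ExpEqDecidable.kpPowers`: `KP(G^*)` and `ExpEq(G)` are
  equivalent. An equation over `G^m` is a system of `m` equations over `G`. Conversely, the
  equations of a system are put into different coordinates of a direct power. A variable may occur
  several times in the system, but only once in a knapsack expression, so that each occurrence
  `u^x` is replaced by `u^y` with a new variable `y`; a further coordinate with the value
  `u^x u^(-y)` ensures `u^x = u^y`.
* `KPDecidable.kpPowers`: if `H` is infinite, then `KP(G ≀ H)` decides `KP(G^*)`, since `G^m`
  embeds into `G ≀ H` by means of `m` different positions in `H`. Such positions can be computed,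
  because the word problem of `H` is decidable.
* `ExpEqDecidable.wreathLetter` with `KPDecidable.of_wreathLetter`: `ExpEq(G)` decides
  `KP(G ≀ H)`.

For the last implication, let `u₁^x₁ ⋯ u_k^x_k` be a product of powers of words over the standard
generators of `G ≀ H`. The `i`-th power visits a position `h : H` in its factor number `t` if
`h = g σᵢ^t w`, where `g` is the value of the preceding powers in `H`, `σᵢ` is the value of `uᵢ` in
`H`, and `w` is the value of a prefix of `uᵢ`. If `σᵢ` has infinite order, then only a bounded
number of factors around the factor `t` can visit `h`. If `σᵢ^D = 1`, then the contribution of the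
power to the value at `h` is a power `U^(xᵢ / D)` of an element of `G` up to a factor that depends
only on the remainder of `xᵢ` modulo `D`. In both cases, the contribution is determined by one of
finitely many local types, apart from the quotient `xᵢ / D`, which becomes a new variable. A type
consists of a local type for each power (`LocalType`, `posTypes`). Hence the value at `h` is a
product of powers over `G`, which depends only on the type of `h` (`powProd_contributions`), and
the product of powers is trivial if and only if it is trivial in `H` and the equations over `G` of
all types that occur are satisfied (`exists_powProd_eq_one_iff`).

The condition that only types from a given list occur is a first-order condition over the natural
numbers, built from linear equations and the solution sets of exponent equations over `H`. The
latter are semilinear as `H` is knapsack-semilinear, so that a semilinear representation of the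
condition can be computed. This is expressed by effectively semilinear families (`Eff`), which are
closed under Boolean operations and projections. For each linear set of the representation, the
coefficients of its periods are substituted for the variables in the equations over `G`, which
leaves a system of exponent equations (`ExpEqDecidable.exists_of_eff`).

For complements, Mathlib shows that they are semilinear, but provides no algorithm. A
representation of the complement is found by a search: that two representations are complementary
is verified by a certificate, namely the states of a finite automaton that reads the binary digits
of a vector and keeps track of the linear sets which contain the rest (`complCert`,
`exists_computable_compl`).
-/

/-! ### Computable functions and searches -/

attribute [fun_prop] Computable
attribute [fun_prop] Computable.id Computable.const Computable.comp

/-- Boolean equality test. Having a head symbol of its own, it is found by `fun_prop`. -/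
def eqTest {α : Type*} [DecidableEq α] (x y : α) : Bool := decide (x = y)

/-- Boolean comparison of natural numbers. -/
def leTest (x y : ℕ) : Bool := decide (x ≤ y)

/-- Boolean membership test for lists. -/
def memTest {α : Type*} [DecidableEq α] (x : α) (l : List α) : Bool := decide (x ∈ l)

@[simp]
theorem eqTest_iff {α : Type*} [DecidableEq α] {x y : α} : eqTest x y = true ↔ x = y := by
  simp [eqTest]

@[simp]
theorem eqTest_self {α : Type*} [DecidableEq α] (x : α) : eqTest x x = true := eqTest_iff.2 rfl

theorem eqTest_of_ne {α : Type*} [DecidableEq α] {x y : α} (h : x ≠ y) : eqTest x y = false := by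
  simp [eqTest, h]

@[simp]
theorem leTest_iff {x y : ℕ} : leTest x y = true ↔ x ≤ y := by simp [leTest]

@[simp]
theorem memTest_iff {α : Type*} [DecidableEq α] {x : α} {l : List α} :
    memTest x l = true ↔ x ∈ l := by simp [memTest]

namespace Computable

variable {α β γ σ : Type*} [Primcodable α] [Primcodable β] [Primcodable γ] [Primcodable σ]

@[fun_prop]
theorem mk_pair {f : α → β} {g : α → γ} (hf : Computable f) (hg : Computable g) :
    Computable fun a => (f a, g a) :=
  hf.pair hg

@[fun_prop]
theorem proj_fst {f : α → β × γ} (hf : Computable f) : Computable fun a => (f a).1 :=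
  Computable.fst.comp hf

@[fun_prop]
theorem proj_snd {f : α → β × γ} (hf : Computable f) : Computable fun a => (f a).2 :=
  Computable.snd.comp hf

@[fun_prop]
theorem mk_some {f : α → β} (hf : Computable f) : Computable fun a => some (f a) :=
  Computable.option_some.comp hf

@[fun_prop]
theorem add {f g : α → ℕ} (hf : Computable f) (hg : Computable g) :
    Computable fun a => f a + g a :=
  Primrec.nat_add.to_comp.comp hf hg

@[fun_prop]
theorem sub {f g : α → ℕ} (hf : Computable f) (hg : Computable g) :
    Computable fun a => f a - g a :=
  Primrec.nat_sub.to_comp.comp hf hg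

@[fun_prop]
theorem div {f g : α → ℕ} (hf : Computable f) (hg : Computable g) :
    Computable fun a => f a / g a :=
  Primrec.nat_div.to_comp.comp hf hg

@[fun_prop]
theorem mod {f g : α → ℕ} (hf : Computable f) (hg : Computable g) :
    Computable fun a => f a % g a :=
  Primrec.nat_mod.to_comp.comp hf hg

@[fun_prop]
theorem max_nat {f g : α → ℕ} (hf : Computable f) (hg : Computable g) :
    Computable fun a => max (f a) (g a) :=
  Primrec.nat_max.to_comp.comp hf hg

@[fun_prop]
theorem eqTest [DecidableEq β] {f g : α → β} (hf : Computable f) (hg : Computable g) :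
    Computable fun a => eqTest (f a) (g a) :=
  (Primrec.eq (α := β)).decide.to_comp.comp hf hg

@[fun_prop]
theorem leTest {f g : α → ℕ} (hf : Computable f) (hg : Computable g) :
    Computable fun a => leTest (f a) (g a) :=
  Primrec.nat_le.decide.to_comp.comp hf hg

@[fun_prop]
theorem bool_and {f g : α → Bool} (hf : Computable f) (hg : Computable g) :
    Computable fun a => f a && g a :=
  Primrec.and.to_comp.comp hf hg

@[fun_prop]
theorem bool_or {f g : α → Bool} (hf : Computable f) (hg : Computable g) :
    Computable fun a => f a || g a :=
  Primrec.or.to_comp.comp hf hg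

@[fun_prop]
theorem bool_not {f : α → Bool} (hf : Computable f) : Computable fun a => !(f a) :=
  Primrec.not.to_comp.comp hf

@[fun_prop]
theorem bool_cond {c : α → Bool} {f g : α → σ} (hc : Computable c) (hf : Computable f)
    (hg : Computable g) : Computable fun a => bif c a then f a else g a :=
  Computable.cond hc hf hg

@[fun_prop]
theorem list_mk_cons {f : α → β} {g : α → List β} (hf : Computable f) (hg : Computable g) :
    Computable fun a => f a :: g a :=
  Computable.list_cons.comp hf hg

@[fun_prop]
theorem append {f g : α → List β} (hf : Computable f) (hg : Computable g) :
    Computable fun a => f a ++ g a :=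
  Computable.list_append.comp hf hg

@[fun_prop]
theorem length {f : α → List β} (hf : Computable f) : Computable fun a => (f a).length :=
  Computable.list_length.comp hf

@[fun_prop]
theorem reverse {f : α → List β} (hf : Computable f) : Computable fun a => (f a).reverse :=
  Computable.list_reverse.comp hf

@[fun_prop]
theorem range {f : α → ℕ} (hf : Computable f) : Computable fun a => List.range (f a) :=
  Primrec.list_range.to_comp.comp hf

@[fun_prop]
theorem take {f : α → ℕ} {g : α → List β} (hf : Computable f) (hg : Computable g) :
    Computable fun a => (g a).take (f a) :=
  Primrec.list_take.to_comp.comp hf hg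

@[fun_prop]
theorem getElem? {f : α → List β} {g : α → ℕ} (hf : Computable f) (hg : Computable g) :
    Computable fun a => (f a)[g a]? :=
  Computable.list_getElem?.comp hf hg

@[fun_prop]
theorem getD {f : α → List β} {g : α → ℕ} {d : β} (hf : Computable f) (hg : Computable g) :
    Computable fun a => (f a).getD (g a) d :=
  (Primrec.list_getD d).to_comp.comp hf hg

@[fun_prop]
theorem foldl {f : α → List β} {g : α → σ} {h : α → σ → β → σ} (hf : Computable f)
    (hg : Computable g) (hh : Computable fun x : α × σ × β => h x.1 x.2.1 x.2.2) :
    Computable fun a => (f a).foldl (h a) (g a) := by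
  have key : Computable fun a => Nat.rec (motive := fun _ => σ) (g a)
      (fun n s => Option.casesOn (motive := fun _ => σ) (f a)[n]? s fun b => h a s b)
      (f a).length := by
    refine Computable.nat_rec (h := fun a (x : ℕ × σ) =>
      Option.casesOn (motive := fun _ => σ) (f a)[x.1]? x.2 fun b => h a x.2 b)
      (by fun_prop) hg ?_
    refine Computable.option_casesOn (by fun_prop) (by fun_prop) ?_
    exact hh.comp (f := fun x : α × σ × β => h x.1 x.2.1 x.2.2)
      (g := fun x : (α × ℕ × σ) × β => (x.1.1, x.1.2.2, x.2)) (by fun_prop)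
  refine key.of_eq fun a => ?_
  have : ∀ (l : List β) (n : ℕ), n ≤ l.length → Nat.rec (motive := fun _ => σ) (g a)
      (fun n s => Option.casesOn (motive := fun _ => σ) l[n]? s fun b => h a s b) n
      = (l.take n).foldl (h a) (g a) := by
    intro l n hn
    induction n with
    | zero => simp
    | succ n ih =>
      have hn' : n < l.length := hn
      simp only [ih (by omega), List.getElem?_eq_getElem hn']
      rw [List.take_add_one, List.getElem?_eq_getElem hn', List.foldl_append]
      rfl
  simpa using this (f a) _ le_rfl

@[fun_prop]
theorem foldr {f : α → List β} {g : α → σ} {h : α → β → σ → σ} (hf : Computable f)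
    (hg : Computable g) (hh : Computable fun x : α × β × σ => h x.1 x.2.1 x.2.2) :
    Computable fun a => (f a).foldr (h a) (g a) := by
  have : Computable fun a => (f a).reverse.foldl (fun s b => h a b s) (g a) :=
    foldl (h := fun a s b => h a b s) (by fun_prop) hg
      (hh.comp (f := fun x : α × β × σ => h x.1 x.2.1 x.2.2)
        (g := fun x : α × σ × β => (x.1, x.2.2, x.2.1)) (by fun_prop))
  exact this.of_eq fun a => by simp

@[fun_prop]
theorem map {f : α → List β} {g : α → β → σ} (hf : Computable f)
    (hg : Computable fun x : α × β => g x.1 x.2) : Computable fun a => (f a).map (g a) := by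
  have : Computable fun a => (f a).foldr (fun b s => g a b :: s) [] :=
    foldr hf (by fun_prop) (list_mk_cons
      (hg.comp (f := fun x : α × β => g x.1 x.2) (g := fun x : α × β × List σ => (x.1, x.2.1))
        (by fun_prop)) (by fun_prop))
  refine this.of_eq fun a => ?_
  induction f a <;> simp_all

@[fun_prop]
theorem flatMap {f : α → List β} {g : α → β → List σ} (hf : Computable f)
    (hg : Computable fun x : α × β => g x.1 x.2) : Computable fun a => (f a).flatMap (g a) := by
  have : Computable fun a => (f a).foldr (fun b s => g a b ++ s) [] :=
    foldr hf (by fun_prop) (append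
      (hg.comp (f := fun x : α × β => g x.1 x.2) (g := fun x : α × β × List σ => (x.1, x.2.1))
        (by fun_prop)) (by fun_prop))
  refine this.of_eq fun a => ?_
  induction f a <;> simp_all

@[fun_prop]
theorem flatten {f : α → List (List β)} (hf : Computable f) :
    Computable fun a => (f a).flatten :=
  Primrec.list_flatten.to_comp.comp hf

@[fun_prop]
theorem filter {f : α → List β} {g : α → β → Bool} (hf : Computable f)
    (hg : Computable fun x : α × β => g x.1 x.2) : Computable fun a => (f a).filter (g a) := by
  have : Computable fun a => (f a).flatMap (fun b => bif g a b then [b] else []) :=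
    flatMap hf (by fun_prop)
  refine this.of_eq fun a => ?_
  induction f a with
  | nil => rfl
  | cons b l ih => cases h : g a b <;> simp_all

@[fun_prop]
theorem any {f : α → List β} {g : α → β → Bool} (hf : Computable f)
    (hg : Computable fun x : α × β => g x.1 x.2) : Computable fun a => (f a).any (g a) := by
  have : Computable fun a => (f a).foldr (fun b s => g a b || s) false :=
    foldr hf (by fun_prop) (bool_or
      (hg.comp (f := fun x : α × β => g x.1 x.2) (g := fun x : α × β × Bool => (x.1, x.2.1))
        (by fun_prop)) (by fun_prop))
  refine this.of_eq fun a => ?_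
  induction f a <;> simp_all

@[fun_prop]
theorem all {f : α → List β} {g : α → β → Bool} (hf : Computable f)
    (hg : Computable fun x : α × β => g x.1 x.2) : Computable fun a => (f a).all (g a) := by
  have : Computable fun a => !((f a).any fun b => !(g a b)) := by fun_prop
  exact this.of_eq fun a => by simp [List.all_eq_not_any_not]

@[fun_prop]
theorem list_sum {f : α → List ℕ} (hf : Computable f) : Computable fun a => (f a).sum := by
  have : Computable fun a => (f a).foldr (fun b s => b + s) 0 := by fun_prop
  exact this.of_eq fun a => by simp [List.sum]

@[fun_prop]
theorem replicate {f : α → ℕ} {g : α → β} (hf : Computable f) (hg : Computable g) :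
    Computable fun a => List.replicate (f a) (g a) := by
  have : Computable fun a => (List.range (f a)).map fun _ => g a := by fun_prop
  exact this.of_eq fun a => by simp

@[fun_prop]
theorem memTest [DecidableEq β] {f : α → β} {g : α → List β} (hf : Computable f)
    (hg : Computable g) : Computable fun a => memTest (f a) (g a) := by
  have : Computable fun a => (g a).any fun b => _root_.eqTest b (f a) := by fun_prop
  exact this.of_eq fun a => by rw [Bool.eq_iff_iff]; simp

theorem of_finite [Finite β] (f : β → σ) : Computable f :=
  (Primrec.dom_finite f).to_comp

/-- A search that always succeeds defines a computable function. -/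
theorem exists_choice {check : α → β → Bool} (hc : Computable fun x : α × β => check x.1 x.2)
    (h : ∀ a, ∃ b, check a b = true) : ∃ f : α → β, Computable f ∧ ∀ a, check a (f a) = true := by
  let s : α → ℕ → Option β := fun a n =>
    (Encodable.decode (α := β) n).bind fun b => bif check a b then some b else none
  have hs : Computable₂ s := by
    refine Computable.option_bind (Computable.decode.comp Computable.snd) ?_
    exact Computable.cond (hc.comp (f := fun x : α × β => check x.1 x.2)
      (g := fun x : (α × ℕ) × β => (x.1.1, x.2)) (by fun_prop)) (by fun_prop) (by fun_prop)
  have hspec : ∀ a n b, b ∈ s a n → check a b = true := by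
    intro a n b hb
    simp only [s, Option.mem_def, Option.bind_eq_some_iff] at hb
    obtain ⟨b', -, hb'⟩ := hb
    cases hcb : check a b' <;> simp_all
  have hdom : ∀ a, (Nat.rfindOpt (s a)).Dom := by
    intro a
    rw [Nat.rfindOpt_dom]
    obtain ⟨b, hb⟩ := h a
    exact ⟨Encodable.encode b, b, by simp [s, hb]⟩
  refine ⟨fun a => (Nat.rfindOpt (s a)).get (hdom a), ?_, fun a => ?_⟩
  · exact (Partrec.rfindOpt hs).of_eq_tot fun a => Part.get_mem _
  · obtain ⟨n, hn⟩ := Nat.rfindOpt_spec (Part.get_mem (hdom a))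
    exact hspec a n _ hn

end Computable

/-- All ways to choose one element from each of the given lists. -/
def choices {α : Type*} : List (List α) → List (List α)
  | [] => [[]]
  | l :: ls => l.flatMap fun x => (choices ls).map fun c => x :: c

theorem mem_choices {α : Type*} {ls : List (List α)} {c : List α} :
    c ∈ choices ls ↔ List.Forall₂ (fun x l => x ∈ l) c ls := by
  induction ls generalizing c with
  | nil => simp [choices]
  | cons l ls ih =>
    cases c with
    | nil => simp [choices]
    | cons x c => simp [choices, ih]

@[fun_prop]
theorem Computable.choices {α β : Type*} [Primcodable α] [Primcodable β]
    {f : α → List (List β)} (hf : Computable f) : Computable fun a => choices (f a) := by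
  have : Computable fun a => (f a).foldr
      (fun l s => l.flatMap fun x => s.map fun c => x :: c) [[]] := by fun_prop
  refine this.of_eq fun a => ?_
  induction f a <;> simp_all [_root_.choices]

theorem ComputablePred.of_computable {α : Type*} [Primcodable α] {p : α → Prop} {f : α → Bool}
    (hf : Computable f) (h : ∀ a, f a = true ↔ p a) : ComputablePred p :=
  ⟨fun a => decidable_of_iff _ (h a), hf.of_eq fun a => by
    rw [Bool.eq_iff_iff, h]; simp⟩

theorem ComputablePred.exists_computable {α : Type*} [Primcodable α] {p : α → Prop}
    (hp : ComputablePred p) : ∃ f : α → Bool, Computable f ∧ ∀ a, f a = true ↔ p a := by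
  obtain ⟨_, h⟩ := hp
  exact ⟨_, h, fun a => by simp⟩

/-! ### Semilinear representations -/

/-- Semilinear representations, as in `semilinearSetOf`. -/
abbrev SLRep : Type := List (List ℕ × List (List ℕ))

/-- The valuation `ν` restricted to the coordinates below `k` lies in the linear set with
representation `(w, P)`. -/
def linMem (k : ℕ) (w : List ℕ) (P : List (List ℕ)) (ν : ℕ → ℕ) : Prop :=
  ∃ c : ℕ → ℕ, ∀ j < k, ν j = w.getD j 0 + ∑ i ∈ Finset.range P.length,
    c i * (P.getD i []).getD j 0

/-- The valuation `ν` restricted to the coordinates below `k` lies in the semilinear set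
represented by `R`. -/
def slMem (k : ℕ) (R : SLRep) (ν : ℕ → ℕ) : Prop :=
  ∃ L ∈ R, linMem k L.1 L.2 ν

theorem mem_linearSetOf_iff {k : ℕ} {L : List ℕ × List (List ℕ)} {ν : ℕ → ℕ} :
    (fun j : Fin k => ν j) ∈ linearSetOf k L ↔ linMem k L.1 L.2 ν := by
  have key : ∀ c : ℕ → ℕ, ((fun j : Fin k => ν j) =
      listVec k L.1 + ∑ i : Fin L.2.length, c i • listVec k (L.2.get i)) ↔
      ∀ j < k, ν j = L.1.getD j 0 + ∑ i ∈ Finset.range L.2.length,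
        c i * (L.2.getD i []).getD j 0 := by
    intro c
    rw [funext_iff, Fin.forall_iff]
    refine forall₂_congr fun j hj => ?_
    rw [Finset.sum_range]
    simp [listVec, Finset.sum_apply]
  constructor
  · rintro ⟨c, hc⟩
    refine ⟨fun i => if h : i < L.2.length then c ⟨i, h⟩ else 0, (key _).1 ?_⟩
    simpa using hc
  · rintro ⟨c, hc⟩
    exact ⟨fun i => c i, (key c).2 hc⟩

theorem mem_semilinearSetOf_iff {k : ℕ} {R : SLRep} {ν : ℕ → ℕ} :
    (fun j : Fin k => ν j) ∈ semilinearSetOf k R ↔ slMem k R ν := by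
  simp [semilinearSetOf, slMem, mem_linearSetOf_iff]

open Pointwise in
theorem linearSetOf_eq_vadd_closure (k : ℕ) (L : List ℕ × List (List ℕ)) :
    linearSetOf k L = listVec k L.1 +ᵥ
      (AddSubmonoid.closure (Set.range fun i => listVec k (L.2.get i)) : Set (Fin k → ℕ)) := by
  ext s
  simp only [linearSetOf, Set.mem_ofPred_eq, Set.mem_vadd_set, SetLike.mem_coe,
    ← Submodule.span_nat_eq_addSubmonoidClosure, Submodule.mem_toAddSubmonoid,
    Submodule.mem_span_range_iff_exists_fun, vadd_eq_add]
  constructor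
  · rintro ⟨c, rfl⟩
    exact ⟨_, ⟨c, rfl⟩, rfl⟩
  · rintro ⟨_, ⟨c, rfl⟩, rfl⟩
    exact ⟨c, rfl⟩

theorem isSemilinearSet_semilinearSetOf (k : ℕ) (R : SLRep) :
    IsSemilinearSet (semilinearSetOf k R) := by
  have : semilinearSetOf k R = ⋃ L ∈ R.toFinset, linearSetOf k L := by
    ext s; simp [semilinearSetOf]
  rw [this]
  refine IsSemilinearSet.biUnion_finset fun L _ => IsLinearSet.isSemilinearSet ?_
  rw [linearSetOf_eq_vadd_closure]
  exact ⟨_, _, Set.finite_range _, rfl⟩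

theorem exists_rep_of_isLinearSet {k : ℕ} {s : Set (Fin k → ℕ)} (hs : IsLinearSet s) :
    ∃ L, s = linearSetOf k L := by
  obtain ⟨a, t, rfl⟩ := isLinearSet_iff.1 hs
  have hl : ∀ v : Fin k → ℕ, listVec k (List.ofFn v) = v := fun v => by
    ext i; simp [listVec, List.getD]
  refine ⟨(List.ofFn a, t.toList.map List.ofFn), ?_⟩
  rw [linearSetOf_eq_vadd_closure, hl]
  congr 3
  ext v
  simp only [Set.mem_range, Finset.mem_coe]
  constructor
  · intro hv
    obtain ⟨i, hi⟩ := List.get_of_mem (List.mem_map.2 ⟨v, Finset.mem_toList.2 hv, rfl⟩ :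
      List.ofFn v ∈ t.toList.map List.ofFn)
    exact ⟨i, by rw [hi, hl]⟩
  · rintro ⟨i, rfl⟩
    obtain ⟨v, hv, h⟩ := List.mem_map.1 (List.get_mem (t.toList.map List.ofFn) i)
    rw [← h, hl]
    exact Finset.mem_toList.1 hv

theorem exists_rep_of_isSemilinearSet {k : ℕ} {s : Set (Fin k → ℕ)} (hs : IsSemilinearSet s) :
    ∃ R : SLRep, s = semilinearSetOf k R := by
  obtain ⟨S, hS, rfl⟩ := isSemilinearSet_iff.1 hs
  choose! L hL using fun t ht => exists_rep_of_isLinearSet (hS t ht)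
  refine ⟨S.toList.map L, ?_⟩
  ext v
  simp only [semilinearSetOf, Set.mem_sUnion, Set.mem_ofPred_eq, List.mem_map, Finset.mem_toList,
    Finset.mem_coe]
  constructor
  · rintro ⟨t, ht, hv⟩
    exact ⟨_, ⟨t, ht, rfl⟩, hL t ht ▸ hv⟩
  · rintro ⟨_, ⟨t, ht, rfl⟩, hv⟩
    exact ⟨t, ht, (hL t ht).symm ▸ hv⟩

/-- The complement of a set with a semilinear representation has a semilinear representation. -/
theorem exists_compl_rep (k : ℕ) (R : SLRep) : ∃ R' : SLRep, ∀ ν, slMem k R' ν ↔ ¬ slMem k R ν := by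
  obtain ⟨R', h⟩ := exists_rep_of_isSemilinearSet (isSemilinearSet_semilinearSetOf k R).compl
  refine ⟨R', fun ν => ?_⟩
  rw [← mem_semilinearSetOf_iff, ← mem_semilinearSetOf_iff, ← h, Set.mem_compl_iff]

/-! ### Verifying complements by binary automata -/

/-- All vectors `w + p₁ + ⋯ + p_l` with `[p₁, …, p_l]` a sublist of `P`, in dimension `k`. -/
def subSums (k : ℕ) (w : List ℕ) (P : List (List ℕ)) : List (List ℕ) :=
  P.foldr (fun p acc => acc ++ acc.map fun z =>
    (List.range k).map fun j => z.getD j 0 + p.getD j 0) [w]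

@[simp]
theorem getD_map_range {α : Type*} (k j : ℕ) (f : ℕ → α) (d : α) :
    ((List.range k).map f).getD j d = if j < k then f j else d := by
  by_cases h : j < k <;> simp [List.getD, h]

theorem exists_of_mem_subSums {k : ℕ} {w : List ℕ} {P : List (List ℕ)} {z : List ℕ}
    (hz : z ∈ subSums k w P) : ∃ e : ℕ → ℕ, (∀ i, e i ≤ 1) ∧ ∀ j < k,
      z.getD j 0 = w.getD j 0 + ∑ i ∈ Finset.range P.length, e i * (P.getD i []).getD j 0 := by
  induction P generalizing z with
  | nil => exact ⟨0, by simp, by simp_all [subSums]⟩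
  | cons p P ih =>
    simp only [subSums, List.foldr_cons, List.mem_append, List.mem_map] at hz
    rcases hz with hz | ⟨y, hy, rfl⟩
    · obtain ⟨e, he, h⟩ := ih hz
      refine ⟨fun i => Nat.casesOn i 0 e, fun i => by cases i <;> simp [he], fun j hj => ?_⟩
      simpa [Finset.sum_range_succ'] using h j hj
    · obtain ⟨e, he, h⟩ := ih hy
      refine ⟨fun i => Nat.casesOn i 1 e, fun i => by cases i <;> simp [he], fun j hj => ?_⟩
      rw [getD_map_range, if_pos hj, h j hj]
      simp [Finset.sum_range_succ', add_assoc]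

theorem exists_mem_subSums {k : ℕ} {w : List ℕ} {P : List (List ℕ)} (e : ℕ → ℕ)
    (he : ∀ i, e i ≤ 1) : ∃ z ∈ subSums k w P, ∀ j < k,
      z.getD j 0 = w.getD j 0 + ∑ i ∈ Finset.range P.length, e i * (P.getD i []).getD j 0 := by
  induction P generalizing e with
  | nil => exact ⟨w, by simp [subSums], by simp⟩
  | cons p P ih =>
    obtain ⟨z, hz, h⟩ := ih (fun i => e (i + 1)) fun i => he _
    rcases Nat.le_one_iff_eq_zero_or_eq_one.1 (he 0) with h0 | h0
    · refine ⟨z, List.mem_append.2 (Or.inl hz), fun j hj => ?_⟩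
      simpa [Finset.sum_range_succ', h0] using h j hj
    · refine ⟨_, List.mem_append.2 (Or.inr (List.mem_map.2 ⟨z, hz, rfl⟩)), fun j hj => ?_⟩
      rw [getD_map_range, if_pos hj, h j hj]
      simp [Finset.sum_range_succ', add_assoc, h0]

/-- Reading the least significant binary digits of `ν` turns membership in the linear set
`(w, P)` into membership of `⌊ν / 2⌋` in one of finitely many linear sets with the same periods:
the coefficients are halved, and their last bits select the summands of an element of
`subSums`. -/
theorem linMem_iff_half {k : ℕ} {w : List ℕ} {P : List (List ℕ)} {ν : ℕ → ℕ} :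
    linMem k w P ν ↔ ∃ z ∈ subSums k w P, (∀ j < k, z.getD j 0 % 2 = ν j % 2) ∧
      linMem k ((List.range k).map fun j => z.getD j 0 / 2) P fun j => ν j / 2 := by
  constructor
  · rintro ⟨c, hc⟩
    obtain ⟨z, hz, h⟩ := exists_mem_subSums (k := k) (w := w) (P := P) (fun i => c i % 2)
      fun i => by omega
    have hν : ∀ j < k, ν j = z.getD j 0 +
        2 * ∑ i ∈ Finset.range P.length, c i / 2 * (P.getD i []).getD j 0 := by
      intro j hj
      rw [hc j hj, h j hj, Finset.mul_sum, add_assoc, ← Finset.sum_add_distrib]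
      congr 1
      refine Finset.sum_congr rfl fun i _ => ?_
      rw [← mul_assoc, ← add_mul, Nat.mod_add_div]
    refine ⟨z, hz, fun j hj => by have := hν j hj; omega, fun i => c i / 2, fun j hj => ?_⟩
    have := hν j hj
    rw [getD_map_range, if_pos hj]
    beta_reduce
    omega
  · rintro ⟨z, hz, hd, c, hc⟩
    obtain ⟨e, he, h⟩ := exists_of_mem_subSums hz
    refine ⟨fun i => e i + 2 * c i, fun j hj => ?_⟩
    have h1 := hc j hj
    rw [getD_map_range, if_pos hj] at h1
    have h2 := hd j hj
    have h3 : ∑ i ∈ Finset.range P.length, (e i + 2 * c i) * (P.getD i []).getD j 0 =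
        ∑ i ∈ Finset.range P.length, e i * (P.getD i []).getD j 0 +
        2 * ∑ i ∈ Finset.range P.length, c i * (P.getD i []).getD j 0 := by
      rw [Finset.mul_sum, ← Finset.sum_add_distrib]
      exact Finset.sum_congr rfl fun i _ => by ring
    have h4 := h j hj
    beta_reduce at h1 ⊢
    omega

theorem linMem_of_forall_eq_zero {k : ℕ} {w : List ℕ} {P : List (List ℕ)} {ν : ℕ → ℕ}
    (hν : ∀ j < k, ν j = 0) : linMem k w P ν ↔ ∀ j < k, w.getD j 0 = 0 := by
  constructor
  · rintro ⟨c, hc⟩ j hj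
    have := hc j hj
    rw [hν j hj] at this
    omega
  · exact fun h => ⟨0, fun j hj => by simp [-List.getD_eq_getElem?_getD, hν j hj, h j hj]⟩

/-- A state of the automaton: a linear set, marked as part of the set that is to be complemented
(`true`) or of its candidate complement (`false`). -/
abbrev TagLin : Type := Bool × List ℕ × List (List ℕ)

/-- The union of the linear sets with mark `t` among those in `A`. -/
def tagMem (k : ℕ) (A : List TagLin) (t : Bool) (ν : ℕ → ℕ) : Prop :=
  ∃ s ∈ A, s.1 = t ∧ linMem k s.2.1 s.2.2 ν

/-- The transition of the subset automaton for the digit vector `d`. -/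
def tagStep (k : ℕ) (d : List ℕ) (A : List TagLin) : List TagLin :=
  A.flatMap fun s => ((subSums k s.2.1 s.2.2).filter fun z =>
    (List.range k).all fun j => eqTest (z.getD j 0 % 2) (d.getD j 0)).map fun z =>
      (s.1, (List.range k).map fun j => z.getD j 0 / 2, s.2.2)

theorem tagMem_iff_half {k : ℕ} {A : List TagLin} {t : Bool} {ν : ℕ → ℕ} {d : List ℕ}
    (hd : ∀ j < k, d.getD j 0 = ν j % 2) :
    tagMem k A t ν ↔ tagMem k (tagStep k d A) t fun j => ν j / 2 := by
  simp only [tagMem]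
  constructor
  · rintro ⟨s, hs, ht, h⟩
    obtain ⟨z, hz, h1, h2⟩ := linMem_iff_half.1 h
    refine ⟨(s.1, (List.range k).map fun j => z.getD j 0 / 2, s.2.2), List.mem_flatMap.2
      ⟨s, hs, List.mem_map.2 ⟨z, List.mem_filter.2 ⟨hz, ?_⟩, rfl⟩⟩, ht, h2⟩
    simp only [List.all_eq_true, List.mem_range, eqTest_iff]
    exact fun j hj => (h1 j hj).trans (hd j hj).symm
  · rintro ⟨_, hs₀, ht, h⟩
    obtain ⟨s, hs, hs'⟩ := List.mem_flatMap.1 hs₀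
    obtain ⟨z, hz, rfl⟩ := List.mem_map.1 hs'
    obtain ⟨hz, hz'⟩ := List.mem_filter.1 hz
    simp only [List.all_eq_true, List.mem_range, eqTest_iff] at hz'
    exact ⟨s, hs, ht, linMem_iff_half.2 ⟨z, hz, fun j hj => (hz' j hj).trans (hd j hj), h⟩⟩

/-- The zero vector belongs to one of the linear sets with mark `t`. -/
def tagZero (k : ℕ) (A : List TagLin) (t : Bool) : Bool :=
  A.any fun s => eqTest s.1 t && (List.range k).all fun j => eqTest (s.2.1.getD j 0) 0

theorem tagZero_iff {k : ℕ} {A : List TagLin} {t : Bool} {ν : ℕ → ℕ} (hν : ∀ j < k, ν j = 0) :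
    tagZero k A t = true ↔ tagMem k A t ν := by
  simp only [tagZero, tagMem, List.any_eq_true, Bool.and_eq_true, eqTest_iff,
    List.all_eq_true, List.mem_range, linMem_of_forall_eq_zero hν]

/-- The lists `A` and `B` have the same elements. -/
def sameElems {α : Type*} [DecidableEq α] (A B : List α) : Bool :=
  A.all (fun x => memTest x B) && B.all fun x => memTest x A

theorem sameElems_iff {α : Type*} [DecidableEq α] {A B : List α} :
    sameElems A B = true ↔ ∀ x, x ∈ A ↔ x ∈ B := by
  simp only [sameElems, Bool.and_eq_true, List.all_eq_true, memTest_iff]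
  exact ⟨fun h x => ⟨h.1 x, h.2 x⟩, fun h => ⟨fun x => (h x).1, fun x => (h x).2⟩⟩

theorem tagMem_congr {k : ℕ} {A B : List TagLin} (h : sameElems A B = true) (t : Bool)
    (ν : ℕ → ℕ) : tagMem k A t ν ↔ tagMem k B t ν := by
  simp [tagMem, sameElems_iff.1 h]

/-- The start state of the automaton that compares `R` and `R'`. -/
def tagInit (k : ℕ) (R R' : SLRep) : List TagLin :=
  (R.map fun L => (true, (List.range k).map fun j => L.1.getD j 0, L.2)) ++
    R'.map fun L => (false, (List.range k).map fun j => L.1.getD j 0, L.2)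

theorem tagMem_tagInit {k : ℕ} {R R' : SLRep} {t : Bool} {ν : ℕ → ℕ} :
    tagMem k (tagInit k R R') t ν ↔ slMem k (bif t then R else R') ν := by
  have h : ∀ L : List ℕ × List (List ℕ),
      linMem k ((List.range k).map fun j => L.1.getD j 0) L.2 ν ↔ linMem k L.1 L.2 ν := by
    refine fun L => exists_congr fun c => forall₂_congr fun j hj => ?_
    rw [getD_map_range, if_pos hj]
  simp only [tagMem, tagInit, List.mem_append, List.mem_map, slMem]
  constructor
  · rintro ⟨_, ⟨L, hL, rfl⟩ | ⟨L, hL, rfl⟩, rfl, hm⟩ <;> exact ⟨L, hL, (h L).1 hm⟩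
  · rintro ⟨L, hL, hm⟩
    cases t
    · exact ⟨_, Or.inr ⟨L, hL, rfl⟩, rfl, (h L).2 hm⟩
    · exact ⟨_, Or.inl ⟨L, hL, rfl⟩, rfl, (h L).2 hm⟩

/-- `C` is a certificate for `R` and `R'` representing complementary sets: a list of states of the
subset automaton which contains the start state, is closed under transitions, and in which every
state accepts exactly one mark. -/
def complCert (k : ℕ) (R R' : SLRep) (C : List (List TagLin)) : Bool :=
  (C.any fun A => sameElems A (tagInit k R R')) && C.all fun A =>
    eqTest (tagZero k A true) (!(tagZero k A false)) &&
      (choices (List.replicate k [0, 1])).all fun d => C.any fun A' => sameElems A' (tagStep k d A)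

theorem digits_mem_choices (k : ℕ) (ν : ℕ → ℕ) :
    (List.range k).map (fun j => ν j % 2) ∈ choices (List.replicate k [0, 1]) := by
  rw [mem_choices, List.forall₂_iff_get]
  refine ⟨by simp, fun i hi _ => ?_⟩
  simp
  omega

theorem compl_of_complCert {k : ℕ} {R R' : SLRep} {C : List (List TagLin)}
    (h : complCert k R R' C = true) (ν : ℕ → ℕ) : slMem k R' ν ↔ ¬ slMem k R ν := by
  simp only [complCert, Bool.and_eq_true, List.any_eq_true, List.all_eq_true,
    eqTest_iff] at h
  obtain ⟨⟨A₀, hA₀, h₀⟩, h⟩ := h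
  have key : ∀ n, ∀ A ∈ C, ∀ ν : ℕ → ℕ, (∑ j ∈ Finset.range k, ν j) = n →
      (tagMem k A false ν ↔ ¬ tagMem k A true ν) := by
    intro n
    induction n using Nat.strong_induction_on with
    | _ n ih =>
      intro A hA ν hn
      obtain ⟨hz, hd⟩ := h A hA
      by_cases hν : ∀ j < k, ν j = 0
      · rw [← tagZero_iff hν, ← tagZero_iff hν, hz]
        simp
      · push Not at hν
        obtain ⟨i, hi, hi0⟩ := hν
        obtain ⟨A', hA', hs⟩ := hd _ (digits_mem_choices k ν)
        have hdig : ∀ j < k, ((List.range k).map fun j => ν j % 2).getD j 0 = ν j % 2 :=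
          fun j hj => by rw [getD_map_range, if_pos hj]
        rw [tagMem_iff_half hdig, tagMem_iff_half hdig, ← tagMem_congr hs, ← tagMem_congr hs]
        refine ih _ ?_ A' hA' _ rfl
        rw [← hn]
        refine Finset.sum_lt_sum (fun j _ => Nat.div_le_self _ _) ⟨i, Finset.mem_range.2 hi, ?_⟩
        omega
  have := key _ A₀ hA₀ ν rfl
  rw [tagMem_congr h₀, tagMem_congr h₀, tagMem_tagInit, tagMem_tagInit] at this
  exact this

theorem mem_sublists_filter {α : Type*} (l : List α) (p : α → Bool) : l.filter p ∈ l.sublists := by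
  simp

/-- Complementary representations have a certificate: all entries that occur in reachable states
are bounded, so the reachable part of the subset automaton is finite. -/
theorem exists_complCert {k : ℕ} {R R' : SLRep} (h : ∀ ν, slMem k R' ν ↔ ¬ slMem k R ν) :
    ∃ C, complCert k R R' C = true := by
  classical
  set I := tagInit k R R' with hI
  -- the entries of the states stay below the bound `b`, as `(b + b) / 2 ≤ b`
  obtain ⟨b, hb⟩ : ∃ b : ℕ, ∀ s ∈ I, ∀ j < k, s.2.1.getD j 0 ≤ b ∧
      ∑ i ∈ Finset.range s.2.2.length, (s.2.2.getD i []).getD j 0 ≤ b := by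
    refine ⟨∑ s ∈ I.toFinset, ∑ j ∈ Finset.range k, (s.2.1.getD j 0 +
      ∑ i ∈ Finset.range s.2.2.length, (s.2.2.getD i []).getD j 0), fun s hs j hj => ?_⟩
    have h1 := Finset.single_le_sum (f := fun s : TagLin => ∑ j ∈ Finset.range k, (s.2.1.getD j 0 +
      ∑ i ∈ Finset.range s.2.2.length, (s.2.2.getD i []).getD j 0)) (fun _ _ => Nat.zero_le _)
      (List.mem_toFinset.2 hs)
    have h2 := Finset.single_le_sum (f := fun j => (s.2.1.getD j 0 +
      ∑ i ∈ Finset.range s.2.2.length, (s.2.2.getD i []).getD j 0)) (fun _ _ => Nat.zero_le _)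
      (Finset.mem_range.2 hj)
    omega
  let U : List TagLin := I.flatMap fun s =>
    (choices (List.replicate k (List.range (b + 1)))).map fun w => (s.1, w, s.2.2)
  have hU : ∀ (s : TagLin) (w : ℕ → ℕ), s ∈ I → (∀ j < k, w j ≤ b) →
      (s.1, (List.range k).map w, s.2.2) ∈ U := by
    intro s w hs hw
    refine List.mem_flatMap.2 ⟨s, hs, List.mem_map.2 ⟨_, ?_, rfl⟩⟩
    rw [mem_choices, List.forall₂_iff_get]
    refine ⟨by simp, fun i hi _ => ?_⟩
    have := hw i (by simpa using hi)
    simp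
    omega
  have hUI : ∀ s ∈ I, s ∈ U := by
    intro s hs
    have hs' : s = (s.1, (List.range k).map fun j => s.2.1.getD j 0, s.2.2) := by
      rw [hI] at hs
      simp only [tagInit, List.mem_append, List.mem_map] at hs
      obtain ⟨L, -, rfl⟩ | ⟨L, -, rfl⟩ := hs <;>
      · simp only [Prod.mk.injEq, true_and, and_true]
        refine List.map_congr_left fun j hj => ?_
        rw [getD_map_range, if_pos (List.mem_range.1 hj)]
    rw [hs']
    exact hU s _ hs fun j hj => (hb s hs j hj).1
  have hstep : ∀ (d : List ℕ) (A : List TagLin), A ⊆ U → tagStep k d A ⊆ U := by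
    intro d A hA s hs
    obtain ⟨s', hs', hs⟩ := List.mem_flatMap.1 hs
    obtain ⟨z, hz, rfl⟩ := List.mem_map.1 hs
    obtain ⟨s₀, hs₀, h₀⟩ := List.mem_flatMap.1 (hA hs')
    obtain ⟨w, hw, rfl⟩ := List.mem_map.1 h₀
    refine hU s₀ _ hs₀ fun j hj => ?_
    obtain ⟨e, he, hz⟩ := exists_of_mem_subSums (List.mem_filter.1 hz).1
    have hzj := hz j hj
    rw [mem_choices, List.forall₂_iff_get] at hw
    have hwj : w.getD j 0 ≤ b := by
      have hj' : j < w.length := by rw [hw.1]; simpa using hj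
      have := hw.2 j hj' (by simpa using hj)
      simp only [List.get_eq_getElem, List.getElem_replicate, List.mem_range] at this
      rw [List.getD_eq_getElem?_getD, List.getElem?_eq_getElem hj', Option.getD_some]
      omega
    have hsum : ∑ i ∈ Finset.range s₀.2.2.length, e i * (s₀.2.2.getD i []).getD j 0 ≤
        ∑ i ∈ Finset.range s₀.2.2.length, (s₀.2.2.getD i []).getD j 0 :=
      Finset.sum_le_sum fun i _ => by
        simpa [-List.getD_eq_getElem?_getD] using
          Nat.mul_le_mul_right ((s₀.2.2.getD i []).getD j 0) (he i)
    have := (hb s₀ hs₀ j hj).2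
    dsimp only at hzj
    omega
  -- every subset of `U` is listed among the filtered sublists of `U`
  have hrep : ∀ A : List TagLin, A ⊆ U →
      ∃ A' ∈ U.sublists, sameElems A' A = true := by
    intro A hA
    refine ⟨U.filter fun s => memTest s A, mem_sublists_filter _ _, ?_⟩
    rw [sameElems_iff]
    intro x
    simp only [List.mem_filter, memTest_iff]
    exact ⟨fun h => h.2, fun h => ⟨hA h, h⟩⟩
  let good : List TagLin → Prop := fun A => ∀ ν, tagMem k A false ν ↔ ¬ tagMem k A true ν
  have hgood : ∀ {A B : List TagLin}, sameElems A B = true → good B → good A := by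
    intro A B hs hB ν
    rw [tagMem_congr hs, tagMem_congr hs]
    exact hB ν
  refine ⟨U.sublists.filter fun A => decide (good A), ?_⟩
  simp only [complCert, Bool.and_eq_true, List.any_eq_true, List.all_eq_true, eqTest_iff,
    decide_eq_true_eq, List.mem_filter]
  constructor
  · obtain ⟨A', hA', hs⟩ := hrep I hUI
    refine ⟨A', ⟨hA', hgood hs fun ν => ?_⟩, hs⟩
    rw [hI, tagMem_tagInit, tagMem_tagInit]
    exact h ν
  · rintro A ⟨hA, hg⟩
    constructor
    · have := hg 0
      rw [← tagZero_iff (ν := 0) (by simp), ← tagZero_iff (ν := 0) (by simp)] at this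
      cases h1 : tagZero k A true <;> cases h2 : tagZero k A false <;> simp_all
    · intro d hd
      obtain ⟨A', hA', hs⟩ := hrep (tagStep k d A) (hstep d A (List.mem_sublists.1 hA).subset)
      refine ⟨A', ⟨hA', hgood hs fun ν => ?_⟩, hs⟩
      have hdig : ∀ j < k, d.getD j 0 < 2 := by
        intro j hj
        rw [mem_choices, List.forall₂_iff_get] at hd
        have hj' : j < d.length := by rw [hd.1]; simpa using hj
        have := hd.2 j hj' (by simpa using hj)
        rw [List.getD_eq_getElem?_getD, List.getElem?_eq_getElem hj', Option.getD_some]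
        simp at this
        omega
      have := hg fun j => d.getD j 0 + 2 * ν j
      have hd' : ∀ j < k, d.getD j 0 = (d.getD j 0 + 2 * ν j) % 2 := fun j hj => by
        have := hdig j hj; omega
      rw [tagMem_iff_half hd', tagMem_iff_half hd'] at this
      have hh : ∀ j < k, (d.getD j 0 + 2 * ν j) / 2 = ν j := fun j hj => by
        have := hdig j hj; omega
      have hc : ∀ t, tagMem k (tagStep k d A) t (fun j => (d.getD j 0 + 2 * ν j) / 2) ↔
          tagMem k (tagStep k d A) t ν := by
        refine fun t => exists_congr fun s => and_congr_right fun _ => and_congr_right fun _ =>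
          exists_congr fun c => forall₂_congr fun j hj => ?_
        beta_reduce
        rw [hh j hj]
      rwa [hc, hc] at this

section computability

variable {α : Type*} [Primcodable α]

@[fun_prop]
theorem Computable.subSums {k : α → ℕ} {w : α → List ℕ} {P : α → List (List ℕ)}
    (hk : Computable k) (hw : Computable w) (hP : Computable P) :
    Computable fun a => subSums (k a) (w a) (P a) := by
  unfold _root_.subSums
  fun_prop

@[fun_prop]
theorem Computable.tagStep {k : α → ℕ} {d : α → List ℕ} {A : α → List TagLin}
    (hk : Computable k) (hd : Computable d) (hA : Computable A) :
    Computable fun a => tagStep (k a) (d a) (A a) := by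
  unfold _root_.tagStep
  fun_prop

@[fun_prop]
theorem Computable.tagZero {k : α → ℕ} {A : α → List TagLin} {t : α → Bool}
    (hk : Computable k) (hA : Computable A) (ht : Computable t) :
    Computable fun a => tagZero (k a) (A a) (t a) := by
  unfold _root_.tagZero
  fun_prop

@[fun_prop]
theorem Computable.sameElems {β : Type*} [Primcodable β] [DecidableEq β] {A B : α → List β}
    (hA : Computable A) (hB : Computable B) : Computable fun a => sameElems (A a) (B a) := by
  unfold _root_.sameElems
  fun_prop

@[fun_prop]
theorem Computable.tagInit {k : α → ℕ} {R R' : α → SLRep} (hk : Computable k)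
    (hR : Computable R) (hR' : Computable R') :
    Computable fun a => tagInit (k a) (R a) (R' a) := by
  unfold _root_.tagInit
  fun_prop

@[fun_prop]
theorem Computable.complCert {k : α → ℕ} {R R' : α → SLRep} {C : α → List (List TagLin)}
    (hk : Computable k) (hR : Computable R) (hR' : Computable R') (hC : Computable C) :
    Computable fun a => complCert (k a) (R a) (R' a) (C a) := by
  unfold _root_.complCert
  fun_prop

/-- Complements of semilinear sets can be computed: a representation of the complement exists and
can be verified, so that a search finds it. -/
theorem exists_computable_compl : ∃ f : ℕ × SLRep → SLRep, Computable f ∧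
    ∀ k R ν, slMem k (f (k, R)) ν ↔ ¬ slMem k R ν := by
  obtain ⟨f, hf, h⟩ := Computable.exists_choice (α := ℕ × SLRep)
    (β := SLRep × List (List TagLin)) (check := fun a b => complCert a.1 a.2 b.1 b.2)
    (by fun_prop) fun a => by
      obtain ⟨R', hR'⟩ := exists_compl_rep a.1 a.2
      obtain ⟨C, hC⟩ := exists_complCert hR'
      exact ⟨(R', C), hC⟩
  exact ⟨fun a => (f a).1, by fun_prop, fun k R ν => compl_of_complCert (h (k, R)) ν⟩

end computability

/-! ### Effectively semilinear families -/

/-- A family of predicates on valuations `ℕ → ℕ` is effectively semilinear: an algorithm computes,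
from the index `i`, a dimension `k` and a semilinear representation in `ℕ^k` of the predicate with
index `i`, which depends only on the first `k` variables. -/
def Eff {ι : Type*} [Primcodable ι] (S : ι → (ℕ → ℕ) → Prop) : Prop :=
  ∃ (k : ι → ℕ) (f : ι → SLRep), Computable k ∧ Computable f ∧ ∀ i ν, S i ν ↔ slMem (k i) (f i) ν

/-- The `j`-th unit vector. -/
def unitVec (j : ℕ) : List ℕ := List.replicate j 0 ++ [1]

theorem getD_replicate_concat (x n j : ℕ) :
    (List.replicate x 0 ++ [n]).getD j 0 = if j = x then n else 0 := by
  rcases lt_trichotomy j x with h | h | h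
  · simp [List.getElem?_append, h, h.ne]
  · simp [h]
  · have h' : ¬ j < x := by omega
    obtain ⟨d, hd⟩ := Nat.exists_eq_add_of_lt h
    have h'' : j - x = d + 1 := by omega
    simp [List.getElem?_append, h', h.ne', h'']

theorem getD_unitVec (j i : ℕ) : (unitVec j).getD i 0 = if i = j then 1 else 0 :=
  getD_replicate_concat j 1 i

/-- The vector `v` of `ℕ^d`, placed at the coordinates `N, …, N + d - 1`. -/
def placeVec (N d : ℕ) (v : List ℕ) : List ℕ :=
  List.replicate N 0 ++ (List.range d).map fun j => v.getD j 0

theorem getD_placeVec_add {N d j : ℕ} (v : List ℕ) (hj : j < d) :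
    (placeVec N d v).getD (N + j) 0 = v.getD j 0 := by
  simp [placeVec, hj]

theorem getD_placeVec_of_not {N d m : ℕ} (v : List ℕ) (hm : ¬ (N ≤ m ∧ m < N + d)) :
    (placeVec N d v).getD m 0 = 0 := by
  by_cases h : m < N
  · simp [placeVec, List.getElem?_append, h]
  · have : d ≤ m - N := by omega
    simp [placeVec, List.getElem?_append, h, this]

/-- The coordinates below `k` outside the interval `[N, N + d)`. -/
def freeCoords (N d k : ℕ) : List ℕ :=
  (List.range k).filter fun m => !(leTest N m && leTest (m + 1) (N + d))

theorem mem_freeCoords {N d k m : ℕ} :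
    m ∈ freeCoords N d k ↔ m < k ∧ ¬ (N ≤ m ∧ m < N + d) := by
  simp only [freeCoords, List.mem_filter, List.mem_range, Bool.not_eq_true',
    ← Bool.not_eq_true, Bool.and_eq_true, leTest_iff, Nat.succ_le_iff]

/-- The representation of `R`, read in the coordinates `N, …, N + d - 1` of `ℕ^k`; the other
coordinates are free. -/
def placeRep (N d k : ℕ) (R : SLRep) : SLRep :=
  R.map fun L => (placeVec N d L.1, L.2.map (placeVec N d) ++ (freeCoords N d k).map unitVec)

theorem sum_range_getD {α : Type*} (l : List α) (d : α) (g : α → ℕ) :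
    ∑ i ∈ Finset.range l.length, g (l.getD i d) = (l.map g).sum := by
  induction l with
  | nil => simp
  | cons a l ih => simp only [List.length_cons, Finset.sum_range_succ', List.getD_cons_succ, ih,
      List.getD_cons_zero, List.map_cons, List.sum_cons, add_comm]

theorem linMem_append {k : ℕ} {w : List ℕ} {P Q : List (List ℕ)} {ν : ℕ → ℕ} :
    linMem k w (P ++ Q) ν ↔ ∃ c e : ℕ → ℕ, ∀ j < k, ν j = w.getD j 0 +
      ∑ i ∈ Finset.range P.length, c i * (P.getD i []).getD j 0 +
      ∑ i ∈ Finset.range Q.length, e i * (Q.getD i []).getD j 0 := by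
  have key : ∀ (c : ℕ → ℕ) j, ∑ i ∈ Finset.range (P ++ Q).length,
      c i * ((P ++ Q).getD i []).getD j 0 =
      ∑ i ∈ Finset.range P.length, c i * (P.getD i []).getD j 0 +
      ∑ i ∈ Finset.range Q.length, c (P.length + i) * (Q.getD i []).getD j 0 := by
    intro c j
    rw [List.length_append, Finset.sum_range_add]
    congr 1
    · refine Finset.sum_congr rfl fun i hi => ?_
      rw [List.getD_append _ _ _ _ (Finset.mem_range.1 hi)]
    · refine Finset.sum_congr rfl fun i _ => ?_
      rw [List.getD_append_right _ _ _ _ (by omega), Nat.add_sub_cancel_left]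
  constructor
  · rintro ⟨c, hc⟩
    exact ⟨c, fun i => c (P.length + i), fun j hj => by rw [hc j hj, key, add_assoc]⟩
  · rintro ⟨c, e, h⟩
    refine ⟨fun i => if i < P.length then c i else e (i - P.length), fun j hj => ?_⟩
    rw [key, h j hj, add_assoc]
    congr 2
    · exact Finset.sum_congr rfl fun i hi => by rw [if_pos (Finset.mem_range.1 hi)]
    · exact Finset.sum_congr rfl fun i _ => by
        rw [if_neg (by omega), Nat.add_sub_cancel_left]

theorem getD_map_of_lt {α β : Type*} (f : α → β) (l : List α) (d : α) (d' : β) {i : ℕ}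
    (hi : i < l.length) : (l.map f).getD i d' = f (l.getD i d) := by
  simp [hi]

theorem slMem_placeRep {N d k : ℕ} (hk : N + d ≤ k) (R : SLRep) (ν : ℕ → ℕ) :
    slMem k (placeRep N d k R) ν ↔ slMem d R fun j => ν (N + j) := by
  have hP : ∀ (P : List (List ℕ)) (c : ℕ → ℕ) j, j < d →
      ∑ i ∈ Finset.range (P.map (placeVec N d)).length,
        c i * ((P.map (placeVec N d)).getD i []).getD (N + j) 0 =
      ∑ i ∈ Finset.range P.length, c i * (P.getD i []).getD j 0 := by
    intro P c j hj
    rw [List.length_map]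
    refine Finset.sum_congr rfl fun i hi => ?_
    rw [getD_map_of_lt _ _ [] _ (Finset.mem_range.1 hi), getD_placeVec_add _ hj]
  have hP' : ∀ (P : List (List ℕ)) (c : ℕ → ℕ) m, ¬ (N ≤ m ∧ m < N + d) →
      ∑ i ∈ Finset.range (P.map (placeVec N d)).length,
        c i * ((P.map (placeVec N d)).getD i []).getD m 0 = 0 := by
    intro P c m hm
    rw [List.length_map]
    refine Finset.sum_eq_zero fun i hi => ?_
    rw [getD_map_of_lt _ _ [] _ (Finset.mem_range.1 hi), getD_placeVec_of_not _ hm, mul_zero]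
  have hmem : ∀ L : List ℕ × List (List ℕ), linMem k (placeVec N d L.1)
      (L.2.map (placeVec N d) ++ (freeCoords N d k).map unitVec) ν ↔
      linMem d L.1 L.2 fun j => ν (N + j) := by
    intro L
    rw [linMem_append]
    constructor
    · rintro ⟨c, e, h⟩
      refine ⟨c, fun j hj => ?_⟩
      beta_reduce
      rw [h (N + j) (by omega), getD_placeVec_add _ hj, hP _ _ _ hj, add_eq_left, List.length_map]
      refine Finset.sum_eq_zero fun i hi => ?_
      rw [getD_map_of_lt _ _ 0 _ (Finset.mem_range.1 hi), getD_unitVec, if_neg, mul_zero]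
      intro hm
      have hi' := Finset.mem_range.1 hi
      have : (freeCoords N d k).getD i 0 ∈ freeCoords N d k := by
        rw [List.getD_eq_getElem?_getD, List.getElem?_eq_getElem hi', Option.getD_some]
        exact List.getElem_mem _
      rw [← hm, mem_freeCoords] at this
      omega
    · rintro ⟨c, h⟩
      refine ⟨c, fun i => ν ((freeCoords N d k).getD i 0), fun m hm => ?_⟩
      have hfree : ∑ i ∈ Finset.range ((freeCoords N d k).map unitVec).length,
          ν ((freeCoords N d k).getD i 0) *
            (((freeCoords N d k).map unitVec).getD i []).getD m 0 =
          (freeCoords N d k).count m * ν m := by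
        rw [List.length_map]
        have : ∀ i ∈ Finset.range (freeCoords N d k).length,
            ν ((freeCoords N d k).getD i 0) *
              (((freeCoords N d k).map unitVec).getD i []).getD m 0 =
            if m = (freeCoords N d k).getD i 0 then ν m else 0 := by
          intro i hi
          rw [getD_map_of_lt _ _ 0 _ (Finset.mem_range.1 hi), getD_unitVec]
          split_ifs with h
          · rw [h, mul_one]
          · rw [mul_zero]
        rw [Finset.sum_congr rfl this,
          sum_range_getD (freeCoords N d k) 0 fun x => if m = x then ν m else 0]
        induction freeCoords N d k with
        | nil => simp
        | cons a l ih =>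
          rw [List.map_cons, List.sum_cons, ih, List.count_cons]
          by_cases h : m = a
          · subst h; simp; ring
          · simp [h, Ne.symm h]
      rw [hfree]
      by_cases hin : N ≤ m ∧ m < N + d
      · obtain ⟨j, rfl⟩ := Nat.exists_eq_add_of_le hin.1
        have hj : j < d := by omega
        rw [getD_placeVec_add _ hj, hP _ _ _ hj, List.count_eq_zero_of_not_mem, zero_mul,
          add_zero]
        · exact h j hj
        · rw [mem_freeCoords]; tauto
      · rw [getD_placeVec_of_not _ hin, hP' _ _ _ hin, List.count_eq_one_of_mem]
        · simp
        · exact List.Nodup.filter _ List.nodup_range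
        · exact mem_freeCoords.2 ⟨hm, hin⟩
  simp only [slMem, placeRep, List.mem_map]
  constructor
  · rintro ⟨_, ⟨L, hL, rfl⟩, h⟩
    exact ⟨L, hL, (hmem L).1 h⟩
  · rintro ⟨L, hL, h⟩
    exact ⟨_, ⟨L, hL, rfl⟩, (hmem L).2 h⟩

@[fun_prop]
theorem Computable.placeRep {α : Type*} [Primcodable α] {N d k : α → ℕ} {R : α → SLRep}
    (hN : Computable N) (hd : Computable d) (hk : Computable k) (hR : Computable R) :
    Computable fun a => placeRep (N a) (d a) (k a) (R a) := by
  unfold _root_.placeRep placeVec freeCoords unitVec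
  fun_prop

namespace Eff

variable {ι κ : Type*} [Primcodable ι] [Primcodable κ] {S T : ι → (ℕ → ℕ) → Prop}

theorem of_iff (hS : Eff S) (h : ∀ i ν, T i ν ↔ S i ν) : Eff T := by
  obtain ⟨k, f, hk, hf, hS⟩ := hS
  exact ⟨k, f, hk, hf, fun i ν => (h i ν).trans (hS i ν)⟩

theorem comp {g : κ → ι} (hS : Eff S) (hg : Computable g) : Eff fun i => S (g i) := by
  obtain ⟨k, f, hk, hf, hS⟩ := hS
  exact ⟨fun i => k (g i), fun i => f (g i), by fun_prop, by fun_prop, fun i ν => hS (g i) ν⟩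

/-- The dimension of the representations can be enlarged. -/
theorem exists_ge_dim (hS : Eff S) {K : ι → ℕ} (hK : Computable K) :
    ∃ (k : ι → ℕ) (f : ι → SLRep), Computable k ∧ Computable f ∧
      (∀ i ν, S i ν ↔ slMem (k i) (f i) ν) ∧ ∀ i, K i ≤ k i := by
  obtain ⟨k, f, hk, hf, hS⟩ := hS
  refine ⟨fun i => max (k i) (K i), fun i => placeRep 0 (k i) (max (k i) (K i)) (f i),
    by fun_prop, by fun_prop, fun i ν => ?_, fun i => le_max_right _ _⟩
  rw [slMem_placeRep (by simp), hS]
  simp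

protected theorem not (hS : Eff S) : Eff fun i ν => ¬ S i ν := by
  obtain ⟨k, f, hk, hf, hS⟩ := hS
  obtain ⟨g, hg, h⟩ := exists_computable_compl
  refine ⟨k, fun i => g (k i, f i), hk, by fun_prop, fun i ν => ?_⟩
  rw [h, ← hS]

protected theorem exists_mem {S : ι → κ → (ℕ → ℕ) → Prop} {l : ι → List κ}
    (hS : Eff fun (x : ι × κ) => S x.1 x.2) (hl : Computable l) :
    Eff fun i ν => ∃ x ∈ l i, S i x ν := by
  obtain ⟨k, f, hk, hf, hS⟩ := hS
  let K : ι → ℕ := fun i => ((l i).map fun x => k (i, x)).sum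
  have hK : Computable K := by fun_prop
  refine ⟨K, fun i => (l i).flatMap fun x => placeRep 0 (k (i, x)) (K i) (f (i, x)), hK,
    by fun_prop, fun i ν => ?_⟩
  have hle : ∀ x ∈ l i, 0 + k (i, x) ≤ K i := fun x hx => by
    rw [zero_add]
    exact List.le_sum_of_mem (List.mem_map.2 ⟨x, hx, rfl⟩)
  have h : ∀ x ∈ l i, (S i x ν ↔ slMem (K i) (placeRep 0 (k (i, x)) (K i) (f (i, x))) ν) := by
    intro x hx
    rw [slMem_placeRep (hle x hx)]
    simpa using hS (i, x) ν
  simp only [slMem, List.mem_flatMap]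
  constructor
  · rintro ⟨x, hx, hxS⟩
    obtain ⟨L, hL, hm⟩ := (h x hx).1 hxS
    exact ⟨L, ⟨x, hx, hL⟩, hm⟩
  · rintro ⟨L, ⟨x, hx, hL⟩, hm⟩
    exact ⟨x, hx, (h x hx).2 ⟨L, hL, hm⟩⟩

protected theorem forall_mem {S : ι → κ → (ℕ → ℕ) → Prop} {l : ι → List κ}
    (hS : Eff fun (x : ι × κ) => S x.1 x.2) (hl : Computable l) :
    Eff fun i ν => ∀ x ∈ l i, S i x ν :=
  (Eff.exists_mem (S := fun i x ν => ¬ S i x ν) hS.not hl).not.of_iff fun i ν => by simp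

protected theorem or (hS : Eff S) (hT : Eff T) : Eff fun i ν => S i ν ∨ T i ν := by
  obtain ⟨k, f, hk, hf, hS⟩ := hS
  obtain ⟨k', f', hk', hf', hT⟩ := hT
  refine ⟨fun i => max (k i) (k' i), fun i => placeRep 0 (k i) (max (k i) (k' i)) (f i) ++
    placeRep 0 (k' i) (max (k i) (k' i)) (f' i), by fun_prop, by fun_prop, fun i ν => ?_⟩
  have h1 := slMem_placeRep (N := 0) (d := k i) (k := max (k i) (k' i)) (by simp) (f i) ν
  have h2 := slMem_placeRep (N := 0) (d := k' i) (k := max (k i) (k' i)) (by simp) (f' i) ν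
  simp only [zero_add, ← hS, ← hT] at h1 h2
  beta_reduce
  rw [← h1, ← h2]
  simp only [slMem, List.mem_append, or_and_right, exists_or]

protected theorem and (hS : Eff S) (hT : Eff T) : Eff fun i ν => S i ν ∧ T i ν :=
  (hS.not.or hT.not).not.of_iff fun i ν => by tauto

protected theorem imp (hS : Eff S) (hT : Eff T) : Eff fun i ν => S i ν → T i ν :=
  (hS.not.or hT).of_iff fun i ν => by tauto

/-- Quantification over all variables from `N` on: the representation is truncated. -/
protected theorem exists_ge {N : ι → ℕ} (hS : Eff S) (hN : Computable N) :
    Eff fun i ν => ∃ μ : ℕ → ℕ, (∀ j < N i, μ j = ν j) ∧ S i μ := by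
  obtain ⟨k, f, hk, hf, hS, hle⟩ := hS.exists_ge_dim hN
  refine ⟨N, f, hN, hf, fun i ν => ?_⟩
  simp only [hS]
  constructor
  · rintro ⟨μ, hμ, L, hL, c, hc⟩
    exact ⟨L, hL, c, fun j hj => by rw [← hμ j hj, hc j (hj.trans_le (hle i))]⟩
  · rintro ⟨L, hL, c, hc⟩
    refine ⟨fun j => L.1.getD j 0 + ∑ i ∈ Finset.range L.2.length, c i * (L.2.getD i []).getD j 0,
      fun j hj => (hc j hj).symm, L, hL, c, fun j _ => rfl⟩

/-- A predicate that does not depend on the valuation and is decidable. -/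
protected theorem const {p : ι → Bool} (hp : Computable p) : Eff fun i _ => p i = true := by
  refine ⟨fun _ => 0, fun i => bif p i then [([], [])] else [], by fun_prop, by fun_prop,
    fun i ν => ?_⟩
  beta_reduce
  cases p i <;> simp [slMem, linMem]

theorem computablePred_exists (hS : Eff S) : ComputablePred fun i => ∃ ν, S i ν := by
  obtain ⟨k, f, hk, hf, hS⟩ := hS
  refine ComputablePred.of_computable (f := fun i => !(eqTest (f i) [])) (by fun_prop) fun i => ?_
  rw [Bool.not_eq_true', ← Bool.not_eq_true, eqTest_iff]
  simp only [hS]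
  constructor
  · intro h
    obtain ⟨L, hL⟩ := List.exists_mem_of_ne_nil _ h
    exact ⟨fun j => L.1.getD j 0, L, hL, 0, fun j _ => by simp⟩
  · rintro ⟨ν, L, hL, -⟩ h
    simp [h] at hL

/-- The relation `x = D y + r + s t` for some `t`, where `x` and `y` are different variables. -/
theorem affine : Eff fun (a : ℕ × ℕ × ℕ × ℕ × ℕ) ν => a.1 ≠ a.2.1 ∧
    ∃ t, ν a.1 = a.2.2.1 * ν a.2.1 + a.2.2.2.1 + a.2.2.2.2 * t := by
  let J : ℕ → ℕ → List ℕ := fun x k => (List.range k).filter fun m => !(eqTest m x)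
  let g : ℕ → ℕ → ℕ → ℕ → ℕ → List ℕ := fun x y D k m => (List.range k).map fun j =>
    bif eqTest j m then 1 else bif eqTest j x && eqTest m y then D else 0
  refine ⟨fun a => a.1 + a.2.1 + 1, fun a => bif eqTest a.1 a.2.1 then [] else
    [(List.replicate a.1 0 ++ [a.2.2.2.1],
      (J a.1 (a.1 + a.2.1 + 1)).map (g a.1 a.2.1 a.2.2.1 (a.1 + a.2.1 + 1)) ++
        [List.replicate a.1 0 ++ [a.2.2.2.2]])], by fun_prop, by fun_prop, ?_⟩
  rintro ⟨x, y, D, r, s⟩ ν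
  by_cases hxy : x = y
  · simp [hxy, slMem]
  have hxy' : eqTest x y = false := eqTest_of_ne hxy
  simp only [hxy', cond_false, slMem, List.mem_singleton, exists_eq_left, ne_eq, hxy,
    not_false_eq_true, true_and]
  rw [linMem_append]
  have hv := getD_replicate_concat x
  have hJ : ∀ {k m}, m ∈ J x k ↔ m < k ∧ m ≠ x := by
    intro k m
    simp only [J, List.mem_filter, List.mem_range, Bool.not_eq_true', ← Bool.not_eq_true,
      eqTest_iff, ne_eq]
  have hJn : ∀ k, (J x k).Nodup := fun k => List.Nodup.filter _ List.nodup_range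
  set k := x + y + 1 with hk
  have hg : ∀ m j, j < k → (g x y D k m).getD j 0 =
      if j = m then 1 else if j = x ∧ m = y then D else 0 := by
    intro m j hj
    simp only [g, getD_map_range, hj, if_true]
    by_cases h1 : j = m
    · rw [if_pos h1, (eqTest_iff).2 h1, cond_true]
    · rw [if_neg h1, eqTest_of_ne h1, cond_false]
      by_cases h2 : j = x ∧ m = y
      · rw [if_pos h2, eqTest_iff.2 h2.1, eqTest_iff.2 h2.2]; rfl
      · have h3 : (eqTest j x && eqTest m y) = false := by
          rw [← Bool.not_eq_true, Bool.and_eq_true, eqTest_iff, eqTest_iff]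
          exact h2
        rw [if_neg h2, h3, cond_false]
  -- the coefficient of the generator that belongs to the variable `m` is the value of `m`
  have hsum : ∀ (c : ℕ → ℕ) j, j < k →
      ∑ i ∈ Finset.range ((J x k).map (g x y D k)).length,
        c i * (((J x k).map (g x y D k)).getD i []).getD j 0 =
      if j = x then D * c ((J x k).idxOf y) else c ((J x k).idxOf j) := by
    intro c j hj
    rw [List.length_map]
    -- only one generator has a nonzero entry at `j`
    have aux : ∀ m₀ e, m₀ ∈ J x k → (∀ m ∈ J x k, (g x y D k m).getD j 0 =
        if m = m₀ then e else 0) → ∑ i ∈ Finset.range (J x k).length,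
        c i * (((J x k).map (g x y D k)).getD i []).getD j 0 = e * c ((J x k).idxOf m₀) := by
      intro m₀ e hm₀ hge
      have hlt := List.idxOf_lt_length_of_mem hm₀
      rw [Finset.sum_eq_single ((J x k).idxOf m₀)]
      · rw [getD_map_of_lt _ _ 0 _ hlt, hge, if_pos, mul_comm]
        all_goals
          rw [List.getD_eq_getElem?_getD, List.getElem?_eq_getElem hlt, Option.getD_some]
          simp [hm₀]
      · intro i hi hne
        have hi' := Finset.mem_range.1 hi
        rw [getD_map_of_lt _ _ 0 _ hi', List.getD_eq_getElem (hn := hi'),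
          hge _ (List.getElem_mem _),
          if_neg, mul_zero]
        rintro rfl
        exact hne ((hJn k).idxOf_getElem i hi').symm
      · intro h; exact absurd (Finset.mem_range.2 hlt) h
    by_cases h : j = x
    · subst h
      rw [if_pos rfl]
      refine aux y D (hJ.2 ⟨by omega, Ne.symm hxy⟩) fun m hm => ?_
      rw [hg m j hj, if_neg (hJ.1 hm).2.symm]
      simp
    · rw [if_neg h, aux j 1 (hJ.2 ⟨hj, h⟩), one_mul]
      intro m _
      rw [hg m j hj]
      by_cases h' : j = m
      · simp [h']
      · simp [h', Ne.symm h', h]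
  constructor
  · rintro ⟨t, ht⟩
    refine ⟨fun i => ν ((J x k).getD i 0), fun _ => t, fun j hj => ?_⟩
    have hval : ∀ m ∈ J x k, (J x k).getD ((J x k).idxOf m) 0 = m := fun m hm => by
      rw [List.getD_eq_getElem (hn := List.idxOf_lt_length_of_mem hm)]
      simp
    rw [hsum _ j hj, hv]
    simp only [List.length_singleton, Finset.sum_range_one, List.getD_cons_zero, hv]
    by_cases h : j = x
    · subst h
      rw [if_pos rfl, if_pos rfl, if_pos rfl, hval y (hJ.2 ⟨by omega, Ne.symm hxy⟩), ht]
      ring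
    · rw [if_neg h, if_neg h, if_neg h, hval j (hJ.2 ⟨hj, h⟩)]
      simp
  · rintro ⟨c, e, h⟩
    refine ⟨e 0, ?_⟩
    have hx := h x (by omega)
    have hy := h y (by omega)
    rw [hsum _ _ (by omega), hv] at hx hy
    simp only [List.length_singleton, Finset.sum_range_one, List.getD_cons_zero, hv, if_true,
      if_neg (Ne.symm hxy)] at hx hy
    rw [hx, hy]
    ring

/-- `ν x = D * ν y + r`. -/
theorem affine_eq {x y D r : ι → ℕ} (hx : Computable x) (hy : Computable y) (hD : Computable D)
    (hr : Computable r) (hne : ∀ i, x i ≠ y i) : Eff fun i ν => ν (x i) = D i * ν (y i) + r i :=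
  (affine.comp (g := fun i => (x i, y i, D i, r i, 0)) (by fun_prop)).of_iff fun i ν => by
    simp [hne i]

/-- `D * ν y + r ≤ ν x`. -/
theorem affine_le {x y D r : ι → ℕ} (hx : Computable x) (hy : Computable y) (hD : Computable D)
    (hr : Computable r) (hne : ∀ i, x i ≠ y i) : Eff fun i ν => D i * ν (y i) + r i ≤ ν (x i) :=
  (affine.comp (g := fun i => (x i, y i, D i, r i, 1)) (by fun_prop)).of_iff fun i ν => by
    simp [hne i, le_iff_exists_add]

theorem eq_const {x r : ι → ℕ} (hx : Computable x) (hr : Computable r) :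
    Eff fun i ν => ν (x i) = r i :=
  (affine_eq (y := fun i => x i + 1) (D := fun _ => 0) hx (by fun_prop) (by fun_prop) hr
    (by simp)).of_iff fun i ν => by simp

theorem const_le {x r : ι → ℕ} (hx : Computable x) (hr : Computable r) :
    Eff fun i ν => r i ≤ ν (x i) :=
  (affine_le (y := fun i => x i + 1) (D := fun _ => 0) hx (by fun_prop) (by fun_prop) hr
    (by simp)).of_iff fun i ν => by simp

end Eff

/-! ### Words and products of powers -/

section words

variable {A B K : Type*} [Group K]

@[simp]
theorem evalWord_nil (g : A → K) : evalWord g [] = 1 := rfl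

@[simp]
theorem evalWord_cons (g : A → K) (x : A) (w : List A) :
    evalWord g (x :: w) = g x * evalWord g w := by
  simp [evalWord]

@[simp]
theorem evalWord_append (g : A → K) (v w : List A) :
    evalWord g (v ++ w) = evalWord g v * evalWord g w := by
  simp [evalWord]

@[simp]
theorem evalWord_flatten (g : A → K) (l : List (List A)) :
    evalWord g l.flatten = (l.map (evalWord g)).prod := by
  induction l <;> simp_all

theorem evalWord_flatMap (g : A → K) (φ : B → List A) (w : List B) :
    evalWord g (w.flatMap φ) = (w.map fun x => evalWord g (φ x)).prod := by
  induction w <;> simp_all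

theorem evalWord_replicate_flatten (g : A → K) (n : ℕ) (w : List A) :
    evalWord g (List.replicate n w).flatten = evalWord g w ^ n := by
  simp

theorem map_evalWord {K' : Type*} [Group K'] (φ : K →* K') (g : A → K) (w : List A) :
    φ (evalWord g w) = evalWord (fun x => φ (g x)) w := by
  simp [evalWord, map_list_prod, Function.comp_def]

/-- The inverse word, where `i x` is the letter for the inverse of the letter `x`. -/
def invWord (i : A → A) (w : List A) : List A := (w.map i).reverse

theorem evalWord_invWord {g : A → K} {i : A → A} (hi : ∀ x, g (i x) = (g x)⁻¹) (w : List A) :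
    evalWord g (invWord i w) = (evalWord g w)⁻¹ := by
  induction w with
  | nil => simp [invWord]
  | cons x w ih =>
    simp only [invWord, List.map_cons, List.reverse_cons, evalWord_append] at ih ⊢
    simp [ih, hi]

/-- A formal product `u₁^x₁ ⋯ u_l^x_l` of powers of words with variable exponents. -/
abbrev Segs (A : Type*) : Type _ := List (List A × ℕ)

/-- The value of a formal product of powers. -/
def powProd (g : A → K) (L : Segs A) (ν : ℕ → ℕ) : K :=
  (L.map fun s => evalWord g s.1 ^ ν s.2).prod

@[simp]
theorem powProd_nil (g : A → K) (ν : ℕ → ℕ) : powProd g [] ν = 1 := rfl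

@[simp]
theorem powProd_cons (g : A → K) (s : List A × ℕ) (L : Segs A) (ν : ℕ → ℕ) :
    powProd g (s :: L) ν = evalWord g s.1 ^ ν s.2 * powProd g L ν := by
  simp [powProd]

@[simp]
theorem powProd_append (g : A → K) (L L' : Segs A) (ν : ℕ → ℕ) :
    powProd g (L ++ L') ν = powProd g L ν * powProd g L' ν := by
  simp [powProd]

theorem powProd_flatMap {B : Type*} (g : A → K) (φ : B → Segs A) (l : List B) (ν : ℕ → ℕ) :
    powProd g (l.flatMap φ) ν = (l.map fun x => powProd g (φ x) ν).prod := by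
  induction l <;> simp_all

theorem powProd_congr {g : A → K} {L : Segs A} {ν μ : ℕ → ℕ} (h : ∀ s ∈ L, ν s.2 = μ s.2) :
    powProd g L ν = powProd g L μ := by
  rw [powProd, powProd, List.map_congr_left fun s hs => by rw [h s hs]]

theorem map_eq_map_range {β : Type*} (l : List A) (f : A → β) (d : A) :
    l.map f = (List.range l.length).map fun i => f (l.getD i d) := by
  apply List.ext_getElem
  · simp
  · intro i h1 h2
    simp at h1
    simp [h1]

theorem prod_map_range_eq_single {M : Type*} [Monoid M] {n i : ℕ} (f : ℕ → M) (hi : i < n)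
    (h : ∀ j < n, j ≠ i → f j = 1) : ((List.range n).map f).prod = f i := by
  induction n with
  | zero => omega
  | succ n ih =>
    rw [List.range_succ, List.map_append, List.prod_append]
    simp only [List.map_cons, List.map_nil, List.prod_singleton]
    by_cases hin : i = n
    · subst hin
      rw [List.prod_eq_one, one_mul]
      intro x hx
      obtain ⟨j, hj, rfl⟩ := List.mem_map.1 hx
      have := List.mem_range.1 hj
      exact h j (by omega) (by omega)
    · rw [h n (by omega) (Ne.symm hin), mul_one]
      exact ih (by omega) fun j hj hne => h j (by omega) hne

end words

namespace ExpExpr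

variable {A B K : Type*} [Group K]

/-- Substitution of words for letters. -/
def bindLetters (φ : A → List B) (E : ExpExpr A) : ExpExpr B :=
  (E.1.flatMap φ, E.2.map fun t => (t.1.flatMap φ, t.2.1, t.2.2.flatMap φ))

theorem vars_bindLetters (φ : A → List B) (E : ExpExpr A) : (E.bindLetters φ).vars = E.vars := by
  simp [vars, bindLetters]

theorem subst_bindLetters (φ : A → List B) (E : ExpExpr A) (ν : ℕ → ℕ) :
    (E.bindLetters φ).subst ν = (E.subst ν).flatMap φ := by
  have h : ∀ n w, (List.replicate n (List.flatMap φ w)).flatten =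
      (List.replicate n w).flatten.flatMap φ := by
    intro n w
    induction n <;> simp_all [List.replicate_succ]
  simp only [subst, bindLetters, List.flatMap_append, List.map_map]
  congr 1
  induction E.2 with
  | nil => simp
  | cons t l ih => simp [h] at ih ⊢; simp [ih]

/-- The expression as a product of powers. The variable `x` becomes `x + 1`; the variable `0` is
used for the constant exponent `1`. -/
def toSegs (E : ExpExpr A) : Segs A :=
  (E.1, 0) :: E.2.flatMap fun t => [(t.1, t.2.1 + 1), (t.2.2, 0)]

theorem powProd_toSegs (g : A → K) (E : ExpExpr A) (ν : ℕ → ℕ) (hν : ν 0 = 1) :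
    powProd g E.toSegs ν = evalWord g (E.subst fun x => ν (x + 1)) := by
  simp only [toSegs, subst, powProd_cons, evalWord_append, hν, pow_one, evalWord_flatten]
  congr 1
  induction E.2 with
  | nil => simp
  | cons t l ih => simp [hν, ih, mul_assoc]

theorem exists_isSolution_iff (g : A → K) (E : ExpExpr A) :
    (∃ ν, E.IsSolution g ν) ↔ ∃ ν, ν 0 = 1 ∧ powProd g E.toSegs ν = 1 := by
  constructor
  · rintro ⟨ν, h⟩
    refine ⟨fun x => Nat.casesOn x 1 ν, rfl, ?_⟩
    rw [powProd_toSegs _ _ _ rfl]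
    exact h
  · rintro ⟨ν, h0, h⟩
    exact ⟨fun x => ν (x + 1), by rwa [powProd_toSegs _ _ _ h0] at h⟩

/-- The product of powers `L`, whose variable `0` has the value `1`, as an expression. -/
def ofSegs (L : Segs A) : ExpExpr A :=
  ([], L.map fun s => bif eqTest s.2 0 then ([], 0, s.1) else (s.1, s.2 - 1, []))

theorem evalWord_subst_ofSegs (g : A → K) (L : Segs A) (ν : ℕ → ℕ) (hν : ν 0 = 1) :
    evalWord g ((ofSegs L).subst fun x => ν (x + 1)) = powProd g L ν := by
  simp only [ofSegs, subst, evalWord_append, evalWord_nil, one_mul, evalWord_flatten]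
  induction L with
  | nil => simp
  | cons s L ih =>
    simp only [List.map_cons, List.prod_cons, ih, powProd_cons]
    congr 1
    rcases Nat.eq_zero_or_pos s.2 with h | h
    · simp [h, hν]
    · have h' : eqTest s.2 0 = false := eqTest_of_ne (by omega)
      simp only [h', cond_false, evalWord_append, evalWord_replicate_flatten, evalWord_nil,
        mul_one]
      rw [Nat.sub_add_cancel h]

end ExpExpr

section computability

variable {ι A B : Type*} [Primcodable ι] [Primcodable A] [Primcodable B]

@[fun_prop]
theorem Computable.invWord {i : A → A} (hi : Computable i) {w : ι → List A} (hw : Computable w) :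
    Computable fun a => invWord i (w a) := by
  unfold _root_.invWord
  fun_prop

@[fun_prop]
theorem Computable.bindLetters {φ : ι → A → List B} (hφ : Computable fun x : ι × A => φ x.1 x.2)
    {E : ι → ExpExpr A} (hE : Computable E) :
    Computable fun a => (E a).bindLetters (φ a) := by
  unfold ExpExpr.bindLetters
  fun_prop

@[fun_prop]
theorem Computable.toSegs {E : ι → ExpExpr A} (hE : Computable E) :
    Computable fun a => (E a).toSegs := by
  unfold ExpExpr.toSegs
  fun_prop

@[fun_prop]
theorem Computable.ofSegs {L : ι → Segs A} (hL : Computable L) :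
    Computable fun a => ExpExpr.ofSegs (L a) := by
  unfold ExpExpr.ofSegs
  fun_prop

theorem ComputablePred.of_reduction {p : A → Prop} {r : ι → Prop} (hp : ComputablePred p)
    {f : ι → A} (hf : Computable f) (h : ∀ i, r i ↔ p (f i)) : ComputablePred r := by
  obtain ⟨g, hg, hgp⟩ := hp.exists_computable
  exact ComputablePred.of_computable (f := fun i => g (f i)) (by fun_prop) fun i => by
    rw [hgp, h]

theorem ComputablePred.and_computable {p : ι → Prop} {c : ι → Bool} {q : ι → Prop}
    (hp : ComputablePred p) (hc : Computable c) (h : ∀ i, q i ↔ (c i = true ∧ p i)) :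
    ComputablePred q := by
  obtain ⟨g, hg, hgp⟩ := hp.exists_computable
  exact ComputablePred.of_computable (f := fun i => c i && g i) (by fun_prop) fun i => by
    rw [h, Bool.and_eq_true, hgp]

/-- Every element of the list `l` of numbers occurs only once. -/
def nodupTest (l : List ℕ) : Bool :=
  l.all fun x => eqTest (l.filter fun y => eqTest y x).length 1

theorem nodupTest_iff {l : List ℕ} : nodupTest l = true ↔ l.Nodup := by
  have h : ∀ x, (l.filter fun y => eqTest y x).length = l.count x := by
    intro x
    rw [List.count_eq_length_filter]
    congr 2
  simp only [nodupTest, List.all_eq_true, eqTest_iff, h]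
  exact List.nodup_iff_count_eq_one.symm

@[fun_prop]
theorem Computable.vars {E : ι → ExpExpr A} (hE : Computable E) :
    Computable fun a => (E a).vars := by
  unfold ExpExpr.vars
  fun_prop

theorem exists_computable_isKnapsack :
    ∃ c : ExpExpr A → Bool, Computable c ∧ ∀ E, c E = true ↔ E.IsKnapsack := by
  refine ⟨fun E => nodupTest E.vars, ?_, fun E => nodupTest_iff⟩
  unfold nodupTest
  fun_prop

end computability

/-! ### Systems of exponent equations and knapsack over direct powers -/

section powers

variable {G : Type*} [Group G] {p : ℕ} {a : Fin p → G}

theorem ExpEqDecidable.segs (h : ExpEqDecidable a) :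
    ComputablePred fun S : List (Segs (Fin p)) =>
      ∃ ν, ν 0 = 1 ∧ ∀ L ∈ S, powProd a L ν = 1 := by
  refine h.of_reduction (f := fun S => S.map fun L => ExpExpr.ofSegs L) (by fun_prop) fun S => ?_
  constructor
  · rintro ⟨ν, h0, h⟩
    refine ⟨fun x => ν (x + 1), fun E hE => ?_⟩
    obtain ⟨L, hL, rfl⟩ := List.mem_map.1 hE
    rw [ExpExpr.IsSolution, ExpExpr.evalWord_subst_ofSegs _ _ _ h0, h L hL]
  · rintro ⟨ν, h⟩
    refine ⟨fun x => Nat.casesOn x 1 ν, rfl, fun L hL => ?_⟩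
    rw [← ExpExpr.evalWord_subst_ofSegs _ _ _ rfl]
    exact h _ (List.mem_map.2 ⟨L, hL, rfl⟩)

theorem evalWord_powLetter {m : ℕ} (j : Fin m) (w : List (ℕ × Fin p)) :
    evalWord (powLetter a m) w j =
      evalWord a (w.flatMap fun l => bif eqTest l.1 j.1 then [l.2] else []) := by
  induction w with
  | nil => simp
  | cons l w ih =>
    rw [evalWord_cons, Pi.mul_apply, ih, List.flatMap_cons, evalWord_append]
    congr 1
    by_cases h : l.1 = j
    · simp [powLetter, h]
    · have h' : eqTest l.1 j.1 = false := eqTest_of_ne h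
      simp [powLetter, h', Ne.symm h]

theorem exists_computable_lettersIn :
    ∃ c : ℕ × ExpExpr (ℕ × Fin p) → Bool, Computable c ∧ ∀ I, c I = true ↔
      I.2.LettersIn (fun l => l.1 < I.1) ∧ I.2.IsKnapsack := by
  obtain ⟨k, hk, hk'⟩ := exists_computable_isKnapsack (A := ℕ × Fin p)
  refine ⟨fun I => ((I.2.1.all fun l => leTest (l.1 + 1) I.1) && I.2.2.all fun t =>
    (t.1.all fun l => leTest (l.1 + 1) I.1) && t.2.2.all fun l => leTest (l.1 + 1) I.1) && k I.2,
    by fun_prop, fun I => ?_⟩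
  simp only [Bool.and_eq_true, List.all_eq_true, leTest_iff, Nat.succ_le_iff, hk',
    ExpExpr.LettersIn]

/-- Solvability over `G^m` is a system of exponent equations, one for each coordinate. -/
theorem ExpEqDecidable.kpPowers (h : ExpEqDecidable a) : KPPowersDecidable a := by
  obtain ⟨c, hc, hc'⟩ := exists_computable_lettersIn (p := p)
  have h' := h.of_reduction (ι := ℕ × ExpExpr (ℕ × Fin p))
    (f := fun I => (List.range I.1).map fun j =>
      I.2.bindLetters fun l => bif eqTest l.1 j then [l.2] else [])
    (r := fun I => ∃ ν, I.2.IsSolution (powLetter a I.1) ν) (by fun_prop) fun I => ?_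
  · exact h'.and_computable hc fun I => by rw [hc']
  · refine exists_congr fun ν => ?_
    simp only [ExpExpr.IsSolution, List.mem_map, List.mem_range, forall_exists_index, and_imp,
      forall_apply_eq_imp_iff₂, ExpExpr.subst_bindLetters, funext_iff, evalWord_powLetter,
      Pi.one_apply, Fin.forall_iff]

/-- The word `w` over `a` in the coordinate `i` of a direct power. -/
def atCoord {p : ℕ} (i : ℕ) (w : List (Fin p)) : List (ℕ × Fin p) := w.map fun s => (i, s)

theorem evalWord_atCoord {m : ℕ} (j : Fin m) (i : ℕ) (w : List (Fin p)) :
    evalWord (powLetter a m) (atCoord i w) j = if (j : ℕ) = i then evalWord a w else 1 := by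
  induction w with
  | nil => simp [atCoord]
  | cons x w ih =>
    simp only [atCoord, List.map_cons, evalWord_cons, Pi.mul_apply] at ih ⊢
    rw [ih]
    split_ifs with h <;> simp [powLetter, h]

/-- The occurrences of powers in a system: the index of the equation, the base, the variable. -/
def occurrences {p : ℕ} (S : List (Segs (Fin p))) : List (ℕ × List (Fin p) × ℕ) :=
  (List.range S.length).flatMap fun e => (S.getD e []).map fun s => (e, s)

/-- The base of the power of the variable `x` in `powersExpr`: it has the base of the `o`-th
occurrence in the coordinate `n + o`, if this is an occurrence of `x`. -/
def powersBase {p : ℕ} (S : List (Segs (Fin p))) (x : ℕ) : List (ℕ × Fin p) :=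
  (List.range (occurrences S).length).flatMap fun o =>
    bif eqTest ((occurrences S).getD o (0, [], 0)).2.2 x then
      atCoord (S.length + o) ((occurrences S).getD o (0, [], 0)).2.1 else []

/-- A bound for the variables of a system. -/
def varBound {p : ℕ} (S : List (Segs (Fin p))) : ℕ := ((occurrences S).map fun o => o.2.2).sum

/-- A system of `n` equations whose variable `0` has the value `1`, as a knapsack expression over a
direct power. The `o`-th occurrence `u^x` of a power, in the equation `e`, is replaced by `u^y` in
the coordinate `e`, with a new variable `y`. The coordinate `n + o` has the value `u^x u^(-y)`,
which ensures that `u^x = u^y`. -/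
def powersExpr {p : ℕ} (i : Fin p → Fin p) (S : List (Segs (Fin p))) : ExpExpr (ℕ × Fin p) :=
  (powersBase S 0, ((List.range (varBound S)).map fun x => (powersBase S (x + 1), x, [])) ++
    (List.range (occurrences S).length).map fun o =>
      (atCoord ((occurrences S).getD o (0, [], 0)).1 ((occurrences S).getD o (0, [], 0)).2.1 ++
        atCoord (S.length + o) (invWord i ((occurrences S).getD o (0, [], 0)).2.1),
        varBound S + o, []))

theorem computable_powersExpr (i : Fin p → Fin p) : Computable (powersExpr i) := by
  have hi : Computable i := Computable.of_finite i
  unfold powersExpr varBound powersBase occurrences atCoord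
  fun_prop

theorem isKnapsack_powersExpr (i : Fin p → Fin p) (S : List (Segs (Fin p))) :
    (powersExpr i S).IsKnapsack := by
  have : (powersExpr i S).vars = List.range (varBound S + (occurrences S).length) := by
    simp [ExpExpr.vars, powersExpr, List.range_add, Function.comp_def]
  rw [ExpExpr.IsKnapsack, this]
  exact List.nodup_range

theorem getD_mem {α : Type*} {l : List α} {i : ℕ} {d : α} (hi : i < l.length) :
    l.getD i d ∈ l := by
  rw [List.getD_eq_getElem (hn := hi)]
  exact List.getElem_mem _

theorem occurrences_fst_lt {S : List (Segs (Fin p))} {o : ℕ} (ho : o < (occurrences S).length) :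
    ((occurrences S).getD o (0, [], 0)).1 < S.length := by
  have h := getD_mem (d := (0, [], 0)) ho
  generalize (occurrences S).getD o (0, [], 0) = x at h
  obtain ⟨e, he, h⟩ := List.mem_flatMap.1 h
  obtain ⟨s, -, rfl⟩ := List.mem_map.1 h
  exact List.mem_range.1 he

theorem lettersIn_powersExpr (i : Fin p → Fin p) (S : List (Segs (Fin p))) :
    (powersExpr i S).LettersIn fun l => l.1 < S.length + (occurrences S).length := by
  have hbase : ∀ x, ∀ l ∈ powersBase S x, l.1 < S.length + (occurrences S).length := by
    intro x l hl
    obtain ⟨o, ho, hl⟩ := List.mem_flatMap.1 hl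
    have := List.mem_range.1 ho
    cases h : eqTest ((occurrences S).getD o (0, [], 0)).2.2 x
    · simp [h, -List.getD_eq_getElem?_getD] at hl
    · simp only [h, cond_true, atCoord, List.mem_map] at hl
      obtain ⟨_, _, rfl⟩ := hl
      dsimp only
      omega
  refine ⟨hbase 0, fun t ht => ?_⟩
  rcases List.mem_append.1 ht with ht | ht
  · obtain ⟨x, -, rfl⟩ := List.mem_map.1 ht
    exact ⟨hbase _, by simp⟩
  · obtain ⟨o, ho, rfl⟩ := List.mem_map.1 ht
    have ho := List.mem_range.1 ho
    refine ⟨fun l hl => ?_, by simp⟩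
    have h1 : ((occurrences S).getD o (0, [], 0)).1 < S.length := occurrences_fst_lt ho
    rcases List.mem_append.1 hl with hl | hl
    · obtain ⟨_, _, rfl⟩ := List.mem_map.1 hl
      dsimp only
      omega
    · obtain ⟨_, _, rfl⟩ := List.mem_map.1 hl
      dsimp only
      omega

theorem evalWord_powersBase_of_lt {m : ℕ} {S : List (Segs (Fin p))} (j : Fin m)
    (hj : j < S.length) (x : ℕ) : evalWord (powLetter a m) (powersBase S x) j = 1 := by
  rw [powersBase, evalWord_flatMap, Pi.list_prod_apply, List.prod_eq_one]
  intro y hy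
  simp only [List.mem_map] at hy
  obtain ⟨_, ⟨o, _, rfl⟩, rfl⟩ := hy
  cases eqTest ((occurrences S).getD o (0, [], 0)).2.2 x
  · simp
  · rw [cond_true, evalWord_atCoord, if_neg (by omega)]

theorem evalWord_powersBase {m : ℕ} {S : List (Segs (Fin p))} (j : Fin m) {o : ℕ}
    (ho : o < (occurrences S).length) (hj : (j : ℕ) = S.length + o) (x : ℕ) :
    evalWord (powLetter a m) (powersBase S x) j =
      if ((occurrences S).getD o (0, [], 0)).2.2 = x then
        evalWord a ((occurrences S).getD o (0, [], 0)).2.1 else 1 := by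
  rw [powersBase, evalWord_flatMap, Pi.list_prod_apply, List.map_map,
    prod_map_range_eq_single _ ho]
  · simp only [Function.comp_apply]
    by_cases h : ((occurrences S).getD o (0, [], 0)).2.2 = x
    · rw [if_pos h, eqTest_iff.2 h, cond_true, evalWord_atCoord, if_pos hj]
    · rw [if_neg h, eqTest_of_ne h, cond_false]
      simp
  · intro o' _ hne
    simp only [Function.comp_apply]
    cases eqTest ((occurrences S).getD o' (0, [], 0)).2.2 x
    · simp
    · rw [cond_true, evalWord_atCoord, if_neg (by omega)]

/-- The value of `powersExpr` at a coordinate. -/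
theorem evalWord_subst_powersExpr (i : Fin p → Fin p) (S : List (Segs (Fin p))) {m : ℕ}
    (j : Fin m) (μ ν : ℕ → ℕ) (h0 : ν 0 = 1) (hν : ∀ x < varBound S, ν (x + 1) = μ x) :
    evalWord (powLetter a m) ((powersExpr i S).subst μ) j =
      ((List.range (varBound S + 1)).map fun x =>
        evalWord (powLetter a m) (powersBase S x) j ^ ν x).prod *
      ((List.range (occurrences S).length).map fun o =>
        (evalWord (powLetter a m) (atCoord ((occurrences S).getD o (0, [], 0)).1
            ((occurrences S).getD o (0, [], 0)).2.1) j *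
          evalWord (powLetter a m) (atCoord (S.length + o)
            (invWord i ((occurrences S).getD o (0, [], 0)).2.1)) j) ^ μ (varBound S + o)).prod := by
  simp only [powersExpr, ExpExpr.subst, evalWord_append, evalWord_flatten, List.map_append,
    List.prod_append, List.map_map, Pi.mul_apply, Pi.list_prod_apply, Function.comp_def,
    evalWord_nil, mul_one, Pi.pow_apply, List.map_replicate,
    List.prod_replicate]
  rw [← mul_assoc]
  congr 1
  rw [List.range_succ_eq_map, List.map_cons, List.prod_cons, h0, pow_one, List.map_map]
  congr 2
  refine List.map_congr_left fun x hx => ?_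
  simp only [Function.comp_apply, Nat.succ_eq_add_one]
  rw [hν x (List.mem_range.1 hx)]

theorem powersExpr_spec {i : Fin p → Fin p} (hi : ∀ x, a (i x) = (a x)⁻¹)
    (S : List (Segs (Fin p))) : (∃ ν, ν 0 = 1 ∧ ∀ L ∈ S, powProd a L ν = 1) ↔
      ∃ μ, (powersExpr i S).IsSolution (powLetter a (S.length + (occurrences S).length)) μ := by
  set O := occurrences S with hO
  set n := S.length
  -- the coordinate `n + o` relates the two variables of the occurrence `o`
  have hocc : ∀ (μ ν : ℕ → ℕ), ν 0 = 1 → (∀ x < varBound S, ν (x + 1) = μ x) → ∀ o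
      (ho : o < O.length), evalWord (powLetter a (n + O.length)) ((powersExpr i S).subst μ)
        ⟨n + o, by omega⟩ = evalWord a (O.getD o (0, [], 0)).2.1 ^ ν (O.getD o (0, [], 0)).2.2 *
        (evalWord a (O.getD o (0, [], 0)).2.1)⁻¹ ^ μ (varBound S + o) := by
    intro μ ν h0 hν o ho
    rw [evalWord_subst_powersExpr i S _ μ ν h0 hν, ← hO]
    have hx : (O.getD o (0, [], 0)).2.2 < varBound S + 1 :=
      Nat.lt_succ_of_le (List.le_sum_of_mem (List.mem_map.2 ⟨_, getD_mem ho, rfl⟩))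
    have he : (O.getD o (0, [], 0)).1 < n := occurrences_fst_lt ho
    congr 1
    · rw [prod_map_range_eq_single _ hx]
      · rw [evalWord_powersBase _ ho rfl, if_pos rfl]
      · intro x _ hne
        rw [evalWord_powersBase _ ho rfl, if_neg (Ne.symm hne), one_pow]
    · rw [prod_map_range_eq_single _ ho]
      · rw [evalWord_atCoord, evalWord_atCoord, if_pos rfl, if_neg (by dsimp only; omega), one_mul,
          evalWord_invWord hi]
      · intro o' ho' hne
        have he' : (O.getD o' (0, [], 0)).1 < n := occurrences_fst_lt ho'
        rw [evalWord_atCoord, evalWord_atCoord, if_neg (by dsimp only; omega),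
          if_neg (by dsimp only; omega), one_mul, one_pow]
  -- if the variables are related, then the coordinate `e` is the value of the equation `e`
  have heq : ∀ (μ ν : ℕ → ℕ), ν 0 = 1 → (∀ x < varBound S, ν (x + 1) = μ x) →
      (∀ o < O.length, evalWord a (O.getD o (0, [], 0)).2.1 ^ ν (O.getD o (0, [], 0)).2.2 =
        evalWord a (O.getD o (0, [], 0)).2.1 ^ μ (varBound S + o)) → ∀ e (he : e < n),
      evalWord (powLetter a (n + O.length)) ((powersExpr i S).subst μ) ⟨e, by omega⟩ =
        powProd a (S.getD e []) ν := by
    intro μ ν h0 hν hrel e he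
    rw [evalWord_subst_powersExpr i S _ μ ν h0 hν, ← hO, List.prod_eq_one, one_mul]
    · have h1 : ((List.range O.length).map fun o =>
          (evalWord (powLetter a (n + O.length)) (atCoord (O.getD o (0, [], 0)).1
              (O.getD o (0, [], 0)).2.1) ⟨e, by omega⟩ *
            evalWord (powLetter a (n + O.length)) (atCoord (S.length + o)
              (invWord i (O.getD o (0, [], 0)).2.1)) ⟨e, by omega⟩) ^ μ (varBound S + o)) =
          O.map fun o => if e = o.1 then evalWord a o.2.1 ^ ν o.2.2 else 1 := by
        rw [map_eq_map_range O _ (0, [], 0)]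
        refine List.map_congr_left fun o ho => ?_
        rw [evalWord_atCoord, evalWord_atCoord]
        dsimp only
        rw [if_neg (show ¬ e = S.length + o by omega), mul_one, hrel o (List.mem_range.1 ho)]
        split_ifs <;> simp
      rw [h1, hO, occurrences, List.map_flatMap, List.flatMap_def, List.prod_flatten, List.map_map,
        prod_map_range_eq_single _ he]
      · simp [powProd, Function.comp_def]
      · intro e' _ hne
        rw [Function.comp_apply, List.prod_eq_one]
        simp only [List.map_map, List.mem_map, Function.comp_apply, if_neg (Ne.symm hne)]
        rintro _ ⟨_, -, rfl⟩
        rfl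
    · intro y hy
      obtain ⟨x, -, rfl⟩ := List.mem_map.1 hy
      rw [evalWord_powersBase_of_lt _ he, one_pow]
  constructor
  · rintro ⟨ν, h0, h⟩
    let μ : ℕ → ℕ := fun y => if y < varBound S then ν (y + 1) else
      ν (O.getD (y - varBound S) (0, [], 0)).2.2
    have hμ : ∀ x < varBound S, ν (x + 1) = μ x := fun x hx => by simp only [μ, if_pos hx]
    have hμ' : ∀ o, μ (varBound S + o) = ν (O.getD o (0, [], 0)).2.2 := fun o => by
      simp only [μ]
      rw [if_neg (by omega), Nat.add_sub_cancel_left]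
    refine ⟨μ, funext fun j => ?_⟩
    by_cases hj : (j : ℕ) < n
    · have := heq μ ν h0 hμ (fun o _ => by rw [hμ']) j hj
      rw [Fin.eta] at this
      rw [this, h _ (getD_mem hj), Pi.one_apply]
    · have := hocc μ ν h0 hμ (j - n) (by omega)
      have hj' : (⟨n + (j - n), by omega⟩ : Fin (n + O.length)) = j := by
        apply Fin.ext; dsimp only; omega
      rw [hj', hμ'] at this
      rw [this]
      simp
  · rintro ⟨μ, h⟩
    have h' : ∀ j, evalWord (powLetter a (n + O.length)) ((powersExpr i S).subst μ) j = 1 :=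
      fun j => congrFun h j
    let ν : ℕ → ℕ := fun x => Nat.casesOn x 1 μ
    refine ⟨ν, rfl, fun L hL => ?_⟩
    obtain ⟨e, he, rfl⟩ := List.getElem_of_mem hL
    have := heq μ ν rfl (fun x _ => rfl) (fun o ho => ?_) e he
    · rw [h', List.getD_eq_getElem (hn := he)] at this
      exact this.symm
    · have := hocc μ ν rfl (fun x _ => rfl) o ho
      rw [h', inv_pow] at this
      exact (mul_inv_eq_one.1 this.symm)

/-- A system of exponent equations reduces to a knapsack expression over a direct power: repeated
variables are replaced by different ones, and further coordinates enforce that the corresponding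
powers agree. -/
theorem KPPowersDecidable.expEq (ha : ∀ i, ∃ j, a j = (a i)⁻¹) (h : KPPowersDecidable a) :
    ExpEqDecidable a := by
  choose i hi using ha
  have hcomp := computable_powersExpr i
  have hocc : Computable (occurrences (p := p)) := by unfold occurrences; fun_prop
  refine h.of_reduction (f := fun S : List (ExpExpr (Fin p)) =>
    ((S.map fun E => E.toSegs).length + (occurrences (S.map fun E => E.toSegs)).length,
      powersExpr i (S.map fun E => E.toSegs))) (by fun_prop) fun S => ?_
  rw [and_iff_right ⟨lettersIn_powersExpr i _, isKnapsack_powersExpr i _⟩, ← powersExpr_spec hi]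
  constructor
  · rintro ⟨ν, hν⟩
    refine ⟨fun x => Nat.casesOn x 1 ν, rfl, fun L hL => ?_⟩
    obtain ⟨E, hE, rfl⟩ := List.mem_map.1 hL
    rw [ExpExpr.powProd_toSegs _ _ _ rfl]
    exact hν E hE
  · rintro ⟨ν, h0, hν⟩
    refine ⟨fun x => ν (x + 1), fun E hE => ?_⟩
    rw [ExpExpr.IsSolution, ← ExpExpr.powProd_toSegs _ _ _ h0]
    exact hν _ (List.mem_map.2 ⟨E, hE, rfl⟩)

end powers

/-! ### Exponent equations over a knapsack-semilinear group -/

section knapsackSemilinear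

variable {ι H : Type*} [Primcodable ι] [Group H] {q : ℕ} {b : Fin q → H}

/-- The knapsack expression `u₀^x₀ u₁^x₁ ⋯` with consecutive variables. -/
def indexExpr {A : Type*} (L : List (List A)) : ExpExpr A :=
  ([], (List.range L.length).map fun i => (L.getD i [], i, []))

theorem vars_indexExpr {A : Type*} (L : List (List A)) :
    (indexExpr L).vars = List.range L.length := by
  simp [ExpExpr.vars, indexExpr, Function.comp_def]

theorem get_vars_indexExpr {A : Type*} (L : List (List A)) (i : Fin (indexExpr L).depth) :
    (indexExpr L).vars.get i = i := by
  have h : ∀ (l : List ℕ) (i : Fin l.length), l = List.range L.length → l.get i = i := by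
    rintro l i rfl
    simp
  exact h _ i (vars_indexExpr L)

theorem depth_indexExpr {A : Type*} (L : List (List A)) :
    (indexExpr L).depth = L.length := by
  simp [ExpExpr.depth, vars_indexExpr]

theorem isSolution_indexExpr (L : Segs (Fin q)) {ν μ : ℕ → ℕ}
    (h : ∀ i < L.length, ν i = μ (L.getD i ([], 0)).2) :
    (indexExpr (L.map Prod.fst)).IsSolution b ν ↔ powProd b L μ = 1 := by
  have : evalWord b ((indexExpr (L.map Prod.fst)).subst ν) = powProd b L μ := by
    simp only [ExpExpr.subst, indexExpr, evalWord_append, evalWord_nil, one_mul, powProd,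
      evalWord_flatten, List.map_map, List.length_map]
    rw [map_eq_map_range L (fun s => evalWord b s.1 ^ μ s.2) ([], 0)]
    congr 1
    refine List.map_congr_left fun i hi => ?_
    have hi' := List.mem_range.1 hi
    simp only [Function.comp_apply, List.append_nil, evalWord_replicate_flatten]
    rw [h i hi', getD_map_of_lt _ _ ([], 0) _ hi']
  rw [ExpExpr.IsSolution, this]

theorem mem_solSet_indexExpr (L : List (List (Fin q))) (ν : ℕ → ℕ) :
    (fun j : Fin (indexExpr L).depth => ν j) ∈ (indexExpr L).solSet b ↔
      (indexExpr L).IsSolution b ν := by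
  constructor
  · rintro ⟨μ, hμ, h⟩
    have hνμ : ∀ j < L.length, ν j = μ j := by
      intro j hj
      have := h ⟨j, by rwa [depth_indexExpr]⟩
      rwa [get_vars_indexExpr] at this
    have key : (indexExpr L).subst ν = (indexExpr L).subst μ := by
      simp only [ExpExpr.subst, indexExpr, List.map_map]
      congr 2
      refine List.map_congr_left fun i hi => ?_
      simp only [Function.comp_apply]
      rw [hνμ i (List.mem_range.1 hi)]
    rwa [ExpExpr.IsSolution, key]
  · intro h
    exact ⟨ν, h, fun i => by rw [get_vars_indexExpr]⟩

/-- Exponent equations over a knapsack-semilinear group have effectively semilinear solution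
sets, also if variables are repeated: the occurrences get different new variables, which are
identified with the old variables and then projected away. -/
theorem IsKnapsackSemilinear.eff_eq_one (hH : IsKnapsackSemilinear b) {L : ι → Segs (Fin q)}
    (hL : Computable L) : Eff fun i ν => powProd b (L i) ν = 1 := by
  obtain ⟨f, hf, h⟩ := hH
  let N : ι → ℕ := fun i => ((L i).map fun s => s.2).sum + 1
  have hN : Computable N := by fun_prop
  have hind : Computable fun i => indexExpr ((L i).map Prod.fst) := by
    unfold indexExpr; fun_prop
  have h1 : Eff fun i (μ : ℕ → ℕ) => ∀ m ∈ List.range (L i).length,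
      ((L i).getD m ([], 0)).2 ≠ N i + m → μ (N i + m) = 1 * μ ((L i).getD m ([], 0)).2 + 0 := by
    refine Eff.forall_mem (S := fun i m (μ : ℕ → ℕ) => ((L i).getD m ([], 0)).2 ≠ N i + m →
      μ (N i + m) = 1 * μ ((L i).getD m ([], 0)).2 + 0) ?_ (by fun_prop)
    refine (Eff.affine.comp (g := fun x : ι × ℕ =>
      (N x.1 + x.2, ((L x.1).getD x.2 ([], 0)).2, 1, 0, 0)) (by fun_prop)).or
      (Eff.const (p := fun x : ι × ℕ => eqTest (N x.1 + x.2) ((L x.1).getD x.2 ([], 0)).2)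
        (by fun_prop)) |>.of_iff fun x ν => ?_
    by_cases hx : N x.1 + x.2 = ((L x.1).getD x.2 ([], 0)).2
    · simp [-List.getD_eq_getElem?_getD, hx]
    · simp [-List.getD_eq_getElem?_getD, hx, Ne.symm hx]
  have h2 : Eff fun i (μ : ℕ → ℕ) =>
      slMem (L i).length (f (indexExpr ((L i).map Prod.fst))) fun j => μ (N i + j) :=
    ⟨fun i => N i + (L i).length, fun i => placeRep (N i) (L i).length (N i + (L i).length)
      (f (indexExpr ((L i).map Prod.fst))), by fun_prop, by fun_prop, fun i μ => by
        rw [slMem_placeRep le_rfl]⟩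
  refine ((h1.and h2).exists_ge hN).of_iff fun i ν => ?_
  have hlt : ∀ m < (L i).length, ((L i).getD m ([], 0)).2 < N i := fun m hm =>
    Nat.lt_succ_of_le (List.le_sum_of_mem (List.mem_map.2 ⟨_, getD_mem hm, rfl⟩))
  have hsol : ∀ μ : ℕ → ℕ, slMem (L i).length (f (indexExpr ((L i).map Prod.fst))) μ ↔
      (indexExpr ((L i).map Prod.fst)).IsSolution b μ := by
    intro μ
    have hk : (indexExpr ((L i).map Prod.fst)).IsKnapsack := by
      rw [ExpExpr.IsKnapsack, vars_indexExpr]; exact List.nodup_range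
    rw [← mem_solSet_indexExpr, h _ hk, mem_semilinearSetOf_iff, depth_indexExpr, List.length_map]
  simp only [hsol, one_mul, add_zero, List.mem_range]
  constructor
  · intro hν
    refine ⟨fun j => if j < N i then ν j else ν ((L i).getD (j - N i) ([], 0)).2,
      fun j hj => if_pos hj, fun m hm _ => ?_, ?_⟩
    · beta_reduce
      rw [if_neg (by omega), if_pos (hlt m hm), Nat.add_sub_cancel_left]
    · refine (isSolution_indexExpr (L i) fun m hm => ?_).2 hν
      beta_reduce
      rw [if_neg (by omega), Nat.add_sub_cancel_left]
  · rintro ⟨μ, hμ, hm, hs⟩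
    refine (isSolution_indexExpr (L i) fun m hm' => ?_).1 hs
    have := hlt m hm'
    rw [hm m hm' (by omega), hμ _ this]

theorem IsKnapsackSemilinear.eff_eq (hH : IsKnapsackSemilinear b)
    (hb : ∀ i, ∃ j, b j = (b i)⁻¹) {L L' : ι → Segs (Fin q)} (hL : Computable L)
    (hL' : Computable L') : Eff fun i ν => powProd b (L i) ν = powProd b (L' i) ν := by
  choose inv hinv using hb
  have hi : Computable inv := Computable.of_finite inv
  refine (hH.eff_eq_one (L := fun i => L i ++ (L' i).reverse.map fun s =>
    (invWord inv s.1, s.2)) (by fun_prop)).of_iff fun i ν => ?_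
  have : ∀ M : Segs (Fin q), powProd b (M.reverse.map fun s => (invWord inv s.1, s.2)) ν =
      (powProd b M ν)⁻¹ := by
    intro M
    induction M with
    | nil => simp
    | cons s M ih =>
      rw [List.reverse_cons, List.map_append, powProd_append, ih]
      simp [evalWord_invWord hinv]
  rw [powProd_append, this, mul_inv_eq_one]

/-- The word problem of a knapsack-semilinear group is decidable. -/
theorem IsKnapsackSemilinear.exists_wordEq (hH : IsKnapsackSemilinear b)
    (hb : ∀ i, ∃ j, b j = (b i)⁻¹) : ∃ e : List (Fin q) → List (Fin q) → Bool,
      (Computable fun x : List (Fin q) × List (Fin q) => e x.1 x.2) ∧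
      ∀ u v, e u v = true ↔ evalWord b u = evalWord b v := by
  have h1 := (hH.eff_eq hb (L := fun x : List (Fin q) × List (Fin q) => [(x.1, 0)])
    (L' := fun x => [(x.2, 0)]) (by fun_prop) (by fun_prop)).and
    (Eff.eq_const (x := fun _ => 0) (r := fun _ => 1) (by fun_prop) (by fun_prop))
  obtain ⟨e, he, h⟩ := h1.computablePred_exists.exists_computable
  refine ⟨fun u v => e (u, v), by fun_prop, fun u v => (h (u, v)).trans ?_⟩
  constructor
  · rintro ⟨ν, hν, h0⟩
    simpa [h0] using hν
  · intro h
    exact ⟨fun _ => 1, by simpa using h, rfl⟩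

end knapsackSemilinear

/-! ### Generators of wreath products -/

section wreath

variable {G H : Type*} [Group G] [Group H] {p q r : ℕ} (a : Fin p → G) (b : Fin q → H)

open Classical in
/-- The standard generators of `G ≀ H`: a letter of `G` stands for its value at the position
`1 : H`, a letter of `H` for itself. -/
noncomputable def wreathLetter : Fin p ⊕ Fin q → G ≀ᵣ H
  | .inl s => ⟨Pi.mulSingle 1 (a s), 1⟩
  | .inr t => ⟨1, b t⟩

theorem wreathLetter_mem (l : Fin p ⊕ Fin q) : wreathLetter a b l ∈ wreath G H := by
  classical
  change (Function.mulSupport (wreathLetter a b l).left).Finite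
  cases l with
  | inl s => exact (Set.finite_singleton (1 : H)).subset Pi.mulSupport_mulSingle_subset
  | inr t => simp [wreathLetter]

variable {a b}

theorem evalWord_wreathLetter_inr (w : List (Fin q)) :
    evalWord (wreathLetter a b) (w.map Sum.inr) = ⟨1, evalWord b w⟩ := by
  induction w with
  | nil => rfl
  | cons x w ih =>
    rw [List.map_cons, evalWord_cons, ih]
    ext <;> simp [wreathLetter]

open Classical in
theorem evalWord_wreathLetter_inl (w : List (Fin p)) :
    evalWord (wreathLetter a b) (w.map Sum.inl) = ⟨Pi.mulSingle 1 (evalWord a w), 1⟩ := by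
  induction w with
  | nil => ext <;> simp
  | cons x w ih =>
    rw [List.map_cons, evalWord_cons, ih]
    ext h
    · by_cases hh : h = 1
      · subst hh; simp [wreathLetter]
      · simp [wreathLetter, hh]
    · simp [wreathLetter]

/-- The wreath product is generated by the standard generators. -/
theorem exists_evalWord_wreathLetter (ha : IsSymmGen a) (hb : IsSymmGen b) {x : G ≀ᵣ H}
    (hx : x ∈ wreath G H) : ∃ w, evalWord (wreathLetter a b) w = x := by
  classical
  have hr : ∀ h : H, ∃ w, evalWord (wreathLetter a b) w = ⟨1, h⟩ := by
    intro h
    obtain ⟨w, rfl⟩ := hb.2 h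
    exact ⟨_, evalWord_wreathLetter_inr w⟩
  have hs : ∀ (h : H) (g : G), ∃ w, evalWord (wreathLetter a b) w = ⟨Pi.mulSingle h g, 1⟩ := by
    intro h g
    obtain ⟨v, hv⟩ := hr h
    obtain ⟨v', hv'⟩ := hr h⁻¹
    obtain ⟨w, rfl⟩ := ha.2 g
    refine ⟨v ++ w.map Sum.inl ++ v', ?_⟩
    rw [evalWord_append, evalWord_append, hv, hv', evalWord_wreathLetter_inl]
    ext k
    · by_cases hk : k = h
      · subst hk; simp
      · have : h⁻¹ * k ≠ 1 := fun h' => hk (inv_mul_eq_one.1 h').symm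
        simp [hk, this]
    · simp
  have hf : ∀ (s : Finset H) (f : H → G), Function.mulSupport f ⊆ s →
      ∃ w, evalWord (wreathLetter a b) w = ⟨f, 1⟩ := by
    intro s
    induction s using Finset.induction_on with
    | empty =>
      intro f hf
      refine ⟨[], ?_⟩
      have : f = 1 := by simpa using hf
      rw [this]; rfl
    | insert h s _ ih =>
      intro f hf
      obtain ⟨w, hw⟩ := ih (Function.update f h 1) fun k hk => by
        by_cases hkh : k = h
        · subst hkh; simp at hk
        · have := hf (show k ∈ Function.mulSupport f by simpa [hkh] using hk)
          simpa [hkh] using this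
      obtain ⟨v, hv⟩ := hs h (f h)
      refine ⟨v ++ w, ?_⟩
      rw [evalWord_append, hv, hw]
      ext k
      · by_cases hk : k = h
        · subst hk; simp
        · simp [hk]
      · simp
  have hx' : (Function.mulSupport x.left).Finite := hx
  obtain ⟨w, hw⟩ := hf hx'.toFinset x.left (by simp)
  obtain ⟨v, hv⟩ := hr x.right
  refine ⟨w ++ v, ?_⟩
  rw [evalWord_append, hw, hv]
  ext <;> simp

theorem coe_evalWord (c : Fin r → wreath G H) (w : List (Fin r)) :
    ((evalWord c w : wreath G H) : G ≀ᵣ H) = evalWord (fun i => (c i : G ≀ᵣ H)) w :=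
  map_evalWord (wreath G H).subtype c w

/-- Solvability of knapsack expressions over `G ≀ H` reduces to equations between products of
powers of words in the standard generators. -/
theorem KPDecidable.of_wreathLetter (ha : IsSymmGen a) (hb : IsSymmGen b) (c : Fin r → wreath G H)
    (h : ComputablePred fun L : Segs (Fin p ⊕ Fin q) =>
      ∃ ν, ν 0 = 1 ∧ powProd (wreathLetter a b) L ν = 1) : KPDecidable c := by
  choose tr htr using fun i => exists_evalWord_wreathLetter ha hb (c i).2
  have hc : Computable tr := Computable.of_finite tr
  obtain ⟨k, hk, hk'⟩ := exists_computable_isKnapsack (A := Fin r)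
  have h' := h.of_reduction (ι := ExpExpr (Fin r)) (f := fun E => (E.bindLetters tr).toSegs)
    (r := fun E => ∃ ν, E.IsSolution c ν) (by fun_prop) fun E => ?_
  · exact h'.and_computable hk fun E => by rw [hk']
  · rw [← ExpExpr.exists_isSolution_iff]
    refine exists_congr fun ν => ?_
    rw [ExpExpr.IsSolution, ExpExpr.IsSolution, ExpExpr.subst_bindLetters, evalWord_flatMap,
      ← Subtype.coe_inj, coe_evalWord]
    simp only [htr]
    rfl

/-! ### Direct powers inside wreath products -/

/-- In an infinite group with decidable word problem one can compute a sequence of words that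
represent pairwise different elements. -/
theorem exists_computable_injective [Infinite H] (hb : IsSymmGen b)
    (hH : IsKnapsackSemilinear b) : ∃ W : ℕ → List (Fin q), Computable W ∧
      Function.Injective fun n => evalWord b (W n) := by
  obtain ⟨e, he, he'⟩ := hH.exists_wordEq hb.1
  obtain ⟨f, hf, hf'⟩ := Computable.exists_choice (α := List (List (Fin q)))
    (β := List (Fin q)) (check := fun l w => l.all fun v => !(e v w)) (by fun_prop) fun l => by
      classical
      obtain ⟨h, hh⟩ := Infinite.exists_notMem_finset (l.map (evalWord b)).toFinset
      obtain ⟨w, rfl⟩ := hb.2 h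
      refine ⟨w, ?_⟩
      simp only [List.all_eq_true, Bool.not_eq_true', ← Bool.not_eq_true, he']
      intro v hv hvw
      exact hh (by simpa using ⟨v, hv, hvw⟩)
  let l : ℕ → List (List (Fin q)) := fun n => Nat.rec [] (fun _ l => l ++ [f l]) n
  have hl : Computable l :=
    Computable.nat_rec (f := fun n : ℕ => n) (g := fun _ => []) (h := fun _ x => x.2 ++ [f x.2])
      Computable.id (by fun_prop) (by
        change Computable fun x : ℕ × ℕ × List (List (Fin q)) => x.2.2 ++ [f x.2.2]
        fun_prop)
  have hmem : ∀ n m, m < n → f (l m) ∈ l n := by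
    intro n
    induction n with
    | zero => intro m hm; omega
    | succ n ih =>
      intro m hm
      change _ ∈ l n ++ [f (l n)]
      rcases Nat.lt_succ_iff_lt_or_eq.1 hm with h | rfl
      · exact List.mem_append_left _ (ih m h)
      · simp
  have hne : ∀ n m, m < n → evalWord b (f (l m)) ≠ evalWord b (f (l n)) := by
    intro n m hm
    have := hf' (l n)
    simp only [List.all_eq_true, Bool.not_eq_true', ← Bool.not_eq_true, he'] at this
    exact this _ (hmem n m hm)
  refine ⟨fun n => f (l n), by fun_prop, fun m n hmn => ?_⟩
  rcases lt_trichotomy m n with h | h | h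
  · exact absurd hmn (hne n m h)
  · exact h
  · exact absurd hmn.symm (hne m n h)

/-- `G^m` embeds into `G ≀ᵣ H`, with the `j`-th coordinate at the position `e j`. -/
theorem exists_powEmbedding {e : ℕ → H} (he : Function.Injective e) (m : ℕ) :
    ∃ Φ : (Fin m → G) →* G ≀ᵣ H, Function.Injective Φ ∧ ∀ v,
      Φ v = ⟨Function.extend (fun j : Fin m => e j) v 1, 1⟩ := by
  have hinj : Function.Injective fun j : Fin m => e j := he.comp Fin.val_injective
  refine ⟨⟨⟨fun v => ⟨Function.extend (fun j : Fin m => e j) v 1, 1⟩, ?_⟩, ?_⟩, ?_, fun v => rfl⟩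
  · ext h
    · simp [Function.extend_one]
    · rfl
  · intro v w
    ext h
    · have := congrFun (Function.extend_mul (fun j : Fin m => e j) v w 1 1) h
      simpa using this
    · simp
  · intro v w h
    have h' := congrArg RegularWreathProduct.left h
    funext j
    have := congrFun h' (e j)
    simpa [hinj.extend_apply v 1 j, hinj.extend_apply w 1 j] using this

/-- If `H` is infinite, then the powers `G^m` embed into `G ≀ H` uniformly in `m`, with the
coordinates at pairwise different computable positions. -/
theorem KPDecidable.kpPowers [Infinite H] (hb : IsSymmGen b) (hH : IsKnapsackSemilinear b)
    {c : Fin r → wreath G H} (hc : IsSymmGen c) (h : KPDecidable c) : KPPowersDecidable a := by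
  classical
  obtain ⟨W, hW, hinj⟩ := exists_computable_injective hb hH
  choose i hi using hb.1
  have hic : Computable i := Computable.of_finite i
  choose ta hta using fun s : Fin p => hc.2 ⟨_, wreathLetter_mem a b (Sum.inl s)⟩
  choose tb htb using fun s : Fin q => hc.2 ⟨_, wreathLetter_mem a b (Sum.inr s)⟩
  have hcta : Computable ta := Computable.of_finite ta
  have hctb : Computable tb := Computable.of_finite tb
  have htb' : ∀ w : List (Fin q),
      evalWord (fun i => (c i : G ≀ᵣ H)) (w.flatMap tb) = ⟨1, evalWord b w⟩ := by
    intro w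
    rw [← evalWord_wreathLetter_inr (a := a), evalWord_flatMap, evalWord, List.map_map]
    congr 1
    refine List.map_congr_left fun x _ => ?_
    rw [← coe_evalWord, htb]
    rfl
  obtain ⟨k, hk, hk'⟩ := exists_computable_lettersIn (p := p)
  obtain ⟨d, hd, hd'⟩ := h.exists_computable
  -- the letter `(j, s)` becomes a conjugate of `a s`, which sits at the position `W j`
  let φ : ℕ × Fin p → List (Fin r) := fun l =>
    (W l.1).flatMap tb ++ ta l.2 ++ (invWord i (W l.1)).flatMap tb
  have hφ : Computable φ := by fun_prop
  refine ComputablePred.of_computable (f := fun I => k I && d (I.2.bindLetters φ))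
    (by fun_prop) fun I => ?_
  rw [Bool.and_eq_true, hk', hd']
  refine and_congr_right fun hI => ?_
  rw [ExpExpr.IsKnapsack, ExpExpr.vars_bindLetters]
  rw [and_iff_right (show I.2.vars.Nodup from hI.2)]
  refine exists_congr fun ν => ?_
  obtain ⟨Φ, hΦ, hΦ'⟩ := exists_powEmbedding (G := G) hinj I.1
  have hlet : ∀ l ∈ I.2.subst ν, l.1 < I.1 := by
    intro l hl
    rw [ExpExpr.subst, List.mem_append] at hl
    rcases hl with hl | hl
    · exact hI.1.1 l hl
    · simp only [List.mem_flatten, List.mem_map] at hl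
      obtain ⟨_, ⟨t, ht, rfl⟩, hl⟩ := hl
      rcases List.mem_append.1 hl with hl | hl
      · simp only [List.mem_flatten] at hl
        obtain ⟨w, hw, hl⟩ := hl
        rw [List.eq_of_mem_replicate hw] at hl
        exact (hI.1.2 t ht).1 l hl
      · exact (hI.1.2 t ht).2 l hl
  have key : evalWord (fun i => (c i : G ≀ᵣ H)) ((I.2.subst ν).flatMap φ) =
      Φ (evalWord (powLetter a I.1) (I.2.subst ν)) := by
    rw [map_evalWord, evalWord_flatMap, evalWord]
    congr 1
    refine List.map_congr_left fun l hl => ?_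
    simp only [φ, evalWord_append, htb', evalWord_invWord hi]
    rw [← coe_evalWord, hta, hΦ']
    ext x
    · have hl' := hlet l hl
      have hinj' : Function.Injective fun j : Fin I.1 => evalWord b (W j) :=
        hinj.comp Fin.val_injective
      by_cases hx : x = evalWord b (W l.1)
      · subst hx
        have := hinj'.extend_apply (powLetter a I.1 l) 1 ⟨l.1, hl'⟩
        simp only at this
        simp [this, wreathLetter, powLetter]
      · have hx' : (evalWord b (W l.1))⁻¹ * x ≠ 1 := fun h => hx (inv_mul_eq_one.1 h).symm
        have : Function.extend (fun j : Fin I.1 => evalWord b (W j)) (powLetter a I.1 l) 1 x =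
            1 := by
          by_cases hex : ∃ j : Fin I.1, evalWord b (W j) = x
          · obtain ⟨j, rfl⟩ := hex
            have := hinj'.extend_apply (powLetter a I.1 l) 1 j
            rw [this, powLetter, if_neg]
            intro hj
            exact hx (by rw [hj])
          · rw [Function.extend_apply' _ _ _ hex, Pi.one_apply]
        simp [this, wreathLetter, hx']
    · simp [wreathLetter]
  rw [ExpExpr.IsSolution, ExpExpr.IsSolution, ExpExpr.subst_bindLetters, ← Subtype.coe_inj,
    coe_evalWord, key, Subgroup.coe_one, ← map_one Φ, hΦ.eq_iff]

end wreath

/-! ### Systems of exponent equations with semilinear constraints -/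

section constraints

variable {ι G : Type*} [Primcodable ι] [Group G] {p : ℕ} {a : Fin p → G}

/-- The product of powers `M` with `w + c₀ P₀ + c₁ P₁ + ⋯` substituted for the valuation. The new
variable `i + 1` stands for the coefficient `cᵢ`, the variable `0` for the constant `1`. -/
def substLinear {A : Type*} (L : List ℕ × List (List ℕ)) (M : Segs A) : Segs A :=
  M.flatMap fun s => ((List.replicate (L.1.getD s.2 0) s.1).flatten, 0) ::
    (List.range L.2.length).map fun i =>
      ((List.replicate ((L.2.getD i []).getD s.2 0) s.1).flatten, i + 1)

theorem powProd_substLinear {A : Type*} (g : A → G) (L : List ℕ × List (List ℕ)) (M : Segs A)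
    (c : ℕ → ℕ) (hc : c 0 = 1) : powProd g (substLinear L M) c =
      powProd g M fun j => L.1.getD j 0 +
        ∑ i ∈ Finset.range L.2.length, c (i + 1) * (L.2.getD i []).getD j 0 := by
  rw [substLinear, powProd_flatMap, powProd]
  congr 1
  refine List.map_congr_left fun s _ => ?_
  have h : ∀ n, powProd g ((List.range n).map fun i =>
      ((List.replicate ((L.2.getD i []).getD s.2 0) s.1).flatten, i + 1)) c =
      evalWord g s.1 ^ ∑ i ∈ Finset.range n, c (i + 1) * (L.2.getD i []).getD s.2 0 := by
    intro n
    induction n with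
    | zero => simp
    | succ n ih =>
      rw [List.range_succ, List.map_append, powProd_append, ih, Finset.sum_range_succ, pow_add]
      simp only [List.map_cons, List.map_nil, powProd_cons, powProd_nil, mul_one,
        evalWord_replicate_flatten]
      rw [← pow_mul, mul_comm (c (n + 1))]
  rw [powProd_cons, h, hc, pow_one, evalWord_replicate_flatten, pow_add]

@[fun_prop]
theorem Computable.substLinear {A : Type*} [Primcodable A] {L : ι → List ℕ × List (List ℕ)}
    {M : ι → Segs A} (hL : Computable L) (hM : Computable M) :
    Computable fun i => substLinear (L i) (M i) := by
  unfold _root_.substLinear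
  fun_prop

/-- If systems of exponent equations are decidable, then so are systems with an effectively
semilinear constraint: on each linear set, the coefficients become the variables. -/
theorem ExpEqDecidable.exists_of_eff (h : ExpEqDecidable a) {S : ι → (ℕ → ℕ) → Prop} (hS : Eff S)
    {M : ι → List (Segs (Fin p))} (hM : Computable M) :
    ComputablePred fun i => ∃ ν, S i ν ∧ ∀ L ∈ M i, powProd a L ν = 1 := by
  obtain ⟨k, f, -, hf, hS, hk⟩ := hS.exists_ge_dim
    (K := fun i => (((M i).flatMap fun L => L).map fun s => s.2).sum + 1) (by fun_prop)
  obtain ⟨d, hd, hd'⟩ := h.segs.exists_computable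
  refine ComputablePred.of_computable
    (f := fun i => (f i).any fun L => d ((M i).map (substLinear L))) (by fun_prop) fun i => ?_
  simp only [List.any_eq_true, hd', hS]
  constructor
  · rintro ⟨L, hL, c, h0, hc⟩
    refine ⟨_, ⟨L, hL, fun i => c (i + 1), fun j _ => rfl⟩, fun N hN => ?_⟩
    rw [← powProd_substLinear _ _ _ _ h0]
    exact hc _ (List.mem_map.2 ⟨N, hN, rfl⟩)
  · rintro ⟨ν, ⟨L, hL, c, hc⟩, hν⟩
    refine ⟨L, hL, fun j => Nat.casesOn j 1 c, rfl, fun N' hN' => ?_⟩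
    obtain ⟨N, hN, rfl⟩ := List.mem_map.1 hN'
    rw [powProd_substLinear _ _ _ _ rfl, ← hν N hN]
    refine powProd_congr fun s hs => (hc s.2 ?_).symm
    refine lt_of_lt_of_le (Nat.lt_succ_of_le (List.le_sum_of_mem ?_)) (hk i)
    exact List.mem_map.2 ⟨s, List.mem_flatMap.2 ⟨N, hN, hs⟩, rfl⟩

end constraints

/-! ### Powers in wreath products -/

section wreathPowers

variable {G H : Type*} [Group G] [Group H]

theorem left_pow_add (U : G ≀ᵣ H) (m n : ℕ) (k : H) :
    (U ^ (m + n)).left k = (U ^ m).left k * (U ^ n).left ((U.right ^ m)⁻¹ * k) := by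
  have : ∀ n, (U ^ n).right = U.right ^ n := fun n => map_pow RegularWreathProduct.rightHom U n
  rw [pow_add, RegularWreathProduct.mul_left, Pi.mul_apply, this]

theorem left_pow_eq_one {U : G ≀ᵣ H} {Q : Set H} (hQ : ∀ k, U.left k ≠ 1 → k ∈ Q) {n : ℕ} {k : H}
    (h : ∀ t < n, ∀ w ∈ Q, k ≠ U.right ^ t * w) : (U ^ n).left k = 1 := by
  induction n with
  | zero => simp
  | succ n ih =>
    rw [left_pow_add, ih fun t ht => h t (by omega), one_mul, pow_one]
    by_contra hne
    exact h n (by omega) _ (hQ _ hne) (by group)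

/-- If all coincidences between the translates of `Q` by powers of `U.right` have distance at most
`D`, then only `D` factors on both sides of the `t`-th one contribute to a power of `U` at a
position visited by the `t`-th factor. -/
theorem left_pow_of_bound {U : G ≀ᵣ H} {Q : Set H} (hQ : ∀ k, U.left k ≠ 1 → k ∈ Q) {D : ℕ}
    (hD : ∀ s, D < s → ∀ w ∈ Q, ∀ w' ∈ Q, U.right ^ s * w ≠ w') {x t α β : ℕ} {w : H}
    (hw : w ∈ Q) (hα : α < D ∧ t = α ∨ α = D ∧ D ≤ t)
    (hβ : β < D ∧ x = t + 1 + β ∨ β = D ∧ t + 1 + D ≤ x) :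
    (U ^ x).left (U.right ^ t * w) = (U ^ (α + β + 1)).left (U.right ^ α * w) := by
  obtain ⟨m, rfl⟩ : ∃ m, t = m + α := ⟨t - α, by omega⟩
  obtain ⟨n, rfl⟩ : ∃ n, x = m + ((α + β + 1) + n) := ⟨x - (m + (α + β + 1)), by omega⟩
  have h1 : (U.right ^ m)⁻¹ * (U.right ^ (m + α) * w) = U.right ^ α * w := by
    rw [pow_add]; group
  rw [left_pow_add, left_pow_add, h1, left_pow_eq_one hQ, one_mul, left_pow_eq_one hQ (n := n),
    mul_one]
  · intro s hs w' hw' heq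
    refine hD (s + β + 1) (by omega) w' hw' w hw ?_
    have h2 : U.right ^ (s + β + 1) * w' = U.right ^ (β + 1) * (U.right ^ s * w') := by
      rw [← mul_assoc, ← pow_add]; congr 2; omega
    have h3 : U.right ^ (α + β + 1) = U.right ^ (β + 1) * U.right ^ α := by
      rw [← pow_add]; congr 1; omega
    rw [h2, ← heq, h3]
    group
  · intro s hs w' hw' heq
    refine hD (m + α - s) (by omega) w hw w' hw' ?_
    have h2 : U.right ^ (m + α) = U.right ^ s * U.right ^ (m + α - s) := by
      rw [← pow_add]; congr 1; omega
    rw [h2, mul_assoc] at heq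
    exact mul_left_cancel heq

theorem left_pow_of_right_pow_eq_one {U : G ≀ᵣ H} {D : ℕ} (hD : U.right ^ D = 1) (y r : ℕ)
    (k : H) : (U ^ (D * y + r)).left k = (U ^ D).left k ^ y * (U ^ r).left k := by
  induction y with
  | zero => simp
  | succ y ih =>
    have : D * (y + 1) + r = D + (D * y + r) := by ring
    rw [this, left_pow_add, hD, inv_one, one_mul, ih, pow_succ', mul_assoc]

end wreathPowers

/-! ### Local words -/

section localWords

variable {G H : Type*} [Group G] [Group H] {p q : ℕ} {a : Fin p → G} {b : Fin q → H}

@[fun_prop]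
theorem Computable.toList {α β : Type*} [Primcodable α] [Primcodable β] {f : α → Option β}
    (hf : Computable f) : Computable fun a => (f a).toList :=
  Primrec.optionToList.to_comp.comp hf

/-- The word over `H` that arises from a word over `G ≀ H` by deleting the letters of `G`. -/
def rightWord (u : List (Fin p ⊕ Fin q)) : List (Fin q) :=
  u.flatMap (Sum.elim (fun _ => []) fun t => [t])

/-- The positions visited by the letters of the word `u`. -/
def positions (u : List (Fin p ⊕ Fin q)) : List (List (Fin q)) :=
  (List.range u.length).map fun i => rightWord (u.take i)

/-- The word of the letters of `G` in `u` at the position `w`; here `e` decides the word problem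
of `H`. -/
def localWord (e : List (Fin q) → List (Fin q) → Bool) (u : List (Fin p ⊕ Fin q))
    (w : List (Fin q)) : List (Fin p) :=
  (List.range u.length).flatMap fun i => bif e (rightWord (u.take i)) w then
    u[i]?.toList.flatMap (Sum.elim (fun s => [s]) fun _ => []) else []

theorem right_evalWord_wreathLetter (u : List (Fin p ⊕ Fin q)) :
    (evalWord (wreathLetter a b) u).right = evalWord b (rightWord u) := by
  induction u with
  | nil => rfl
  | cons x u ih =>
    rw [evalWord_cons, RegularWreathProduct.mul_right, ih]
    cases x <;> simp [rightWord, wreathLetter]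

theorem evalWord_localWord {e : List (Fin q) → List (Fin q) → Bool}
    (he : ∀ u v, e u v = true ↔ evalWord b u = evalWord b v) (u : List (Fin p ⊕ Fin q))
    (w : List (Fin q)) :
    evalWord a (localWord e u w) = (evalWord (wreathLetter a b) u).left (evalWord b w) := by
  classical
  induction u using List.reverseRecOn with
  | nil => simp [localWord]
  | append_singleton u x ih =>
    have h1 : localWord e (u ++ [x]) w = localWord e u w ++
        bif e (rightWord u) w then Sum.elim (fun s => [s]) (fun _ => []) x else [] := by
      simp only [localWord, List.length_append, List.length_singleton, List.range_succ,
        List.flatMap_append]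
      congr 1
      · refine List.flatMap_congr fun i hi => ?_
        have hi' := List.mem_range.1 hi
        rw [List.take_append_of_le_length hi'.le, List.getElem?_append_left hi']
      · simp
    rw [h1, evalWord_append, ih, evalWord_append, RegularWreathProduct.mul_left, Pi.mul_apply]
    congr 1
    rw [right_evalWord_wreathLetter]
    by_cases h : evalWord b (rightWord u) = evalWord b w
    · rw [(he _ _).2 h, h]
      cases x <;> simp [wreathLetter]
    · have h' : e (rightWord u) w = false := by rw [← Bool.not_eq_true, he]; exact h
      have h'' : (evalWord b (rightWord u))⁻¹ * evalWord b w ≠ 1 :=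
        fun h' => h (inv_mul_eq_one.1 h')
      rw [h']
      cases x <;> simp [wreathLetter, h'']

/-- The set of the positions visited by the letters of the word `u`. -/
def posSet (b : Fin q → H) (u : List (Fin p ⊕ Fin q)) : Set H :=
  {k | ∃ w ∈ positions u, evalWord b w = k}

theorem mem_posSet_of_left_ne_one (hb : IsSymmGen b) (u : List (Fin p ⊕ Fin q)) (k : H)
    (hk : (evalWord (wreathLetter a b) u).left k ≠ 1) : k ∈ posSet b u := by
  classical
  obtain ⟨w, rfl⟩ := hb.2 k
  by_contra hn
  apply hk
  rw [← evalWord_localWord (e := fun u v => decide (evalWord b u = evalWord b v)) (by simp),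
    localWord, List.flatMap_eq_nil_iff.2, evalWord_nil]
  intro i hi
  have : evalWord b (rightWord (u.take i)) ≠ evalWord b w := fun h =>
    hn ⟨_, List.mem_map.2 ⟨i, hi, rfl⟩, h⟩
  simp [this]

section computability

variable {ι : Type*} [Primcodable ι]

@[fun_prop]
theorem Computable.rightWord {u : ι → List (Fin p ⊕ Fin q)} (hu : Computable u) :
    Computable fun i => rightWord (u i) := by
  have : Computable (Sum.elim (fun _ => []) fun t => [t] : Fin p ⊕ Fin q → List (Fin q)) :=
    Computable.of_finite _
  unfold _root_.rightWord
  fun_prop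

@[fun_prop]
theorem Computable.positions {u : ι → List (Fin p ⊕ Fin q)} (hu : Computable u) :
    Computable fun i => positions (u i) := by
  unfold _root_.positions
  fun_prop

theorem Computable.localWord {e : List (Fin q) → List (Fin q) → Bool}
    (he : Computable fun x : List (Fin q) × List (Fin q) => e x.1 x.2)
    {u : ι → List (Fin p ⊕ Fin q)} (hu : Computable u) {w : ι → List (Fin q)}
    (hw : Computable w) : Computable fun i => localWord e (u i) (w i) := by
  have h : Computable (Sum.elim (fun s => [s]) fun _ => [] : Fin p ⊕ Fin q → List (Fin p)) :=
    Computable.of_finite _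
  have he' : ∀ {κ : Type _} [Primcodable κ] {v v' : κ → List (Fin q)}, Computable v →
      Computable v' → Computable fun k => e (v k) (v' k) := fun hv hv' => he.comp (hv.pair hv')
  unfold _root_.localWord
  refine Computable.flatMap (by fun_prop) (Computable.bool_cond (he' ?_ ?_) ?_ ?_) <;> fun_prop

end computability

/-- The number `d.2` describes the translates of the positions of `u` by the powers of the element
`σ` of `H` that `u` represents: if `d.1` holds then `σ ^ d.2 = 1`, otherwise translates of
distance more than `d.2` are disjoint. -/
def IsOrderData (b : Fin q → H) (u : List (Fin p ⊕ Fin q)) (d : Bool × ℕ) : Prop :=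
  1 ≤ d.2 ∧ (d.1 = true → evalWord b (rightWord u) ^ d.2 = 1) ∧
    (d.1 = false → ∀ s, d.2 < s → ∀ w ∈ posSet b u, ∀ w' ∈ posSet b u,
      evalWord b (rightWord u) ^ s * w ≠ w')

theorem exists_isOrderData (b : Fin q → H) (u : List (Fin p ⊕ Fin q)) :
    ∃ d, IsOrderData b u d := by
  by_cases h : IsOfFinOrder (evalWord b (rightWord u))
  · obtain ⟨n, hn, h⟩ := isOfFinOrder_iff_pow_eq_one.1 h
    exact ⟨(true, n), hn, fun _ => h, by simp⟩
  · have hinj := injective_pow_iff_not_isOfFinOrder.2 h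
    have hfin : (posSet b u).Finite := by
      refine ((positions u).map (evalWord b)).finite_toSet.subset ?_
      rintro _ ⟨w, hw, rfl⟩
      exact List.mem_map.2 ⟨w, hw, rfl⟩
    have hfin' : {s : ℕ | ∃ w ∈ posSet b u, ∃ w' ∈ posSet b u,
        evalWord b (rightWord u) ^ s * w = w'}.Finite := by
      refine Set.Finite.subset (s := ⋃ w ∈ posSet b u, ⋃ w' ∈ posSet b u,
        {s : ℕ | evalWord b (rightWord u) ^ s * w = w'}) ?_ ?_
      · refine hfin.biUnion fun w _ => hfin.biUnion fun w' _ => Set.Subsingleton.finite ?_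
        intro s hs t ht
        exact hinj (mul_right_cancel ((hs : _ = _).trans (ht : _ = _).symm))
      · rintro s ⟨w, hw, w', hw', h⟩
        simp only [Set.mem_iUnion]
        exact ⟨w, hw, w', hw', h⟩
    obtain ⟨D, hD⟩ := hfin'.bddAbove
    refine ⟨(false, D + 1), by simp, by simp, fun _ s hs w hw w' hw' heq => ?_⟩
    have := hD (show s ∈ _ from ⟨w, hw, w', hw', heq⟩)
    simp only at hs
    omega

/-- The data of `IsOrderData` can be computed. -/
theorem IsKnapsackSemilinear.exists_orderData (hH : IsKnapsackSemilinear b)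
    (hb : ∀ i, ∃ j, b j = (b i)⁻¹) : ∃ δ : List (Fin p ⊕ Fin q) → Bool × ℕ, Computable δ ∧
      ∀ u, IsOrderData b u (δ u) := by
  obtain ⟨e, he, he'⟩ := hH.exists_wordEq hb
  -- a coincidence of translates of distance more than `D` is a solution of an exponent equation
  have h1 : Eff fun (x : List (Fin p ⊕ Fin q) × ℕ) ν => ν 0 = 1 ∧ x.2 + 1 ≤ ν 1 ∧
      ∃ w ∈ positions x.1, ∃ w' ∈ positions x.1,
        powProd b [(rightWord x.1, 1), (w, 0)] ν = powProd b [(w', 0)] ν := by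
    refine (Eff.eq_const (by fun_prop) (by fun_prop)).and
      ((Eff.const_le (by fun_prop) (by fun_prop)).and ?_)
    refine Eff.exists_mem (S := fun (x : List (Fin p ⊕ Fin q) × ℕ) w ν => ∃ w' ∈ positions x.1,
        powProd b [(rightWord x.1, 1), (w, 0)] ν = powProd b [(w', 0)] ν) ?_ (by fun_prop)
    refine Eff.exists_mem (S := fun (x : (List (Fin p ⊕ Fin q) × ℕ) × List (Fin q)) w' ν =>
        powProd b [(rightWord x.1.1, 1), (x.2, 0)] ν = powProd b [(w', 0)] ν) ?_ (by fun_prop)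
    exact hH.eff_eq hb (by fun_prop) (by fun_prop)
  obtain ⟨g, hg, hg'⟩ := h1.computablePred_exists.exists_computable
  have hg'' : ∀ u D, g (u, D) = false ↔ ∀ s, D < s → ∀ w ∈ posSet b u, ∀ w' ∈ posSet b u,
      evalWord b (rightWord u) ^ s * w ≠ w' := by
    intro u D
    rw [← Bool.not_eq_true, hg', ← not_iff_not, not_not]
    push Not
    constructor
    · rintro ⟨ν, h0, h1, w, hw, w', hw', h⟩
      refine ⟨ν 1, h1, _, ⟨w, hw, rfl⟩, _, ⟨w', hw', rfl⟩, ?_⟩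
      simpa [h0] using h
    · rintro ⟨s, hs, _, ⟨w, hw, rfl⟩, _, ⟨w', hw', rfl⟩, h⟩
      exact ⟨fun j => if j = 0 then 1 else s, by simp, by simpa using hs, w, hw, w', hw', by
        simpa using h⟩
  obtain ⟨δ, hδ, hδ'⟩ := Computable.exists_choice (α := List (Fin p ⊕ Fin q)) (β := Bool × ℕ)
    (check := fun u d => leTest 1 d.2 && (bif d.1 then
      e (List.replicate d.2 (rightWord u)).flatten [] else !(g (u, d.2)))) (by
      have : Computable fun x : List (Fin p ⊕ Fin q) × Bool × ℕ =>
        e (List.replicate x.2.2 (rightWord x.1)).flatten [] :=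
        he.comp (g := fun x : List (Fin p ⊕ Fin q) × Bool × ℕ =>
          ((List.replicate x.2.2 (rightWord x.1)).flatten, [])) (by fun_prop)
      fun_prop) fun u => by
      obtain ⟨⟨f, D⟩, h1, h2, h3⟩ := exists_isOrderData b u
      refine ⟨(f, D), ?_⟩
      rw [Bool.and_eq_true, leTest_iff]
      refine ⟨h1, ?_⟩
      cases f
      · rw [cond_false, Bool.not_eq_true', hg'']
        exact h3 rfl
      · rw [cond_true, he', evalWord_replicate_flatten, evalWord_nil]
        exact h2 rfl
  refine ⟨δ, hδ, fun u => ?_⟩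
  have := hδ' u
  rw [Bool.and_eq_true, leTest_iff] at this
  refine ⟨this.1, fun h => ?_, fun h => ?_⟩
  · have h2 := this.2
    rwa [h, cond_true, he', evalWord_replicate_flatten, evalWord_nil] at h2
  · have h2 := this.2
    rwa [h, cond_false, Bool.not_eq_true', hg''] at h2

end localWords

/-! ### Types of positions -/

section types

variable {G H : Type*} [Group G] [Group H] {p q : ℕ} {a : Fin p → G} {b : Fin q → H}

/-- The base of the `i`-th power in `L`. -/
def segWord {A : Type*} (L : Segs A) (i : ℕ) : List A := (L.getD i ([], 0)).1

/-- The variable of the `i`-th power in `L`. -/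
def segVar {A : Type*} (L : Segs A) (i : ℕ) : ℕ := (L.getD i ([], 0)).2

/-- A bound for the variables in `L`. For the `i`-th power, with order data `(f, D)`, the variable
`freshVar L + i` is the quotient of its exponent by `D`. -/
def freshVar {A : Type*} (L : Segs A) : ℕ := (L.map fun s => s.2).sum + 1

theorem segVar_lt {A : Type*} (L : Segs A) (i : ℕ) : segVar L i < freshVar L := by
  refine Nat.lt_succ_of_le ?_
  by_cases hi : i < L.length
  · exact List.le_sum_of_mem (List.mem_map.2 ⟨_, getD_mem hi, rfl⟩)
  · rw [segVar, List.getD_eq_default _ _ (by omega)]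
    exact Nat.zero_le _

/-- The product of the first `i` powers of `L`, mapped to `H`. -/
def rightSegs (L : Segs (Fin p ⊕ Fin q)) (i : ℕ) : Segs (Fin q) :=
  (L.take i).map fun s => (rightWord s.1, s.2)

/-- The position reached by the word `w` in the factor number `t` of the `i`-th power. -/
def posVal (b : Fin q → H) (L : Segs (Fin p ⊕ Fin q)) (i : ℕ) (w : List (Fin q)) (t : ℕ)
    (ν : ℕ → ℕ) : H :=
  powProd b (rightSegs L i) ν * (evalWord b (rightWord (segWord L i)) ^ t * evalWord b w)

/-- `posVal` as a product of powers, where the variable `x` has the value `t`. -/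
def posSegs (L : Segs (Fin p ⊕ Fin q)) (i : ℕ) (w : List (Fin q)) (x : ℕ) : Segs (Fin q) :=
  rightSegs L i ++ [(rightWord (segWord L i), x), (w, 0)]

theorem powProd_posSegs (L : Segs (Fin p ⊕ Fin q)) (i : ℕ) (w : List (Fin q)) (x : ℕ)
    (ν : ℕ → ℕ) (h0 : ν 0 = 1) : powProd b (posSegs L i w x) ν = posVal b L i w (ν x) ν := by
  simp [posSegs, posVal, h0]

theorem right_powProd (L : Segs (Fin p ⊕ Fin q)) (ν : ℕ → ℕ) :
    (powProd (wreathLetter a b) L ν).right = powProd b (rightSegs L L.length) ν := by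
  rw [rightSegs, List.take_length]
  induction L with
  | nil => rfl
  | cons s L ih =>
    rw [powProd_cons, RegularWreathProduct.mul_right, ih, List.map_cons, powProd_cons,
      ← right_evalWord_wreathLetter (a := a)]
    congr 1
    exact map_pow RegularWreathProduct.rightHom _ _

/-- The value of a product of powers at the position `h` is the product of the contributions of
its factors. -/
theorem left_powProd (L : Segs (Fin p ⊕ Fin q)) (ν : ℕ → ℕ) (h : H) :
    (powProd (wreathLetter a b) L ν).left h = ((List.range L.length).map fun i =>
      (evalWord (wreathLetter a b) (segWord L i) ^ ν (segVar L i)).left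
        ((powProd b (rightSegs L i) ν)⁻¹ * h)).prod := by
  induction L using List.reverseRecOn with
  | nil => rfl
  | append_singleton L s ih =>
    rw [powProd_append, RegularWreathProduct.mul_left, Pi.mul_apply, ih, right_powProd,
      List.length_append, List.length_singleton, List.range_succ, List.map_append, List.prod_append]
    congr 1
    · congr 1
      refine List.map_congr_left fun i hi => ?_
      have hi' := List.mem_range.1 hi
      rw [segWord, segWord, segVar, segVar, List.getD_append _ _ _ _ hi', rightSegs, rightSegs,
        List.take_append_of_le_length hi'.le]
    · simp [segWord, segVar, rightSegs]

/-- A local type `(i, hit, w, α, β)` describes how the `i`-th power visits a position `h`. If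
`hit` is false, then it does not. Otherwise, `h` is the position of `w` in the factor number `t`.
If the data of the base is `(true, D)`, then `t` can be chosen to be `α`, and `β` is the remainder
of the exponent `x` modulo `D`. If it is `(false, D)`, then `α` and `β` are the numbers of factors
before and after the factor `t`, capped at `D`. -/
abbrev LocalType (q : ℕ) : Type := ℕ × Bool × List (Fin q) × ℕ × ℕ

/-- The arithmetic condition in a local type, for order data `d`; `y` is the quotient of the
exponent `x`. -/
def LocalArith (d : Bool × ℕ) (α β t x y : ℕ) : Prop :=
  (d.1 = true ∧ t = α ∧ x = d.2 * y + β) ∨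
  (d.1 = false ∧ (α < d.2 ∧ t = α ∨ α = d.2 ∧ d.2 ≤ t) ∧
    (β < d.2 ∧ x = t + 1 + β ∨ β = d.2 ∧ t + 1 + d.2 ≤ x))

variable (b) (δ : List (Fin p ⊕ Fin q) → Bool × ℕ)

/-- The position `h` has the local type `τ` under the valuation `ν`. -/
def HasLocalType (L : Segs (Fin p ⊕ Fin q)) (τ : LocalType q) (h : H) (ν : ℕ → ℕ) : Prop :=
  τ.1 < L.length ∧
  ((τ.2.1 = false ∧ ∀ w ∈ positions (segWord L τ.1), ¬ ∃ t < ν (segVar L τ.1),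
      posVal b L τ.1 w t ν = h) ∨
    (τ.2.1 = true ∧ ∃ t < ν (segVar L τ.1), posVal b L τ.1 τ.2.2.1 t ν = h ∧
      LocalArith (δ (segWord L τ.1)) τ.2.2.2.1 τ.2.2.2.2 t (ν (segVar L τ.1))
        (ν (freshVar L + τ.1))))

/-- The possible local types for the `i`-th power. -/
def localTypes (L : Segs (Fin p ⊕ Fin q)) (i : ℕ) : List (LocalType q) :=
  (i, false, [], 0, 0) :: (positions (segWord L i)).flatMap fun w =>
    (List.range ((δ (segWord L i)).2 + 1)).flatMap fun α =>
      (List.range ((δ (segWord L i)).2 + 1)).map fun β => (i, true, w, α, β)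

/-- The types: a local type for each power. -/
def posTypes (L : Segs (Fin p ⊕ Fin q)) : List (List (LocalType q)) :=
  choices ((List.range L.length).map (localTypes δ L))

/-- Some position that is visited has the type `T`. -/
def Occurs (L : Segs (Fin p ⊕ Fin q)) (T : List (LocalType q)) (ν : ℕ → ℕ) : Prop :=
  ∃ c ∈ (List.range L.length).flatMap fun i => (positions (segWord L i)).map fun w => (i, w),
    ∃ t, ∀ τ ∈ T, HasLocalType b δ L τ (posVal b L c.1 c.2 t ν) ν

/-- The product of powers is trivial in `H`, and the quotients of the exponents have the right
values. -/
def IsGood (L : Segs (Fin p ⊕ Fin q)) (ν : ℕ → ℕ) : Prop :=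
  ν 0 = 1 ∧ powProd b (rightSegs L L.length) ν = 1 ∧ ∀ i ∈ List.range L.length,
    ∃ r ∈ List.range (δ (segWord L i)).2,
      ν (segVar L i) = (δ (segWord L i)).2 * ν (freshVar L + i) + r

variable (e : List (Fin q) → List (Fin q) → Bool)

/-- The contribution of a power at a position of local type `τ`, as a product of powers over
`G`. -/
def contribution (L : Segs (Fin p ⊕ Fin q)) (τ : LocalType q) : Segs (Fin p) :=
  bif τ.2.1 then
    bif (δ (segWord L τ.1)).1 then
      [(localWord e (List.replicate (δ (segWord L τ.1)).2 (segWord L τ.1)).flatten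
          ((List.replicate τ.2.2.2.1 (rightWord (segWord L τ.1))).flatten ++ τ.2.2.1),
          freshVar L + τ.1),
        (localWord e (List.replicate τ.2.2.2.2 (segWord L τ.1)).flatten
          ((List.replicate τ.2.2.2.1 (rightWord (segWord L τ.1))).flatten ++ τ.2.2.1), 0)]
    else
      [(localWord e (List.replicate (τ.2.2.2.1 + τ.2.2.2.2 + 1) (segWord L τ.1)).flatten
          ((List.replicate τ.2.2.2.1 (rightWord (segWord L τ.1))).flatten ++ τ.2.2.1), 0)]
  else []

variable {b δ e}

theorem right_segWord_pow (L : Segs (Fin p ⊕ Fin q)) (i : ℕ) :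
    (evalWord (wreathLetter a b) (segWord L i)).right = evalWord b (rightWord (segWord L i)) :=
  right_evalWord_wreathLetter _

/-- The local type determines the contribution of a power. -/
theorem powProd_contribution (hb : IsSymmGen b)
    (he : ∀ u v, e u v = true ↔ evalWord b u = evalWord b v)
    (hδ : ∀ u, IsOrderData b u (δ u)) {L : Segs (Fin p ⊕ Fin q)} {ν : ℕ → ℕ} (h0 : ν 0 = 1)
    {i : ℕ} {τ : LocalType q} (hτ : τ ∈ localTypes δ L i) {h : H}
    (hh : HasLocalType b δ L τ h ν) :
    powProd a (contribution δ e L τ) ν =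
      (evalWord (wreathLetter a b) (segWord L i) ^ ν (segVar L i)).left
        ((powProd b (rightSegs L i) ν)⁻¹ * h) := by
  have hQ := mem_posSet_of_left_ne_one (a := a) hb (segWord L i)
  rcases List.mem_cons.1 hτ with rfl | hτ
  · obtain ⟨-, ⟨-, hh⟩ | ⟨hf, -⟩⟩ := hh
    · symm
      rw [left_pow_eq_one hQ]
      · rfl
      · rintro t ht _ ⟨w, hw, rfl⟩ heq
        refine hh w hw ⟨t, ht, ?_⟩
        rw [right_segWord_pow] at heq
        rw [posVal, ← heq, mul_inv_cancel_left]
    · exact absurd hf (by simp)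
  · simp only [List.mem_flatMap, List.mem_map] at hτ
    obtain ⟨w, hw, α, -, β, -, rfl⟩ := hτ
    obtain ⟨-, ⟨hf, -⟩ | ⟨-, t, ht, rfl, hA⟩⟩ := hh
    · exact absurd hf (by simp)
    · dsimp only at ht hA ⊢
      have hpos : (powProd b (rightSegs L i) ν)⁻¹ * posVal b L i w t ν =
          (evalWord (wreathLetter a b) (segWord L i)).right ^ t * evalWord b w := by
        rw [posVal, inv_mul_cancel_left, right_segWord_pow]
      rw [hpos]
      obtain ⟨h1, h2, h3⟩ := hδ (segWord L i)
      rcases hA with ⟨hf, rfl, hx⟩ | ⟨hf, hα, hβ⟩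
      · rw [hx, left_pow_of_right_pow_eq_one]
        · simp only [contribution, hf, cond_true, powProd_cons, powProd_nil, mul_one, h0, pow_one]
          rw [evalWord_localWord he, evalWord_localWord he]
          simp only [evalWord_append, evalWord_replicate_flatten, right_segWord_pow]
        · rw [right_segWord_pow]
          exact h2 hf
      · rw [left_pow_of_bound hQ (D := (δ (segWord L i)).2) _ ⟨w, hw, rfl⟩ hα hβ]
        · simp only [contribution, hf, cond_true, cond_false, powProd_cons, powProd_nil, mul_one,
            h0, pow_one]
          rw [evalWord_localWord he]
          simp only [evalWord_append, evalWord_replicate_flatten, right_segWord_pow]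
        · rw [right_segWord_pow]
          exact h3 hf

/-- Every position has a local type for each power. -/
theorem exists_hasLocalType (hδ : ∀ u, IsOrderData b u (δ u)) {L : Segs (Fin p ⊕ Fin q)}
    {ν : ℕ → ℕ} (hν : IsGood b δ L ν) {i : ℕ} (hi : i < L.length) (h : H) :
    ∃ τ ∈ localTypes δ L i, HasLocalType b δ L τ h ν := by
  by_cases hhit : ∃ w ∈ positions (segWord L i), ∃ t < ν (segVar L i), posVal b L i w t ν = h
  · obtain ⟨w, hw, t, ht, rfl⟩ := hhit
    obtain ⟨h1, h2, h3⟩ := hδ (segWord L i)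
    have hmem : ∀ α β, α ≤ (δ (segWord L i)).2 → β ≤ (δ (segWord L i)).2 →
        (i, true, w, α, β) ∈ localTypes δ L i := by
      intro α β hα hβ
      refine List.mem_cons_of_mem _ ?_
      simp only [List.mem_flatMap, List.mem_map, List.mem_range]
      exact ⟨w, hw, α, by omega, β, by omega, rfl⟩
    obtain ⟨r, hr, hx⟩ := hν.2.2 i (List.mem_range.2 hi)
    have hr' := List.mem_range.1 hr
    set D := (δ (segWord L i)).2 with hD
    cases hf : (δ (segWord L i)).1
    · refine ⟨(i, true, w, min t D, min (ν (segVar L i) - 1 - t) D),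
        hmem _ _ (min_le_right _ _) (min_le_right _ _), hi, Or.inr ⟨rfl, t, ht, rfl,
          Or.inr ⟨hf, ?_, ?_⟩⟩⟩
      · dsimp only; rw [← hD]; omega
      · dsimp only; rw [← hD]; omega
    · have hlt : t % D < D := Nat.mod_lt _ h1
      refine ⟨(i, true, w, t % D, r), hmem _ _ hlt.le hr'.le, hi, Or.inr ⟨rfl, t % D,
        (Nat.mod_le _ _).trans_lt ht, ?_, Or.inl ⟨hf, rfl, hx⟩⟩⟩
      have hpow : evalWord b (rightWord (segWord L i)) ^ (t % D) =
          evalWord b (rightWord (segWord L i)) ^ t := by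
        conv_rhs => rw [← Nat.mod_add_div t D, pow_add, pow_mul, h2 hf, one_pow, mul_one]
      rw [posVal, posVal, hpow]
  · refine ⟨_, List.mem_cons_self, hi, Or.inl ⟨rfl, fun w hw ht => hhit ⟨w, hw, ht⟩⟩⟩

/-- The value at a position is determined by the type of the position. -/
theorem powProd_contributions (hb : IsSymmGen b)
    (he : ∀ u v, e u v = true ↔ evalWord b u = evalWord b v)
    (hδ : ∀ u, IsOrderData b u (δ u)) {L : Segs (Fin p ⊕ Fin q)} {ν : ℕ → ℕ} (h0 : ν 0 = 1)
    {T : List (LocalType q)} (hT : T ∈ posTypes δ L) {h : H}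
    (hh : ∀ τ ∈ T, HasLocalType b δ L τ h ν) :
    powProd a (T.flatMap (contribution δ e L)) ν =
      (powProd (wreathLetter a b) L ν).left h := by
  rw [posTypes, mem_choices, List.forall₂_iff_get] at hT
  obtain ⟨hlen, hT⟩ := hT
  have hlen' : T.length = L.length := by simpa using hlen
  rw [left_powProd, powProd_flatMap, map_eq_map_range T _ (0, false, [], 0, 0), hlen']
  congr 1
  refine List.map_congr_left fun i hi => ?_
  have hi' : i < T.length := by rw [hlen']; exact List.mem_range.1 hi
  have := hT i hi' (by simpa using List.mem_range.1 hi)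
  refine powProd_contribution hb he hδ h0 ?_ (hh _ (getD_mem hi'))
  rw [List.getD_eq_getElem (hn := hi')]
  simpa using this

theorem exists_posType (hδ : ∀ u, IsOrderData b u (δ u)) {L : Segs (Fin p ⊕ Fin q)}
    {ν : ℕ → ℕ} (hν : IsGood b δ L ν) (h : H) :
    ∃ T ∈ posTypes δ L, ∀ τ ∈ T, HasLocalType b δ L τ h ν := by
  choose! τ hτ hτ' using fun i (hi : i < L.length) => exists_hasLocalType hδ hν hi h
  refine ⟨(List.range L.length).map τ, ?_, ?_⟩
  · rw [posTypes, mem_choices, List.forall₂_map_left_iff, List.forall₂_map_right_iff,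
      List.forall₂_same]
    exact fun i hi => hτ i (List.mem_range.1 hi)
  · intro x hx
    obtain ⟨i, hi, rfl⟩ := List.mem_map.1 hx
    exact hτ' i (List.mem_range.1 hi)

theorem posVal_congr {L : Segs (Fin p ⊕ Fin q)} {ν μ : ℕ → ℕ}
    (h : ∀ j < freshVar L, ν j = μ j) (i : ℕ) (w : List (Fin q)) (t : ℕ) :
    posVal b L i w t ν = posVal b L i w t μ := by
  rw [posVal, posVal, powProd_congr]
  intro s hs
  obtain ⟨s', hs', rfl⟩ := List.mem_map.1 hs
  refine h _ (Nat.lt_succ_of_le (List.le_sum_of_mem ?_))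
  exact List.mem_map.2 ⟨s', List.mem_of_mem_take hs', rfl⟩

theorem hasLocalType_congr {L : Segs (Fin p ⊕ Fin q)} {ν μ : ℕ → ℕ}
    (h : ∀ j < freshVar L + L.length, ν j = μ j) (τ : LocalType q) (k : H) :
    HasLocalType b δ L τ k ν ↔ HasLocalType b δ L τ k μ := by
  refine and_congr_right fun hτ => ?_
  have h1 : ∀ w t, posVal b L τ.1 w t ν = posVal b L τ.1 w t μ := fun w t =>
    posVal_congr (fun j hj => h j (by omega)) _ _ _
  rw [h (segVar L τ.1) ((segVar_lt L τ.1).trans_le (by omega)), h (freshVar L + τ.1) (by omega)]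
  simp only [h1]

/-- All sublists of `l`: for each element, a choice is made whether to keep it. -/
def subLists {α : Type*} (l : List α) : List (List α) :=
  (choices (l.map fun x => [[x], []])).map List.flatten

theorem filter_mem_subLists {α : Type*} (l : List α) (P : α → Bool) : l.filter P ∈ subLists l := by
  refine List.mem_map.2 ⟨l.map fun x => if P x then [x] else [], ?_, ?_⟩
  · rw [mem_choices, List.forall₂_map_left_iff, List.forall₂_map_right_iff, List.forall₂_same]
    intro x _
    by_cases h : P x <;> simp [h]
  · induction l with
    | nil => rfl
    | cons x l ih => by_cases h : P x <;> simp [h, ih]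

/-- A solution exists if and only if there are a set `C` of types and a valuation such that all
types that occur lie in `C`, and such that all types in `C` have a trivial value. -/
theorem exists_powProd_eq_one_iff (hb : IsSymmGen b)
    (he : ∀ u v, e u v = true ↔ evalWord b u = evalWord b v)
    (hδ : ∀ u, IsOrderData b u (δ u)) (L : Segs (Fin p ⊕ Fin q)) :
    (∃ ν, ν 0 = 1 ∧ powProd (wreathLetter a b) L ν = 1) ↔
      ∃ C ∈ subLists (posTypes δ L), ∃ ν,
        (IsGood b δ L ν ∧ ∀ T ∈ posTypes δ L, Occurs b δ L T ν → T ∈ C) ∧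
        ∀ M ∈ C.map fun T => T.flatMap (contribution δ e L), powProd a M ν = 1 := by
  classical
  constructor
  · rintro ⟨ν₀, h0, hL⟩
    let ν : ℕ → ℕ := fun j => if j < freshVar L then ν₀ j else
      ν₀ (segVar L (j - freshVar L)) / (δ (segWord L (j - freshVar L))).2
    have hlt : ∀ j < freshVar L, ν j = ν₀ j := fun j hj => if_pos hj
    have hL' : powProd (wreathLetter a b) L ν = 1 := by
      rw [← hL]
      exact powProd_congr fun s hs => hlt _ (Nat.lt_succ_of_le (List.le_sum_of_mem
        (List.mem_map.2 ⟨s, hs, rfl⟩)))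
    have h0' : ν 0 = 1 := (hlt 0 (Nat.succ_pos _)).trans h0
    have hgood : IsGood b δ L ν := by
      refine ⟨h0', by rw [← right_powProd (a := a), hL']; rfl, fun i _ => ?_⟩
      refine ⟨ν₀ (segVar L i) % (δ (segWord L i)).2,
        List.mem_range.2 (Nat.mod_lt _ (hδ _).1), ?_⟩
      have : ν (freshVar L + i) = ν₀ (segVar L i) / (δ (segWord L i)).2 := by
        simp only [ν]
        rw [if_neg (by omega), Nat.add_sub_cancel_left]
      rw [hlt _ (segVar_lt L i), this, Nat.div_add_mod]
    refine ⟨_, filter_mem_subLists (posTypes δ L) fun T =>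
      decide (powProd a (T.flatMap (contribution δ e L)) ν = 1), ν, ⟨hgood, ?_⟩, ?_⟩
    · rintro T hT ⟨c, -, t, hc⟩
      rw [List.mem_filter, decide_eq_true_eq, powProd_contributions hb he hδ h0' hT hc, hL']
      exact ⟨hT, rfl⟩
    · intro M hM
      obtain ⟨T, hT, rfl⟩ := List.mem_map.1 hM
      simpa using (List.mem_filter.1 hT).2
  · rintro ⟨C, -, ν, ⟨hgood, hC⟩, hν⟩
    refine ⟨ν, hgood.1, ?_⟩
    ext h
    · rw [RegularWreathProduct.one_left, Pi.one_apply]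
      by_cases hc : ∃ c ∈ (List.range L.length).flatMap fun i =>
          (positions (segWord L i)).map fun w => (i, w), ∃ t, posVal b L c.1 c.2 t ν = h
      · obtain ⟨c, hc, t, rfl⟩ := hc
        obtain ⟨T, hT, hT'⟩ := exists_posType hδ hgood (posVal b L c.1 c.2 t ν)
        rw [← powProd_contributions (e := e) hb he hδ hgood.1 hT hT']
        exact hν _ (List.mem_map.2 ⟨T, hC T hT ⟨c, hc, t, hT'⟩, rfl⟩)
      · -- a position that is not visited has the value `1`
        rw [left_powProd, List.prod_eq_one]
        intro g hg
        obtain ⟨i, hi, rfl⟩ := List.mem_map.1 hg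
        refine left_pow_eq_one (mem_posSet_of_left_ne_one hb _) ?_
        rintro t - _ ⟨w, hw, rfl⟩ heq
        refine hc ⟨(i, w), List.mem_flatMap.2 ⟨i, hi, List.mem_map.2 ⟨w, hw, rfl⟩⟩, t, ?_⟩
        rw [right_segWord_pow] at heq
        rw [posVal, ← heq, mul_inv_cancel_left]
    · rw [right_powProd, hgood.2.1]
      rfl

end types

/-! ### The conditions on types are effectively semilinear -/

section effective

variable {ι H : Type*} [Primcodable ι] [Group H] {p q : ℕ} {b : Fin q → H}
  {δ : List (Fin p ⊕ Fin q) → Bool × ℕ}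

@[fun_prop]
theorem Computable.segWord {A : Type*} [Primcodable A] {L : ι → Segs A} {i : ι → ℕ}
    (hL : Computable L) (hi : Computable i) : Computable fun x => segWord (L x) (i x) := by
  unfold _root_.segWord
  fun_prop

@[fun_prop]
theorem Computable.segVar {A : Type*} [Primcodable A] {L : ι → Segs A} {i : ι → ℕ}
    (hL : Computable L) (hi : Computable i) : Computable fun x => segVar (L x) (i x) := by
  unfold _root_.segVar
  fun_prop

@[fun_prop]
theorem Computable.freshVar {A : Type*} [Primcodable A] {L : ι → Segs A}
    (hL : Computable L) : Computable fun x => freshVar (L x) := by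
  unfold _root_.freshVar
  fun_prop

@[fun_prop]
theorem Computable.rightSegs {L : ι → Segs (Fin p ⊕ Fin q)} {i : ι → ℕ}
    (hL : Computable L) (hi : Computable i) : Computable fun x => rightSegs (L x) (i x) := by
  unfold _root_.rightSegs
  fun_prop

@[fun_prop]
theorem Computable.posSegs {L : ι → Segs (Fin p ⊕ Fin q)} {i : ι → ℕ} {w : ι → List (Fin q)}
    {v : ι → ℕ} (hL : Computable L) (hi : Computable i) (hw : Computable w) (hv : Computable v) :
    Computable fun x => posSegs (L x) (i x) (w x) (v x) := by
  unfold _root_.posSegs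
  fun_prop

theorem Computable.localTypes (hδ : Computable δ) {L : ι → Segs (Fin p ⊕ Fin q)} {i : ι → ℕ}
    (hL : Computable L) (hi : Computable i) : Computable fun x => localTypes δ (L x) (i x) := by
  unfold _root_.localTypes
  fun_prop

theorem Computable.posTypes (hδ : Computable δ) : Computable (posTypes δ) := by
  have := Computable.localTypes hδ (ι := Segs (Fin p ⊕ Fin q) × ℕ) (L := fun x => x.1)
    (i := fun x => x.2) (by fun_prop) (by fun_prop)
  unfold _root_.posTypes
  fun_prop

theorem Computable.contribution (hδ : Computable δ) {e : List (Fin q) → List (Fin q) → Bool}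
    (he : Computable fun x : List (Fin q) × List (Fin q) => e x.1 x.2) :
    Computable fun x : Segs (Fin p ⊕ Fin q) × LocalType q => contribution δ e x.1 x.2 := by
  have h1 := Computable.localWord he (ι := Segs (Fin p ⊕ Fin q) × LocalType q) (p := p)
    (u := fun x => (List.replicate (δ (_root_.segWord x.1 x.2.1)).2
      (_root_.segWord x.1 x.2.1)).flatten)
    (w := fun x => (List.replicate x.2.2.2.2.1
      (_root_.rightWord (_root_.segWord x.1 x.2.1))).flatten ++ x.2.2.2.1)
    (by fun_prop) (by fun_prop)
  have h2 := Computable.localWord he (ι := Segs (Fin p ⊕ Fin q) × LocalType q) (p := p)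
    (u := fun x => (List.replicate x.2.2.2.2.2 (_root_.segWord x.1 x.2.1)).flatten)
    (w := fun x => (List.replicate x.2.2.2.2.1
      (_root_.rightWord (_root_.segWord x.1 x.2.1))).flatten ++ x.2.2.2.1)
    (by fun_prop) (by fun_prop)
  have h3 := Computable.localWord he (ι := Segs (Fin p ⊕ Fin q) × LocalType q) (p := p)
    (u := fun x => (List.replicate (x.2.2.2.2.1 + x.2.2.2.2.2 + 1)
      (_root_.segWord x.1 x.2.1)).flatten)
    (w := fun x => (List.replicate x.2.2.2.2.1
      (_root_.rightWord (_root_.segWord x.1 x.2.1))).flatten ++ x.2.2.2.1)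
    (by fun_prop) (by fun_prop)
  unfold _root_.contribution
  fun_prop

@[fun_prop]
theorem Computable.subLists {α : Type*} [Primcodable α] {l : ι → List α} (hl : Computable l) :
    Computable fun x => subLists (l x) := by
  unfold _root_.subLists
  fun_prop

theorem eff_localArith {d : ι → Bool × ℕ} {α β t x y : ι → ℕ} (hd : Computable d)
    (hα : Computable α) (hβ : Computable β) (ht : Computable t) (hx : Computable x)
    (hy : Computable y) (hxy : ∀ i, x i ≠ y i) (hxt : ∀ i, x i ≠ t i) :
    Eff fun i ν => LocalArith (d i) (α i) (β i) (ν (t i)) (ν (x i)) (ν (y i)) := by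
  have h1 := Eff.const (p := fun i => (d i).1) (by fun_prop)
  have h2 := Eff.const (p := fun i => !(d i).1) (by fun_prop)
  have h3 := Eff.eq_const ht hα
  have h4 := Eff.affine_eq hx hy (D := fun i => (d i).2) (by fun_prop) hβ hxy
  have h5 := Eff.const (p := fun i => leTest (α i + 1) (d i).2) (by fun_prop)
  have h6 := Eff.const (p := fun i => eqTest (α i) (d i).2) (by fun_prop)
  have h7 := Eff.const_le ht (r := fun i => (d i).2) (by fun_prop)
  have h8 := Eff.const (p := fun i => leTest (β i + 1) (d i).2) (by fun_prop)
  have h9 := Eff.const (p := fun i => eqTest (β i) (d i).2) (by fun_prop)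
  have h10 := Eff.affine_eq hx ht (D := fun _ => 1) (r := fun i => 1 + β i) (by fun_prop)
    (by fun_prop) hxt
  have h11 := Eff.affine_le hx ht (D := fun _ => 1) (r := fun i => 1 + (d i).2) (by fun_prop)
    (by fun_prop) hxt
  refine ((h1.and (h3.and h4)).or (h2.and (((h5.and h3).or (h6.and h7)).and
    ((h8.and h10).or (h9.and h11))))).of_iff fun i ν => ?_
  simp only [LocalArith, leTest_iff, eqTest_iff, Nat.succ_le_iff, one_mul, add_assoc,
    Bool.not_eq_true']

/-- For the index `((L, i, w), τ)`, the predicate that the position of the word `w` in the factor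
number `t` of the `i`-th power of `L` has the local type `τ`. Here `t` is the value of the first
variable after the quotients of the exponents. -/
theorem eff_hasLocalType (hH : IsKnapsackSemilinear b) (hb : ∀ i, ∃ j, b j = (b i)⁻¹)
    (hδ : Computable δ) :
    Eff fun (x : (Segs (Fin p ⊕ Fin q) × ℕ × List (Fin q)) × LocalType q) ν => ν 0 = 1 ∧
      HasLocalType b δ x.1.1 x.2
        (posVal b x.1.1 x.1.2.1 x.1.2.2 (ν (freshVar x.1.1 + x.1.1.length)) ν) ν := by
  have h0 : Eff fun (_ : (Segs (Fin p ⊕ Fin q) × ℕ × List (Fin q)) × LocalType q) ν =>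
    ν 0 = 1 := Eff.eq_const (by fun_prop) (by fun_prop)
  have hlen := Eff.const (p := fun x : (Segs (Fin p ⊕ Fin q) × ℕ × List (Fin q)) × LocalType q =>
    leTest (x.2.1 + 1) x.1.1.length) (by fun_prop)
  have hf := Eff.const (p := fun x : (Segs (Fin p ⊕ Fin q) × ℕ × List (Fin q)) × LocalType q =>
    !x.2.2.1) (by fun_prop)
  have ht := Eff.const (p := fun x : (Segs (Fin p ⊕ Fin q) × ℕ × List (Fin q)) × LocalType q =>
    x.2.2.1) (by fun_prop)
  -- the word `w` in some factor of the power visits the position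
  have hvisit : ∀ {κ : Type} [Primcodable κ]
      {f : κ → (Segs (Fin p ⊕ Fin q) × ℕ × List (Fin q)) × LocalType q} {w : κ → List (Fin q)}
      {A : κ → (ℕ → ℕ) → Prop}, Computable f → Computable w → Eff A →
      Eff fun k ν => ∃ μ : ℕ → ℕ, (∀ j < freshVar (f k).1.1 + (f k).1.1.length + 1, μ j = ν j) ∧
        (μ 0 = 1 ∧ 1 * μ (freshVar (f k).1.1 + (f k).1.1.length + 1) + 1 ≤
            μ (segVar (f k).1.1 (f k).2.1) ∧
          powProd b (posSegs (f k).1.1 (f k).2.1 (w k)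
              (freshVar (f k).1.1 + (f k).1.1.length + 1)) μ =
            powProd b (posSegs (f k).1.1 (f k).1.2.1 (f k).1.2.2
              (freshVar (f k).1.1 + (f k).1.1.length)) μ ∧ A k μ) := by
    intro κ _ f w A hf hw hA
    refine Eff.exists_ge ((Eff.eq_const (by fun_prop) (by fun_prop)).and
      ((Eff.affine_le (by fun_prop) (by fun_prop) (by fun_prop) (by fun_prop) fun k => ?_).and
        ((hH.eff_eq hb (by fun_prop) (by fun_prop)).and hA))) (by fun_prop)
    have := segVar_lt (f k).1.1 (f k).2.1
    omega
  have hvisit' : ∀ (x : (Segs (Fin p ⊕ Fin q) × ℕ × List (Fin q)) × LocalType q)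
      (w : List (Fin q)) (A : ℕ → (ℕ → ℕ) → Prop) (ν : ℕ → ℕ), ν 0 = 1 →
      (∀ t μ, (∀ j < freshVar x.1.1 + x.1.1.length, μ j = ν j) → (A t μ ↔ A t ν)) →
      ((∃ μ : ℕ → ℕ, (∀ j < freshVar x.1.1 + x.1.1.length + 1, μ j = ν j) ∧
        (μ 0 = 1 ∧ 1 * μ (freshVar x.1.1 + x.1.1.length + 1) + 1 ≤ μ (segVar x.1.1 x.2.1) ∧
          powProd b (posSegs x.1.1 x.2.1 w (freshVar x.1.1 + x.1.1.length + 1)) μ =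
            powProd b (posSegs x.1.1 x.1.2.1 x.1.2.2 (freshVar x.1.1 + x.1.1.length)) μ ∧
          A (μ (freshVar x.1.1 + x.1.1.length + 1)) μ)) ↔
      ∃ t < ν (segVar x.1.1 x.2.1), posVal b x.1.1 x.2.1 w t ν =
        posVal b x.1.1 x.1.2.1 x.1.2.2 (ν (freshVar x.1.1 + x.1.1.length)) ν ∧ A t ν) := by
    intro x w A ν hν0 hA
    have hx := segVar_lt x.1.1 x.2.1
    constructor
    · rintro ⟨μ, hμ, hμ0, hle, heq, hAμ⟩
      have hseg := hμ (segVar x.1.1 x.2.1) (by omega)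
      refine ⟨μ (freshVar x.1.1 + x.1.1.length + 1), by omega, ?_,
        (hA _ μ fun j hj => hμ j (by omega)).1 hAμ⟩
      · rw [powProd_posSegs _ _ _ _ _ hμ0, powProd_posSegs _ _ _ _ _ hμ0,
          posVal_congr (μ := ν) fun j hj => hμ j (by omega),
          posVal_congr (μ := ν) fun j hj => hμ j (by omega),
          hμ (freshVar x.1.1 + x.1.1.length) (by omega)] at heq
        exact heq
    · rintro ⟨t, htx, heq, hAt⟩
      let μ := Function.update ν (freshVar x.1.1 + x.1.1.length + 1) t
      have hμ : ∀ j < freshVar x.1.1 + x.1.1.length + 1, μ j = ν j := fun j hj =>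
        Function.update_of_ne (by omega) _ _
      have hμt : μ (freshVar x.1.1 + x.1.1.length + 1) = t := Function.update_self _ _ _
      have hμ0 : μ 0 = 1 := (hμ 0 (by omega)).trans hν0
      refine ⟨μ, hμ, hμ0, ?_, ?_, ?_⟩
      · rw [hμt, hμ _ (by omega)]
        omega
      · rw [powProd_posSegs _ _ _ _ _ hμ0, powProd_posSegs _ _ _ _ _ hμ0, hμt,
          posVal_congr (μ := ν) fun j hj => hμ j (by omega),
          posVal_congr (μ := ν) fun j hj => hμ j (by omega),
          hμ (freshVar x.1.1 + x.1.1.length) (by omega)]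
        exact heq
      · rw [hμt]
        exact (hA _ μ fun j hj => hμ j (by omega)).2 hAt
  have hnohit := Eff.forall_mem
    (S := fun (x : (Segs (Fin p ⊕ Fin q) × ℕ × List (Fin q)) × LocalType q) w ν => ¬ ∃ μ : ℕ → ℕ,
      (∀ j < freshVar x.1.1 + x.1.1.length + 1, μ j = ν j) ∧
        (μ 0 = 1 ∧ 1 * μ (freshVar x.1.1 + x.1.1.length + 1) + 1 ≤ μ (segVar x.1.1 x.2.1) ∧
          powProd b (posSegs x.1.1 x.2.1 w (freshVar x.1.1 + x.1.1.length + 1)) μ =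
            powProd b (posSegs x.1.1 x.1.2.1 x.1.2.2 (freshVar x.1.1 + x.1.1.length)) μ ∧ True))
    (l := fun x => positions (segWord x.1.1 x.2.1))
    (hvisit (κ := ((Segs (Fin p ⊕ Fin q) × ℕ × List (Fin q)) × LocalType q) × List (Fin q))
      (f := fun k => k.1) (w := fun k => k.2) (A := fun _ _ => True) (by fun_prop) (by fun_prop)
      ((Eff.const (p := fun _ => true) (by fun_prop)).of_iff fun i ν => by simp)).not (by fun_prop)
  have hhit := hvisit (f := fun k => k) (w := fun k => k.2.2.2.1) (A := fun k μ =>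
      k.2.1 < k.1.1.length → LocalArith (δ (segWord k.1.1 k.2.1)) k.2.2.2.2.1 k.2.2.2.2.2
        (μ (freshVar k.1.1 + k.1.1.length + 1)) (μ (segVar k.1.1 k.2.1))
        (μ (freshVar k.1.1 + k.2.1))) (by fun_prop) (by fun_prop) (by
      have hA := eff_localArith
        (d := fun k : (Segs (Fin p ⊕ Fin q) × ℕ × List (Fin q)) × LocalType q =>
          δ (segWord k.1.1 k.2.1)) (α := fun k => k.2.2.2.2.1) (β := fun k => k.2.2.2.2.2)
        (t := fun k => freshVar k.1.1 + k.1.1.length + 1) (x := fun k => segVar k.1.1 k.2.1)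
        (y := fun k => freshVar k.1.1 + k.2.1) (by fun_prop) (by fun_prop) (by fun_prop)
        (by fun_prop) (by fun_prop) (by fun_prop)
        (fun k => by have := segVar_lt k.1.1 k.2.1; omega)
        (fun k => by have := segVar_lt k.1.1 k.2.1; omega)
      refine (hlen.imp hA).of_iff fun k ν => ?_
      simp only [leTest_iff, Nat.succ_le_iff])
  refine (h0.and (hlen.and ((hf.and hnohit).or (ht.and hhit)))).of_iff fun x ν => ?_
  refine and_congr_right fun hν0 => ?_
  rw [leTest_iff, Nat.succ_le_iff]
  refine and_congr_right fun hi => or_congr (and_congr (by simp) ?_) (and_congr_right fun _ => ?_)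
  · refine forall₂_congr fun w _ => not_congr ?_
    rw [hvisit' x w (fun _ _ => True) ν hν0 fun _ _ _ => Iff.rfl]
    simp
  · have := hvisit' x x.2.2.2.1 (fun t μ => x.2.1 < x.1.1.length →
      LocalArith (δ (segWord x.1.1 x.2.1)) x.2.2.2.2.1 x.2.2.2.2.2 t (μ (segVar x.1.1 x.2.1))
        (μ (freshVar x.1.1 + x.2.1))) ν hν0 fun t μ hμ => by
          rw [hμ _ ((segVar_lt _ _).trans_le (by omega))]
          exact imp_congr_right fun hi => by rw [hμ _ (by omega)]
    rw [this]
    simp only [hi, true_imp_iff]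

theorem eff_isGood (hH : IsKnapsackSemilinear b) (hδ : Computable δ) :
    Eff fun (L : Segs (Fin p ⊕ Fin q)) ν => IsGood b δ L ν := by
  refine (Eff.eq_const (by fun_prop) (by fun_prop)).and
    ((hH.eff_eq_one (by fun_prop)).and ?_)
  refine Eff.forall_mem (S := fun (L : Segs (Fin p ⊕ Fin q)) i ν =>
    ∃ r ∈ List.range (δ (segWord L i)).2,
      ν (segVar L i) = (δ (segWord L i)).2 * ν (freshVar L + i) + r) ?_ (by fun_prop)
  refine Eff.exists_mem (S := fun (x : Segs (Fin p ⊕ Fin q) × ℕ) r ν =>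
      ν (segVar x.1 x.2) = (δ (segWord x.1 x.2)).2 * ν (freshVar x.1 + x.2) + r) ?_ (by fun_prop)
  refine Eff.affine_eq (by fun_prop) (by fun_prop) (by fun_prop) (by fun_prop) fun x => ?_
  have := segVar_lt x.1.1 x.1.2
  omega

theorem eff_occurs (hH : IsKnapsackSemilinear b) (hb : ∀ i, ∃ j, b j = (b i)⁻¹)
    (hδ : Computable δ) : Eff fun (x : Segs (Fin p ⊕ Fin q) × List (LocalType q)) ν =>
      ν 0 = 1 ∧ Occurs b δ x.1 x.2 ν := by
  have h1 := eff_hasLocalType (p := p) hH hb hδ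
  have h2 : Eff fun (y : (Segs (Fin p ⊕ Fin q) × List (LocalType q)) × ℕ × List (Fin q)) ν =>
      ∀ τ ∈ y.1.2, ν 0 = 1 ∧ HasLocalType b δ y.1.1 τ
        (posVal b y.1.1 y.2.1 y.2.2 (ν (freshVar y.1.1 + y.1.1.length)) ν) ν :=
    Eff.forall_mem (S := fun (y : (Segs (Fin p ⊕ Fin q) × List (LocalType q)) ×
        ℕ × List (Fin q)) τ ν => ν 0 = 1 ∧ HasLocalType b δ y.1.1 τ
        (posVal b y.1.1 y.2.1 y.2.2 (ν (freshVar y.1.1 + y.1.1.length)) ν) ν)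
      (h1.comp (g := fun z : ((Segs (Fin p ⊕ Fin q) × List (LocalType q)) × ℕ × List (Fin q)) ×
        LocalType q => ((z.1.1.1, z.1.2), z.2)) (by fun_prop)) (by fun_prop)
  have h3 := h2.exists_ge (N := fun y => freshVar y.1.1 + y.1.1.length) (by fun_prop)
  have h4 := Eff.exists_mem (S := fun (x : Segs (Fin p ⊕ Fin q) × List (LocalType q))
      (c : ℕ × List (Fin q)) ν => ∃ μ : ℕ → ℕ,
        (∀ j < freshVar x.1 + x.1.length, μ j = ν j) ∧ ∀ τ ∈ x.2, μ 0 = 1 ∧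
        HasLocalType b δ x.1 τ (posVal b x.1 c.1 c.2 (μ (freshVar x.1 + x.1.length)) μ) μ)
    (l := fun x => (List.range x.1.length).flatMap fun i =>
      (positions (segWord x.1 i)).map fun w => (i, w)) h3 (by fun_prop)
  refine ((Eff.eq_const (x := fun _ => 0) (r := fun _ => 1) (by fun_prop)
    (by fun_prop)).and h4).of_iff fun x ν => ?_
  refine and_congr_right fun hν0 => exists_congr fun c => and_congr_right fun _ => ?_
  constructor
  · rintro ⟨t, ht⟩
    let μ := Function.update ν (freshVar x.1 + x.1.length) t
    have hμ : ∀ j < freshVar x.1 + x.1.length, μ j = ν j := fun j hj =>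
      Function.update_of_ne (by omega) _ _
    have hμt : μ (freshVar x.1 + x.1.length) = t := Function.update_self _ _ _
    refine ⟨μ, hμ, fun τ hτ => ⟨(hμ 0 ?_).trans hν0, ?_⟩⟩
    · have := segVar_lt x.1 0
      omega
    · rw [hasLocalType_congr hμ, hμt, posVal_congr fun j hj => hμ j (by omega)]
      exact ht τ hτ
  · rintro ⟨μ, hμ, h⟩
    refine ⟨μ (freshVar x.1 + x.1.length), fun τ hτ => ?_⟩
    have := (h τ hτ).2
    rwa [hasLocalType_congr hμ, posVal_congr fun j hj => hμ j (by omega)] at this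

/-- If systems of exponent equations over `G` are decidable, then so are equations between
products of powers over `G ≀ H`. -/
theorem ExpEqDecidable.wreathLetter {G : Type*} [Group G] {a : Fin p → G} (hb : IsSymmGen b)
    (hH : IsKnapsackSemilinear b) (h : ExpEqDecidable a) :
    ComputablePred fun L : Segs (Fin p ⊕ Fin q) =>
      ∃ ν, ν 0 = 1 ∧ powProd (wreathLetter a b) L ν = 1 := by
  obtain ⟨e, he, he'⟩ := hH.exists_wordEq hb.1
  obtain ⟨δ, hδ, hδ'⟩ := hH.exists_orderData (p := p) hb.1
  have hpt := Computable.posTypes hδ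
  have hcon := Computable.contribution hδ he
  have h1 : Eff fun (x : Segs (Fin p ⊕ Fin q) × List (List (LocalType q))) ν =>
      IsGood b δ x.1 ν ∧ ∀ T ∈ posTypes δ x.1, ν 0 = 1 ∧ Occurs b δ x.1 T ν → T ∈ x.2 := by
    refine ((eff_isGood hH hδ).comp (g := fun x : Segs (Fin p ⊕ Fin q) ×
      List (List (LocalType q)) => x.1) (by fun_prop)).and ?_
    refine Eff.forall_mem (S := fun (x : Segs (Fin p ⊕ Fin q) × List (List (LocalType q)))
      T ν => ν 0 = 1 ∧ Occurs b δ x.1 T ν → T ∈ x.2) ?_ (by fun_prop)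
    refine (((eff_occurs hH hb.1 hδ).comp (g := fun y : (Segs (Fin p ⊕ Fin q) ×
      List (List (LocalType q))) × List (LocalType q) => (y.1.1, y.2)) (by fun_prop)).imp
      (Eff.const (p := fun y => memTest y.2 y.1.2) (by fun_prop))).of_iff fun y ν => ?_
    rw [memTest_iff]
  obtain ⟨d, hd, hd'⟩ := (h.exists_of_eff h1 (M := fun x => x.2.map fun T =>
    T.flatMap (contribution δ e x.1)) (by fun_prop)).exists_computable
  refine ComputablePred.of_computable
    (f := fun L => (subLists (posTypes δ L)).any fun C => d (L, C)) (by fun_prop) fun L => ?_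
  rw [exists_powProd_eq_one_iff hb he' hδ']
  simp only [List.any_eq_true, hd']
  refine exists_congr fun C => and_congr_right fun _ => exists_congr fun ν =>
    and_congr_left fun _ => and_congr_right fun hg => ?_
  simp only [hg.1, true_and]

end effective

/-! ### Knapsack for wreath products -/

theorem mainTheorem2 {G H : Type*} [Group G] [Group H] {p q r : ℕ}
    (a : Fin p → G) (ha : IsSymmGen a)
    (b : Fin q → H) (hb : IsSymmGen b)
    (c : Fin r → wreath G H) (hc : IsSymmGen c)
    (hH : IsKnapsackSemilinear b) :
    (Infinite H → (KPDecidable c ↔ KPPowersDecidable a)) ∧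
      (KPPowersDecidable a → KPDecidable c) ∧
      (KPPowersDecidable a ↔ ExpEqDecidable a) := by
  have h3 : KPPowersDecidable a ↔ ExpEqDecidable a :=
    ⟨KPPowersDecidable.expEq ha.1, ExpEqDecidable.kpPowers⟩
  have h2 : KPPowersDecidable a → KPDecidable c := fun h =>
    KPDecidable.of_wreathLetter ha hb c (ExpEqDecidable.wreathLetter hb hH (h3.1 h))
  exact ⟨fun _ => ⟨KPDecidable.kpPowers hb hH hc, h2⟩, h2, h3⟩
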